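/- Let $1<p<N$, $p+m-3>0$, $0<\alpha_1\le\alpha_2<p$, and let $g\in C([0,\infty))\cap C^1((0,\infty))$ satisfy $g(0)=0$, $g(s)>0$ and $\alpha_1 g(s)/s\le g'(s)\le\alpha_2 g(s)/s$ for $s>0$. Put $f(x)=e^{g(|x|)}$ for $x\in\mathbb R^N$, $S_\infty=\mathbb R^N\times(0,\infty)$, and consider $$ f\,u_t-\operatorname{div}\big(f\,u^{m-1}|\nabla u|^{p-2}\nabla u\big)=0\ \text{ in } S_\infty,\qquad u(\cdot,0)=u_0. \tag{1}$$ A weak solution [subsolution] of the equation is a function $u\ge0$ with $u\in C([0,\infty);L^1_f(\mathbb R^N))$, $u\in L^\infty(\mathbb R^N\times(\bar t,\infty))$ for every $\bar t>0$, $\nabla u^{q}\in L^p_{\rm loc}(S_\infty)$ with $q=\frac{p+m-2}{p-1}$, and $$\iint_{S_\infty}\{-u\,\eta_t+u^{m-1}|\nabla u|^{p-2}\nabla u\cdot\nabla\eta\}\,f\,dx\,dt=0\quad[\le 0]$$ for all $\eta\in C_0^\infty(S_\infty)$ [all $\eta\in C_0^\infty(S_\infty)$ with $\eta\ge0$], where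 the flux $u^{m-1}|\nabla u|^{p-2}\nabla u$ is understood as $q^{1-p}|\nabla u^{q}|^{p-2}\nabla u^{q}$. It is strong if moreover $u_t\in L^\infty_{\rm loc}((0,\infty);L^1_{f,{\rm loc}}(\mathbb R^N))$. A solution of the Cauchy problem (1) also satisfies $u(\cdot,0)=u_0$ a.e. Here $L^1_f$ is $L^1$ with respect to the measure $f\,dx$. For $r=|x|$, let $G(r)=\int_0^r g(s)s^{-1}\,ds$, $J(r)=r^p/G(r)$, $E(\tau)=J(G^{-1}(\tau))$, and for constants $C_*,\Gamma,r_0>0$, $t_0>1$, $\nu_0\in(0,1)$ let $\tau=\Gamma\log(t+t_0)$, $$I(r)=\nu_0\Big(\frac{r^p}{G(r_0)}\Big)^{\frac1{p-1}}+(1-\nu_0)J(r_0)^{\frac1{p-1}},$$ $$\tilde u(x,t)=\frac{C_*}{(t+t_0)^{\frac1{p+m-3}}}\Big[E(\tau)^{\frac1{p-1}}-J(r)^{\frac1{p-1}}\Big]_+^{\frac{p-1}{p+m-3}}\ (r\ge r_0),\qquad \tilde u(x,t)=\frac{C_*}{(t+t_0)^{\frac1{p+m-3}}}\Big[E(\tau)^{\frac1{p-1}}-I(r)\Big]_+^{\frac{p-1}{p+m-3}}\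 (r<r_0).$$ **Theorem.** Let $\varepsilon>0$ and $\ell>0$. There exist constants $t_0>1$, $C_*,\Gamma,r_0>0$, $\nu_0\in(0,1)$ and $\gamma>0$, depending only on $N,p,m,\alpha_1,\alpha_2,g,\varepsilon,\ell$, such that, for every $t\ge0$, $\tilde u(\cdot,t)$ is $C^1$ in $r$ near $r=r_0$, such that $\tilde u$ is a strong subsolution of the equation, and such that the following holds. Let $u_0\ge0$ be bounded and compactly supported, with $u_0(x)\ge\varepsilon$ for (almost every) $|x|\le\ell$, and let $u$ be a strong solution of (1). Then, for every $t>0$, $$u(x,t)\ge\tilde u(x,t)\qquad\text{for a.e. }x\in\mathbb R^N,$$ and, for every $t>t_0$, $$\operatorname{supp}u(t)\supset B_{R(t)}(0),\qquad R(t)=\gamma\,g^{-1}(\log t),$$ where $\operatorname{supp}$ is the essential support and $B_R(0)$ the open ball. -/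

import Mathlib

open MeasureTheory Set Filter Topology
open scoped ContDiff ENNReal

namespace WeightedParabolic

noncomputable section

/-- The space `ℝ^N` with its Euclidean norm. -/
abbrev Space (N : ℕ) : Type := EuclideanSpace ℝ (Fin N)

/-- The set `S_∞ = ℝ^N × (0, ∞)`; a point is a pair `(x, t)`. -/
def spaceTime (N : ℕ) : Set (Space N × ℝ) := univ ×ˢ Ioi (0 : ℝ)

/-- The structural assumptions on the exponent `g` of the weight:
`g ∈ C([0, ∞)) ∩ C¹((0, ∞))`, `g 0 = 0`, `g > 0` on `(0, ∞)` and
`α₁ g(s)/s ≤ g'(s) ≤ α₂ g(s)/s` for `s > 0`. -/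
structure IsPowerlike (g : ℝ → ℝ) (α₁ α₂ : ℝ) : Prop where
  continuousOn : ContinuousOn g (Ici 0)
  contDiffOn : ContDiffOn ℝ 1 g (Ioi 0)
  map_zero : g 0 = 0
  pos : ∀ s, 0 < s → 0 < g s
  lower : ∀ s, 0 < s → α₁ * (g s / s) ≤ deriv g s
  upper : ∀ s, 0 < s → deriv g s ≤ α₂ * (g s / s)

/-- The weight `f(x) = exp (g |x|)`. -/
def weight {N : ℕ} (g : ℝ → ℝ) (x : Space N) : ℝ := Real.exp (g ‖x‖)

/-- The measure `f(x) dx`, with respect to which the spaces `L^q_f(ℝ^N)` are taken. -/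
def weightMeasure (N : ℕ) (g : ℝ → ℝ) : Measure (Space N) :=
  volume.withDensity fun x => ENNReal.ofReal (weight g x)

/-! ### Test functions and weak derivatives on `S_∞` -/

/-- `η ∈ C_0^∞(S_∞)`. -/
structure IsTest {N : ℕ} (η : Space N × ℝ → ℝ) : Prop where
  smooth : ContDiff ℝ ∞ η
  compact : HasCompactSupport η
  supp : tsupport η ⊆ spaceTime N

/-- The gradient in `x` of a smooth function of `(x, t)`. -/
def gradX {N : ℕ} (η : Space N × ℝ → ℝ) (z : Space N × ℝ) : Space N :=
  gradient (fun y => η (y, z.2)) z.1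

/-- The derivative in `t` of a smooth function of `(x, t)`. -/
def derivT {N : ℕ} (η : Space N × ℝ → ℝ) (z : Space N × ℝ) : ℝ :=
  deriv (fun s => η (z.1, s)) z.2

/-- `V` is the weak gradient in `x` of `w` on `S_∞`. -/
structure IsWeakGradX {N : ℕ} (w : Space N × ℝ → ℝ) (V : Space N × ℝ → Space N) : Prop where
  locInt : LocallyIntegrableOn w (spaceTime N)
  locIntGrad : LocallyIntegrableOn V (spaceTime N)
  byParts : ∀ η : Space N × ℝ → ℝ, IsTest η →
    ∫ z in spaceTime N, w z • gradX η z = -∫ z in spaceTime N, η z • V z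

/-- `V ∈ L^p_loc(S_∞)`. -/
def MemLpLoc {N : ℕ} (p : ℝ) (V : Space N × ℝ → Space N) : Prop :=
  ∀ K : Set (Space N × ℝ), IsCompact K → K ⊆ spaceTime N →
    MemLp V (ENNReal.ofReal p) (volume.restrict K)

/-! ### Weak and strong solutions and subsolutions -/

/-- `u ≥ 0` and `u ∈ C([0, ∞); L¹_f(ℝ^N)) ∩ L^∞(ℝ^N × (t̄, ∞))` for all `t̄ > 0`. -/
structure IsAdmissible {N : ℕ} (g : ℝ → ℝ) (u : Space N × ℝ → ℝ) : Prop where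
  nonneg : ∀ t, 0 ≤ t → ∀ᵐ x : Space N, 0 ≤ u (x, t)
  memL1 : ∀ t, 0 ≤ t → MemLp (fun x => u (x, t)) 1 (weightMeasure N g)
  continuousL1 : ∀ t, 0 ≤ t →
    Tendsto (fun s => eLpNorm (fun x => u (x, s) - u (x, t)) 1 (weightMeasure N g))
      (𝓝[Ici 0] t) (𝓝 0)
  bounded : ∀ tbar, 0 < tbar → MemLp u ∞ (volume.restrict (univ ×ˢ Ioi tbar))

/-- The exponent `q = (p + m - 2) / (p - 1)`; the function `u ^ q` is the one that has a
weak gradient. -/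
def gradExponent (p m : ℝ) : ℝ := (p + m - 2) / (p - 1)

/-- The flux `u^{m-1} |∇u|^{p-2} ∇u`, as a function of `V = ∇(u^q)`, `q = (p+m-2)/(p-1)`.
Since `∇(u^q) = q u^{(m-1)/(p-1)} ∇u`, the flux is `q^{-(p-1)} |V|^{p-2} V`; this is its
meaning when only `u^q` has a weak gradient. -/
def flux {N : ℕ} (p m : ℝ) (V : Space N) : Space N :=
  ((gradExponent p m) ^ (-(p - 1)) * ‖V‖ ^ (p - 2)) • V

/-- The weak form `∫∫ { - u η_t + u^{m-1} |∇u|^{p-2} ∇u · ∇η } f dx dt`, where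
`V = ∇(u^q)`. -/
def weakForm {N : ℕ} (p m : ℝ) (g : ℝ → ℝ) (u : Space N × ℝ → ℝ) (V : Space N × ℝ → Space N)
    (η : Space N × ℝ → ℝ) : ℝ :=
  ∫ z in spaceTime N,
    (-(u z) * derivT η z + inner ℝ (flux p m (V z)) (gradX η z)) * weight g z.1

/-- Weak solutions of `f u_t - div (f u^{m-1} |∇u|^{p-2} ∇u) = 0` in `S_∞`. -/
def IsWeakSolution {N : ℕ} (p m : ℝ) (g : ℝ → ℝ) (u : Space N × ℝ → ℝ) : Prop :=
  IsAdmissible g u ∧ ∃ V : Space N × ℝ → Space N,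
    IsWeakGradX (fun z => u z ^ gradExponent p m) V ∧ MemLpLoc p V ∧
    ∀ η, IsTest η → weakForm p m g u V η = 0

/-- Weak subsolutions: the weak form is `≤ 0` on nonnegative test functions. -/
def IsWeakSubsolution {N : ℕ} (p m : ℝ) (g : ℝ → ℝ) (u : Space N × ℝ → ℝ) : Prop :=
  IsAdmissible g u ∧ ∃ V : Space N × ℝ → Space N,
    IsWeakGradX (fun z => u z ^ gradExponent p m) V ∧ MemLpLoc p V ∧
    ∀ η, IsTest η → (∀ z, 0 ≤ η z) → weakForm p m g u V η ≤ 0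

/-- The weak derivative `u_t` exists in `S_∞` and belongs to
`L^∞_loc((0, ∞); L¹_{f,loc}(ℝ^N))`. -/
def HasStrongTimeDeriv {N : ℕ} (g : ℝ → ℝ) (u : Space N × ℝ → ℝ) : Prop :=
  ∃ w : Space N × ℝ → ℝ,
    AEStronglyMeasurable w (volume.restrict (spaceTime N)) ∧
    (∀ K : Set (Space N), IsCompact K → ∀ a b : ℝ, 0 < a → ∃ C : ℝ,
      ∀ᵐ t ∂(volume.restrict (Icc a b)),
        ∫⁻ x in K, ‖w (x, t)‖ₑ ∂(weightMeasure N g) ≤ ENNReal.ofReal C) ∧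
    ∀ η, IsTest η →
      ∫ z in spaceTime N, u z * derivT η z = -∫ z in spaceTime N, w z * η z

/-- Strong solutions. -/
def IsStrongSolution {N : ℕ} (p m : ℝ) (g : ℝ → ℝ) (u : Space N × ℝ → ℝ) : Prop :=
  IsWeakSolution p m g u ∧ HasStrongTimeDeriv g u

/-- Strong subsolutions. -/
def IsStrongSubsolution {N : ℕ} (p m : ℝ) (g : ℝ → ℝ) (u : Space N × ℝ → ℝ) : Prop :=
  IsWeakSubsolution p m g u ∧ HasStrongTimeDeriv g u

/-- Strong solutions of the Cauchy problem with initial datum `u₀`; the datum is attained in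
the sense of `C([0, ∞); L¹_f(ℝ^N))`. -/
def IsStrongCauchySolution {N : ℕ} (p m : ℝ) (g : ℝ → ℝ) (u₀ : Space N → ℝ)
    (u : Space N × ℝ → ℝ) : Prop :=
  IsStrongSolution p m g u ∧ ∀ᵐ x : Space N, u (x, 0) = u₀ x

/-- The (essential) support of a function defined up to null sets. -/
def essSupport {N : ℕ} (v : Space N → ℝ) : Set (Space N) :=
  {x | ∀ U ∈ 𝓝 x, ¬ ∀ᵐ y ∂(volume.restrict U), v y = 0}

/-! ### The explicit barriers -/

/-- The inverse on `[0, ∞)` of an increasing function `[0, ∞) → [0, ∞)`. -/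
def radialInv (h : ℝ → ℝ) : ℝ → ℝ := Function.invFunOn h (Ici 0)

/-- `G(r) = ∫_0^r g(s)/s ds`. -/
def bigG (g : ℝ → ℝ) (r : ℝ) : ℝ := ∫ s in (0 : ℝ)..r, g s / s

/-- `J(r) = r^p / G(r)`. -/
def bigJ (p : ℝ) (g : ℝ → ℝ) (r : ℝ) : ℝ := r ^ p / bigG g r

/-- `E(τ) = J(G^{-1}(τ))`. -/
def bigE (p : ℝ) (g : ℝ → ℝ) (τ : ℝ) : ℝ := bigJ p g (radialInv (bigG g) τ)

/-- `I(r) = ν₀ (r^p / G(r₀))^{1/(p-1)} + (1 - ν₀) J(r₀)^{1/(p-1)}`. -/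
def bigI (p : ℝ) (g : ℝ → ℝ) (r₀ ν₀ r : ℝ) : ℝ :=
  ν₀ * (r ^ p / bigG g r₀) ^ (1 / (p - 1)) + (1 - ν₀) * bigJ p g r₀ ^ (1 / (p - 1))

/-- The radial profile `ũ(r, t)`: with `τ = Γ log (t + t₀)`, it is
`C (t + t₀)^{-1/(p+m-3)} [E(τ)^{1/(p-1)} - J(r)^{1/(p-1)}]_+^{(p-1)/(p+m-3)}` for `r ≥ r₀`,
and the same with `I(r)` in place of `J(r)^{1/(p-1)}` for `r < r₀`. -/
def profile (p m : ℝ) (g : ℝ → ℝ) (C Γ t₀ r₀ ν₀ r t : ℝ) : ℝ :=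
  C / (t + t₀) ^ (1 / (p + m - 3)) *
    (max 0 (bigE p g (Γ * Real.log (t + t₀)) ^ (1 / (p - 1)) -
      if r₀ ≤ r then bigJ p g r ^ (1 / (p - 1)) else bigI p g r₀ ν₀ r))
      ^ ((p - 1) / (p + m - 3))

/-- The barrier `ũ(x, t) = ũ(|x|, t)`. -/
def barrier {N : ℕ} (p m : ℝ) (g : ℝ → ℝ) (C Γ t₀ r₀ ν₀ : ℝ) (z : Space N × ℝ) : ℝ :=
  profile p m g C Γ t₀ r₀ ν₀ ‖z.1‖ z.2

end

end WeightedParabolic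

/-! Write a = 1/(p+m-3), b = (p-1)a, let Φ be the radial function subtracted inside the barrier, φ =
Φ', e(t) = E(τ)^{1/(p-1)} and W = e(t) - Φ(r). For C (t+t₀)^{-a} W_+^b the exponents fit: the flux
carries the power W^b, and after division by C (t+t₀)^{-a-1} W^{b-1} the differential inequality
becomes -aW + b(t+t₀)e' + b^{p-1}C^{p+m-3}( W[(N-1)φ^{p-1}/r + g'φ^{p-1} + (φ^{p-1})'] - bφ^p ) ≤ 0.

The structural condition makes g and G comparable, α₁G ≤ g ≤ α₂G, and φ^{p-1} is r/G up to bounded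
factors. Hence the bracket is bounded above (`exists_shapeFlux_bound`), and a small C makes its
contribution at most aW/2. With R = G^{-1}(τ), the front term b(t+t₀)e' is at most a multiple of Γ
Φ(R)/G(R). Near the front φ^p is itself of order at least Φ(R)/G(R); away from it W is a fixed
fraction of Φ(R). So a small Γ lets diffusion absorb the front term in the first region and the
remaining aW/2 absorb it in the second (`exists_front_speed`). This uses α₂ < p, which keeps p - g/G
away from zero.

When b < 1 the barrier is not Lipschitz at its front. Three facts make it a weak subsolution anyway:
u^q is a multiple of W_+^{1+a}, which is continuously differentiable in x; each point crosses the
front at one instant only; and along rays the fundamental theorem of calculus needs only right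
derivatives, which vanish at the front. The singular power W^{b-1} in u_t is integrable in x,
locally uniformly in t (`exists_lintegral_rpow_sub_bound`).

Comparison (`IsStrongSubsolution.le_of_isStrongSolution`) is an L¹ contraction. The equations are
subtracted and tested with smooth steps of v^q - u^q, the quantity that has a gradient. Monotonicity
of the flux gives the gradient of the step a good sign. In the limit the steps become the indicator
of {v^q > u^q} = {v > u}, so the chain rule in time for v - u shows that the weighted integral of
(v-u)_+ does not increase. The cut-off costs nothing, since v vanishes outside a ball. Mollification
justifies both chain rules.

Finally t₀ is fixed by Γ log t₀ = G(ℓ), so the barrier starts inside the ball of radius ℓ with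
height at most ε. Its support at time t has radius G^{-1}(Γ log(t+t₀)), which exceeds γ g^{-1}(log
t) because G(γs) ≤ γ^{α₁}G(s) ≤ γ^{α₁}g(s)/α₁. -/

namespace WeightedParabolic

set_option linter.unusedSectionVars false

noncomputable section

/-! ### Mollification -/

section Mollification

variable {X F : Type*} [NormedAddCommGroup X] [NormedSpace ℝ X] [FiniteDimensional ℝ X]
  [MeasurableSpace X] [BorelSpace X] [NormedAddCommGroup F] [NormedSpace ℝ F] [CompleteSpace F]

/-- A bump function supported in the ball of radius `1 / (n + 1)`. -/
def stdBump (X : Type*) [NormedAddCommGroup X] (n : ℕ) : ContDiffBump (0 : X) where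
  rIn := 1 / (2 * (n + 1))
  rOut := 1 / (n + 1)
  rIn_pos := by positivity
  rIn_lt_rOut := by
    apply one_div_lt_one_div_of_lt <;> [positivity; linarith [(n.cast_nonneg : (0 : ℝ) ≤ n)]]

theorem tendsto_stdBump_rOut : Tendsto (fun n => (stdBump X n).rOut) atTop (𝓝 0) :=
  tendsto_one_div_add_atTop_nhds_zero_nat

/-- Convolution with the `n`-th standard mollifier. -/
def mollify (μ : Measure X) (n : ℕ) (h : X → F) : X → F :=
  convolution ((stdBump X n).normed μ) h (ContinuousLinearMap.lsmul ℝ ℝ) μ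

variable {μ : Measure X} [μ.IsAddHaarMeasure]

theorem mollify_apply (n : ℕ) (h : X → F) (x : X) :
    mollify μ n h x = ∫ y, (stdBump X n).normed μ y • h (x - y) ∂μ := rfl

theorem mollify_apply' (n : ℕ) (h : X → F) (x : X) :
    mollify μ n h x = ∫ y, (stdBump X n).normed μ (x - y) • h y ∂μ := by
  rw [mollify, convolution_eq_swap]; rfl

theorem contDiff_mollify {h : X → F} (hh : LocallyIntegrable h μ) (n : ℕ) :
    ContDiff ℝ ∞ (mollify μ n h) :=
  (stdBump X n).hasCompactSupport_normed.contDiff_convolution_left _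
    (stdBump X n).contDiff_normed hh

theorem ae_tendsto_mollify {h : X → F} (hh : LocallyIntegrable h μ) :
    ∀ᵐ x ∂μ, Tendsto (fun n => mollify μ n h x) atTop (𝓝 (h x)) := by
  refine ContDiffBump.ae_convolution_tendsto_right_of_locallyIntegrable (K := 2)
    tendsto_stdBump_rOut (Eventually.of_forall fun n => ?_) hh
  change (1 : ℝ) / (n + 1) ≤ 2 * (1 / (2 * (n + 1)))
  apply le_of_eq; field_simp

/-- Translations act continuously on `Lp` for a finite exponent; the proof transports this from
classes to functions. -/
theorem tendsto_eLpNorm_translate_sub {p : ℝ≥0∞} (h1 : 1 ≤ p) (hp : p ≠ ⊤) {h : X → F}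
    (hh : MemLp h p μ) :
    Tendsto (fun y => eLpNorm (fun x => h (x - y) - h x) p μ) (𝓝 0) (𝓝 0) := by
  have : Fact (1 ≤ p) := ⟨h1⟩
  have : Fact (p ≠ ⊤) := ⟨hp⟩
  set H := hh.toLp h
  have hc : Continuous fun y : X => (DomAddAct.mk (-y) : Xᵈᵃᵃ) +ᵥ H := by
    have h1 : Continuous fun y : X => (DomAddAct.mk (-y) : Xᵈᵃᵃ) :=
      DomAddAct.continuous_mk.comp continuous_neg
    exact h1.vadd continuous_const
  have h0 : (DomAddAct.mk (-(0 : X)) : Xᵈᵃᵃ) +ᵥ H = H := by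
    rw [neg_zero]
    exact zero_vadd _ H
  have ht : Tendsto (fun y : X => edist ((DomAddAct.mk (-y) : Xᵈᵃᵃ) +ᵥ H) H) (𝓝 0) (𝓝 0) := by
    have := (hc.edist continuous_const : Continuous fun y : X =>
      edist ((DomAddAct.mk (-y) : Xᵈᵃᵃ) +ᵥ H) H).tendsto 0
    rwa [h0, edist_self] at this
  refine ht.congr fun y => ?_
  rw [Lp.edist_def]
  apply eLpNorm_congr_ae
  have hq : (fun x => (H : X → F) (-y + x)) =ᵐ[μ] fun x => h (-y + x) :=
    (measurePreserving_add_left μ (-y)).quasiMeasurePreserving.ae_eq_comp hh.coeFn_toLp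
  filter_upwards [DomAddAct.vadd_Lp_ae_eq (DomAddAct.mk (-y)) H, hh.coeFn_toLp, hq]
    with x hx1 hx2 hx3
  rw [Pi.sub_apply, hx1, show (H : X → F) x = h x from hx2]
  simp only [Equiv.symm_apply_apply, vadd_eq_add, hx3]
  rw [neg_add_eq_sub]

/-- The normalized bump is the density of a probability measure, and the mollification error is the
average of h(x-y) - h(x) against it. Jensen's inequality for the power `p` and Tonelli then bound
the error by the worst translation in the support of the bump. -/
theorem eLpNorm_mollify_sub_le {p : ℝ≥0∞} (h1 : 1 ≤ p) (hp : p ≠ ⊤) {h : X → F}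
    (hh : MemLp h p μ) (n : ℕ) {ε : ℝ≥0∞}
    (hε : ∀ y ∈ Metric.ball (0 : X) (stdBump X n).rOut,
      eLpNorm (fun x => h (x - y) - h x) p μ ≤ ε) :
    eLpNorm (fun x => mollify μ n h x - h x) p μ ≤ ε := by
  set φ := (stdBump X n).normed μ with hφ
  have hφc : Continuous φ := (stdBump X n).continuous_normed
  have hφ0 : ∀ y, 0 ≤ φ y := (stdBump X n).nonneg_normed
  set ν : Measure X := μ.withDensity fun y => ENNReal.ofReal (φ y) with hν
  have hφm : Measurable fun y => ENNReal.ofReal (φ y) := hφc.measurable.ennreal_ofReal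
  have hνint : ∀ k : X → F, ∫ y, k y ∂ν = ∫ y, φ y • k y ∂μ := fun k => by
    rw [hν, integral_withDensity_eq_integral_toReal_smul hφm (by simp)]
    simp [ENNReal.toReal_ofReal, hφ0]
  have : IsProbabilityMeasure ν := ⟨by
    rw [hν, withDensity_apply _ MeasurableSet.univ, Measure.restrict_univ,
      ← ofReal_integral_eq_lintegral_ofReal (stdBump X n).integrable_normed
        (Eventually.of_forall hφ0), (stdBump X n).integral_normed, ENNReal.ofReal_one]⟩
  -- A strongly measurable representative makes (x, y) ↦ k(x-y) jointly measurable, as Tonelli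
  -- requires.
  obtain ⟨k, hkm, hhk⟩ := hh.1
  have hk : MemLp k p μ := (memLp_congr_ae hhk).1 hh
  have hmol : mollify μ n h = mollify μ n k := convolution_congr _ (ae_eq_refl _) hhk
  have e1 : eLpNorm (fun x => mollify μ n h x - h x) p μ
      = eLpNorm (fun x => mollify μ n k x - k x) p μ := by
    apply eLpNorm_congr_ae
    filter_upwards [hhk] with x hx
    rw [hmol, hx]
  have hεk : ∀ y ∈ Metric.ball (0 : X) (stdBump X n).rOut,
      eLpNorm (fun x => k (x - y) - k x) p μ ≤ ε := fun y hy => by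
    refine le_of_eq_of_le (eLpNorm_congr_ae ?_) (hε y hy)
    have := (measurePreserving_sub_right μ y).quasiMeasurePreserving.ae_eq_comp hhk
    filter_upwards [hhk, this] with x hx hx2
    simp only [Function.comp_apply] at hx2
    rw [hx, hx2]
  rw [e1]
  have hp0 : p ≠ 0 := (zero_lt_one.trans_le h1).ne'
  set r := p.toReal with hr
  have hr0 : 0 < r := ENNReal.toReal_pos hp0 hp
  have hkl : LocallyIntegrable k μ := hk.locallyIntegrable h1
  have hconv : ∀ x, Integrable (fun y => φ y • k (x - y)) μ := fun x =>
    HasCompactSupport.convolutionExists_left (ContinuousLinearMap.lsmul ℝ ℝ)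
      (stdBump X n).hasCompactSupport_normed hφc hkl x
  have hdiff : ∀ x, mollify μ n k x - k x = ∫ y, (k (x - y) - k x) ∂ν := fun x => by
    rw [hνint]
    simp_rw [smul_sub]
    rw [integral_sub (hconv x) ((stdBump X n).integrable_normed.smul_const _),
      (stdBump X n).integral_normed_smul μ]
    rfl
  have hmeas : ∀ x, AEStronglyMeasurable (fun y => k (x - y) - k x) ν := fun x =>
    ((hkm.comp_measurable (measurable_const.sub measurable_id)).sub
      stronglyMeasurable_const).aestronglyMeasurable
  have hptw : ∀ x, ‖mollify μ n k x - k x‖ₑ ^ r ≤ ∫⁻ y, ‖k (x - y) - k x‖ₑ ^ r ∂ν := fun x => by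
    have h2 : ‖mollify μ n k x - k x‖ₑ ≤ eLpNorm (fun y => k (x - y) - k x) p ν := by
      refine le_trans ?_ (eLpNorm_le_eLpNorm_of_exponent_le h1 (hmeas x))
      rw [hdiff x, eLpNorm_one_eq_lintegral_enorm]
      exact enorm_integral_le_lintegral_enorm _
    rw [eLpNorm_eq_lintegral_rpow_enorm_toReal hp0 hp] at h2
    refine (ENNReal.rpow_le_rpow h2 hr0.le).trans (le_of_eq ?_)
    rw [← ENNReal.rpow_mul, one_div, inv_mul_cancel₀ hr0.ne', ENNReal.rpow_one]
  rw [eLpNorm_eq_lintegral_rpow_enorm_toReal hp0 hp]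
  have hmain : ∫⁻ x, ‖mollify μ n k x - k x‖ₑ ^ r ∂μ ≤ ε ^ r := by
    calc ∫⁻ x, ‖mollify μ n k x - k x‖ₑ ^ r ∂μ
        ≤ ∫⁻ x, ∫⁻ y, ‖k (x - y) - k x‖ₑ ^ r ∂ν ∂μ := lintegral_mono hptw
      _ = ∫⁻ y, ∫⁻ x, ‖k (x - y) - k x‖ₑ ^ r ∂μ ∂ν := by
          apply lintegral_lintegral_swap
          apply Measurable.aemeasurable
          have : StronglyMeasurable (Function.uncurry fun x y : X => k (x - y) - k x) :=
            (hkm.comp_measurable (measurable_fst.sub measurable_snd)).sub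
              (hkm.comp_measurable measurable_fst)
          exact this.enorm.pow_const r
      _ ≤ ∫⁻ _, ε ^ r ∂ν := by
          rw [hν, lintegral_withDensity_eq_lintegral_mul₀' hφm.aemeasurable,
            lintegral_withDensity_eq_lintegral_mul₀' hφm.aemeasurable aemeasurable_const]
          · apply lintegral_mono
            intro y
            by_cases hy : y ∈ Metric.ball (0 : X) (stdBump X n).rOut
            · simp only [Pi.mul_apply]
              gcongr
              have := hεk y hy
              rw [eLpNorm_eq_lintegral_rpow_enorm_toReal hp0 hp] at this
              calc _ = ((∫⁻ x, ‖k (x - y) - k x‖ₑ ^ r ∂μ) ^ (1 / r)) ^ r := by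
                    rw [← ENNReal.rpow_mul, one_div, inv_mul_cancel₀ hr0.ne', ENNReal.rpow_one]
                _ ≤ ε ^ r := ENNReal.rpow_le_rpow this hr0.le
            · have : φ y = 0 := by
                rw [← Function.notMem_support, hφ, (stdBump X n).support_normed_eq]; exact hy
              simp [this]
          · have : StronglyMeasurable (Function.uncurry fun y x : X => k (x - y) - k x) :=
              (hkm.comp_measurable (measurable_snd.sub measurable_fst)).sub
                (hkm.comp_measurable measurable_snd)
            exact (Measurable.lintegral_prod_right (this.enorm.pow_const r)).aemeasurable
      _ = ε ^ r := by simp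
  calc _ ≤ (ε ^ r) ^ (1 / r) := ENNReal.rpow_le_rpow hmain (by positivity)
    _ = ε := by rw [← ENNReal.rpow_mul, mul_one_div_cancel hr0.ne', ENNReal.rpow_one]

theorem tendsto_eLpNorm_mollify_sub {p : ℝ≥0∞} (h1 : 1 ≤ p) (hp : p ≠ ⊤) {h : X → F}
    (hh : MemLp h p μ) :
    Tendsto (fun n => eLpNorm (fun x => mollify μ n h x - h x) p μ) atTop (𝓝 0) := by
  rw [ENNReal.tendsto_nhds_zero]
  intro ε hε
  obtain ⟨δ, hδ, hb⟩ := Metric.eventually_nhds_iff_ball.1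
    (ENNReal.tendsto_nhds_zero.1 (tendsto_eLpNorm_translate_sub h1 hp hh) ε hε)
  filter_upwards [(tendsto_stdBump_rOut (X := X)).eventually_lt_const hδ] with n hn
  exact eLpNorm_mollify_sub_le h1 hp hh n fun y hy => hb y (Metric.ball_subset_ball hn.le hy)

/-- Mollification commutes with weak directional derivatives. -/
theorem fderiv_mollify_apply {Ω : Set X} {h d : X → ℝ} (hh : LocallyIntegrable h μ) {e : X}
    (hw : ∀ η : X → ℝ, ContDiff ℝ ∞ η → HasCompactSupport η → tsupport η ⊆ Ω →
      ∫ y, h y * fderiv ℝ η y e ∂μ = -∫ y, d y * η y ∂μ)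
    {n : ℕ} {x : X} (hx : Metric.closedBall x (stdBump X n).rOut ⊆ Ω) :
    fderiv ℝ (mollify μ n h) x e = mollify μ n d x := by
  set φ := (stdBump X n).normed μ with hφ
  have hφs : ContDiff ℝ ∞ φ := (stdBump X n).contDiff_normed
  have hφc : HasCompactSupport φ := (stdBump X n).hasCompactSupport_normed
  have hd := hφc.hasFDerivAt_convolution_left (ContinuousLinearMap.lsmul ℝ ℝ)
    (hφs.of_le (by exact_mod_cast le_top)) hh x
  have hex := (hφc.fderiv (𝕜 := ℝ)).convolutionExists_left
    ((ContinuousLinearMap.lsmul ℝ ℝ : ℝ →L[ℝ] ℝ →L[ℝ] ℝ).precompL X)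
    (hφs.continuous_fderiv (by simp)) hh x
  have e1 : fderiv ℝ (mollify μ n h) x e = ∫ y, fderiv ℝ φ y e * h (x - y) ∂μ := by
    rw [mollify, hd.fderiv, convolution_def, ContinuousLinearMap.integral_apply hex]
    rfl
  have e2 : ∫ y, fderiv ℝ φ y e * h (x - y) ∂μ = ∫ y, fderiv ℝ φ (x - y) e * h y ∂μ := by
    rw [← integral_sub_left_eq_self (fun y => fderiv ℝ φ y e * h (x - y)) μ x]
    simp
  -- The reflected mollifier is an admissible test function because the closed ball around `x` lies
  -- in `Ω`. The sign from the reflection cancels the one in the definition of the weak derivative.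
  set η : X → ℝ := fun y => φ (x - y) with hη
  have hηs : ContDiff ℝ ∞ η := hφs.comp (contDiff_const.sub contDiff_id)
  have hsup : Function.support η ⊆ Metric.closedBall x (stdBump X n).rOut := by
    intro y hy
    have : x - y ∈ Function.support φ := hy
    rw [hφ, (stdBump X n).support_normed_eq, mem_ball_zero_iff] at this
    rw [Metric.mem_closedBall, dist_comm, dist_eq_norm]
    exact this.le
  have hts : tsupport η ⊆ Metric.closedBall x (stdBump X n).rOut :=
    closure_minimal hsup Metric.isClosed_closedBall
  have hηd : ∀ y, fderiv ℝ η y e = -fderiv ℝ φ (x - y) e := fun y => by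
    have h1 : HasFDerivAt φ (fderiv ℝ φ (x - y)) (x - y) :=
      (hφs.differentiable (by simp) _).hasFDerivAt
    have h2 : HasFDerivAt (fun y : X => x - y) (-ContinuousLinearMap.id ℝ X) y :=
      (hasFDerivAt_id y).const_sub x
    have h3 : HasFDerivAt η _ y := h1.comp y h2
    rw [h3.fderiv]
    simp
  have := hw η hηs (HasCompactSupport.of_support_subset_isCompact
    (isCompact_closedBall _ _) hsup) (hts.trans hx)
  rw [e1, e2, mollify_apply']
  simp_rw [hηd] at this
  simp only [mul_neg, integral_neg, neg_inj] at this
  simp only [smul_eq_mul]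
  rw [show (fun y => fderiv ℝ φ (x - y) e * h y) = fun y => h y * fderiv ℝ φ (x - y) e from
    funext fun y => mul_comm _ _, this]
  exact integral_congr_ae (Eventually.of_forall fun y => mul_comm _ _)

end Mollification

section

/-! ### Calculus of test functions -/

variable {N : ℕ}

instance : (volume : Measure (Space N × ℝ)).IsAddHaarMeasure :=
  inferInstanceAs (Measure.IsAddHaarMeasure ((volume : Measure (Space N)).prod volume))

theorem isOpen_spaceTime : IsOpen (spaceTime N) := isOpen_univ.prod isOpen_Ioi

theorem measurableSet_spaceTime : MeasurableSet (spaceTime N) := isOpen_spaceTime.measurableSet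

theorem volume_restrict_spaceTime :
    (volume : Measure (Space N × ℝ)).restrict (spaceTime N)
      = (volume : Measure (Space N)).prod (volume.restrict (Ioi (0 : ℝ))) := by
  rw [spaceTime, Measure.volume_eq_prod, ← Measure.prod_restrict, Measure.restrict_univ]

theorem gradX_eq {η : Space N × ℝ → ℝ} {z : Space N × ℝ} (h : DifferentiableAt ℝ η z) :
    gradX η z = (InnerProductSpace.toDual ℝ (Space N)).symm
      ((fderiv ℝ η z).comp (ContinuousLinearMap.inl ℝ (Space N) ℝ)) := by
  have h1 : HasFDerivAt (fun y : Space N => (y, z.2))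
      (ContinuousLinearMap.inl ℝ (Space N) ℝ) z.1 := hasFDerivAt_prodMk_left _ _
  have h2 : HasFDerivAt η (fderiv ℝ η z) (z.1, z.2) := h.hasFDerivAt
  have h3 : HasFDerivAt (fun y => η (y, z.2)) _ z.1 := h2.comp z.1 h1
  rw [gradX, gradient, h3.fderiv]

theorem inner_gradX {η : Space N × ℝ → ℝ} {z : Space N × ℝ} (h : DifferentiableAt ℝ η z)
    (e : Space N) : inner ℝ (gradX η z) e = fderiv ℝ η z (e, 0) := by
  rw [gradX_eq h, InnerProductSpace.toDual_symm_apply]; rfl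

theorem derivT_eq {η : Space N × ℝ → ℝ} {z : Space N × ℝ} (h : DifferentiableAt ℝ η z) :
    derivT η z = fderiv ℝ η z (0, 1) := by
  have h1 : HasDerivAt (fun s : ℝ => (z.1, s)) ((0 : Space N), (1 : ℝ)) z.2 :=
    (hasDerivAt_const _ _).prodMk (hasDerivAt_id _)
  have h2 : HasFDerivAt η (fderiv ℝ η z) (z.1, z.2) := h.hasFDerivAt
  exact (h2.comp_hasDerivAt z.2 h1).deriv

namespace IsTest

variable {η : Space N × ℝ → ℝ} (hη : IsTest η)

include hη

theorem differentiable : Differentiable ℝ η := hη.smooth.differentiable (by simp)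

theorem continuous_derivT : Continuous (derivT η) := by
  have : derivT η = fun z => fderiv ℝ η z (0, 1) := funext fun z => derivT_eq (hη.differentiable z)
  rw [this]
  exact (hη.smooth.continuous_fderiv (by simp)).clm_apply continuous_const

theorem continuous_gradX : Continuous (gradX η) := by
  have : gradX η = fun z => (InnerProductSpace.toDual ℝ (Space N)).symm
      ((fderiv ℝ η z).comp (ContinuousLinearMap.inl ℝ (Space N) ℝ)) :=
    funext fun z => gradX_eq (hη.differentiable z)
  rw [this]
  exact (LinearIsometryEquiv.continuous _).comp
    ((hη.smooth.continuous_fderiv (by simp)).clm_comp continuous_const)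

theorem fderiv_eq_zero {z : Space N × ℝ} (hz : z ∉ tsupport η) : fderiv ℝ η z = 0 :=
  image_eq_zero_of_notMem_tsupport fun h => hz (tsupport_fderiv_subset ℝ h)

theorem derivT_eq_zero {z : Space N × ℝ} (hz : z ∉ tsupport η) : derivT η z = 0 := by
  rw [derivT_eq (hη.differentiable z), hη.fderiv_eq_zero hz]; rfl

theorem gradX_eq_zero {z : Space N × ℝ} (hz : z ∉ tsupport η) : gradX η z = 0 := by
  rw [gradX_eq (hη.differentiable z), hη.fderiv_eq_zero hz]; simp

theorem eq_zero {z : Space N × ℝ} (hz : z ∉ tsupport η) : η z = 0 :=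
  image_eq_zero_of_notMem_tsupport hz

theorem mul_left {k : Space N × ℝ → ℝ} (hk : ContDiff ℝ ∞ k) : IsTest fun z => k z * η z where
  smooth := hk.mul hη.smooth
  compact := hη.compact.mul_left
  supp := (tsupport_mul_subset_right (f := k) (g := η)).trans hη.supp

end IsTest

/-- A continuous weight times a locally integrable function times a compactly supported bounded
factor is integrable. -/
theorem integrableOn_of_eq_zero_off {F : Type*} [NormedAddCommGroup F] {h : Space N × ℝ → F}
    {K : Set (Space N × ℝ)} (hK : IntegrableOn h K) (h0 : ∀ z ∉ K, h z = 0) :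
    IntegrableOn h (spaceTime N) :=
  hK.of_forall_sdiff_eq_zero measurableSet_spaceTime fun z hz => h0 z hz.2

theorem IsTest.integrableOn_mul {η h c : Space N × ℝ → ℝ} (hη : IsTest η)
    (hh : LocallyIntegrableOn h (spaceTime N)) (hc : Continuous c)
    (h0 : ∀ z ∉ tsupport η, c z = 0) :
    IntegrableOn (fun z => h z * c z) (spaceTime N) :=
  integrableOn_of_eq_zero_off ((hh.integrableOn_compact_subset hη.supp
    hη.compact).mul_continuousOn hc.continuousOn hη.compact) fun z hz => by simp [h0 z hz]

/-- A continuous weight that depends only on `x` can be inserted in a weak time derivative. -/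
theorem integral_mul_derivT_mul_weight {y d : Space N × ℝ → ℝ} {f : Space N → ℝ}
    (hf : Continuous f) (hy : LocallyIntegrableOn y (spaceTime N))
    (hd : LocallyIntegrableOn d (spaceTime N))
    (hw : ∀ η, IsTest η →
      ∫ z in spaceTime N, y z * derivT η z = -∫ z in spaceTime N, d z * η z)
    {η : Space N × ℝ → ℝ} (hη : IsTest η) :
    ∫ z in spaceTime N, y z * (derivT η z * f z.1)
      = -∫ z in spaceTime N, d z * (η z * f z.1) := by
  have i1 := hη.integrableOn_mul hy hη.continuous_derivT fun z hz => hη.derivT_eq_zero hz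
  have i2 := hη.integrableOn_mul hd hη.smooth.continuous fun z hz => hη.eq_zero hz
  have j1 : IntegrableOn (fun z => y z * (derivT η z * f z.1)) (spaceTime N) := hη.integrableOn_mul hy
    (hη.continuous_derivT.mul (hf.comp continuous_fst)) fun z hz => by simp [hη.derivT_eq_zero hz]
  have j2 : IntegrableOn (fun z => d z * (η z * f z.1)) (spaceTime N) := hη.integrableOn_mul hd
    (hη.smooth.continuous.mul (hf.comp continuous_fst)) fun z hz => by simp [hη.eq_zero hz]
  set A := ∫ z in spaceTime N, ‖y z * derivT η z‖ with hA
  set B := ∫ z in spaceTime N, ‖d z * η z‖ with hB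
  have hA0 : 0 ≤ A := integral_nonneg fun _ => norm_nonneg _
  have hB0 : 0 ≤ B := integral_nonneg fun _ => norm_nonneg _
  rw [← add_eq_zero_iff_eq_neg, ← norm_le_zero_iff]
  refine le_of_forall_pos_le_add fun ε hε => ?_
  -- The weight is only continuous, so its product with a test function need not be one. A uniformly
  -- close smooth `k` does give a test function, and it changes the two integrals by at most (A + B)
  -- ε/(A + B + 1) in total.
  obtain ⟨k, hk, hkf, -⟩ := hf.exists_contDiff_approx (ε := fun _ => ε / (A + B + 1)) ⊤
    continuous_const (fun _ => by positivity)
  set δ := ε / (A + B + 1) with hδ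
  have hk' : ContDiff ℝ ∞ fun z : Space N × ℝ => k z.1 := hk.comp contDiff_fst
  have hηk := hη.mul_left hk'
  have hder : ∀ z, derivT (fun z => k z.1 * η z) z = k z.1 * derivT η z := fun z => by
    simp only [derivT]
    rw [deriv_const_mul]
    exact (hη.smooth.comp (contDiff_const.prodMk contDiff_id)).differentiable (by simp) z.2
  have e := hw _ hηk
  simp_rw [hder] at e
  have l1 : IntegrableOn (fun z => y z * (derivT η z * k z.1)) (spaceTime N) := hη.integrableOn_mul hy
    (hη.continuous_derivT.mul hk'.continuous) fun z hz => by simp [hη.derivT_eq_zero hz]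
  have l2 : IntegrableOn (fun z => d z * (η z * k z.1)) (spaceTime N) := hη.integrableOn_mul hd
    (hη.smooth.continuous.mul hk'.continuous) fun z hz => by simp [hη.eq_zero hz]
  have e' : (∫ z in spaceTime N, y z * (derivT η z * k z.1))
      + ∫ z in spaceTime N, d z * (η z * k z.1) = 0 := by
    rw [add_eq_zero_iff_eq_neg]
    refine (integral_congr_ae (Eventually.of_forall fun z => ?_)).trans (e.trans
      (congrArg _ (integral_congr_ae (Eventually.of_forall fun z => ?_)))) <;> ring
  have b1 : ‖∫ z in spaceTime N,
      (y z * (derivT η z * f z.1) - y z * (derivT η z * k z.1))‖ ≤ A * δ := by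
    rw [hA, ← integral_mul_const]
    refine norm_integral_le_of_norm_le (i1.norm.mul_const _) (Eventually.of_forall fun z => ?_)
    rw [show y z * (derivT η z * f z.1) - y z * (derivT η z * k z.1)
      = (y z * derivT η z) * (f z.1 - k z.1) by ring, norm_mul]
    gcongr
    rw [norm_sub_rev, ← dist_eq_norm]; exact (hkf _).le
  have b2 : ‖∫ z in spaceTime N,
      (d z * (η z * f z.1) - d z * (η z * k z.1))‖ ≤ B * δ := by
    rw [hB, ← integral_mul_const]
    refine norm_integral_le_of_norm_le (i2.norm.mul_const _) (Eventually.of_forall fun z => ?_)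
    rw [show d z * (η z * f z.1) - d z * (η z * k z.1)
      = (d z * η z) * (f z.1 - k z.1) by ring, norm_mul]
    gcongr
    rw [norm_sub_rev, ← dist_eq_norm]; exact (hkf _).le
  rw [integral_sub j1 l1] at b1
  rw [integral_sub j2 l2] at b2
  have hfin : (A + B) * δ ≤ ε := by
    rw [hδ, ← mul_div_assoc, div_le_iff₀ (by positivity)]
    nlinarith
  calc _ = ‖((∫ z in spaceTime N, y z * (derivT η z * f z.1))
          - ∫ z in spaceTime N, y z * (derivT η z * k z.1))
        + ((∫ z in spaceTime N, d z * (η z * f z.1))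
          - ∫ z in spaceTime N, d z * (η z * k z.1))‖ := by
        congr 1; linear_combination e'
    _ ≤ A * δ + B * δ := (norm_add_le _ _).trans (add_le_add b1 b2)
    _ ≤ 0 + ε := by linarith

theorem IsTest.integral_derivT {η : Space N × ℝ → ℝ} (hη : IsTest η) :
    ∫ z in spaceTime N, derivT η z = 0 := by
  have h0 : ∀ z ∉ spaceTime N, derivT η z = 0 := fun z hz =>
    hη.derivT_eq_zero fun h => hz (hη.supp h)
  rw [setIntegral_eq_integral_of_forall_compl_eq_zero fun z hz => h0 z hz]
  have hi : Integrable fun z => fderiv ℝ η z (0, 1) :=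
    ((hη.smooth.continuous_fderiv (by simp)).clm_apply
      continuous_const).integrable_of_hasCompactSupport (hη.compact.fderiv_apply (𝕜 := ℝ) _)
  have := integral_mul_fderiv_eq_neg_fderiv_mul_of_integrable (μ := (volume : Measure (Space N × ℝ)))
    (f := fun _ => (1 : ℝ)) (g := η) (v := (0, 1)) (by simp) (by simpa using hi)
    (by simpa using hη.smooth.continuous.integrable_of_hasCompactSupport hη.compact)
    (fun _ _ => differentiableAt_const _) (fun z _ => hη.differentiable z)
  simp only [one_mul, fderiv_fun_const, Pi.zero_apply, zero_apply, zero_mul,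
    integral_zero, neg_zero] at this
  rw [← this]
  exact integral_congr_ae (Eventually.of_forall fun z => derivT_eq (hη.differentiable z))

theorem IsTest.integral_derivT_mul_weight {η : Space N × ℝ → ℝ} (hη : IsTest η) {f : Space N → ℝ}
    (hf : Continuous f) : ∫ z in spaceTime N, derivT η z * f z.1 = 0 := by
  have := integral_mul_derivT_mul_weight (y := fun _ => 1) (d := fun _ => 0) hf
    (continuous_const.locallyIntegrable.locallyIntegrableOn _)
    (continuous_const.locallyIntegrable.locallyIntegrableOn _)
    (fun η hη => by simpa using hη.integral_derivT) hη
  simpa using this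

end

section

/-! ### Nonlinear test functions -/

variable {N : ℕ}

/-- Convergence is needed only where `G` is nonzero. In the applications `G` carries a cut-off, so a
truncated function may stand in for the original off its support. -/
theorem tendsto_integral_mul_of_bounded {α : Type*} [MeasurableSpace α] {μ : Measure α}
    {G : α → ℝ} (hG : Integrable G μ) {c : ℕ → α → ℝ} {c' : α → ℝ} {C : ℝ}
    (hcm : ∀ n, AEStronglyMeasurable (c n) μ) (hcb : ∀ n x, |c n x| ≤ C)
    (hc : ∀ᵐ x ∂μ, G x ≠ 0 → Tendsto (fun n => c n x) atTop (𝓝 (c' x))) :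
    Tendsto (fun n => ∫ x, G x * c n x ∂μ) atTop (𝓝 (∫ x, G x * c' x ∂μ)) := by
  refine tendsto_integral_of_dominated_convergence (fun x => ‖G x‖ * C)
    (fun n => hG.1.mul (hcm n)) (hG.norm.mul_const _)
    (fun n => Eventually.of_forall fun x => ?_) ?_
  · rw [norm_mul]
    exact mul_le_mul_of_nonneg_left (hcb n x) (norm_nonneg _)
  · filter_upwards [hc] with x hx
    by_cases h : G x = 0
    · simp [h]
    · exact (hx h).const_mul _

theorem integral_eq_zero_of_tendsto_enorm {α : Type*} [MeasurableSpace α] {μ : Measure α}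
    {H : ℕ → α → ℝ} {b : ℕ → ℝ≥0∞} (hb : Tendsto b atTop (𝓝 0))
    (hH : ∀ᶠ n in atTop, ∫⁻ x, ‖H n x‖ₑ ∂μ ≤ b n) :
    Tendsto (fun n => ∫ x, H n x ∂μ) atTop (𝓝 0) := by
  rw [tendsto_iff_edist_tendsto_0]
  refine tendsto_of_tendsto_of_tendsto_of_le_of_le' tendsto_const_nhds hb
    (Eventually.of_forall fun _ => zero_le) ?_
  filter_upwards [hH] with n hn
  rw [edist_zero_right]
  exact (enorm_integral_le_lintegral_enorm _).trans hn

/-- A locally integrable function cannot be mollified globally; its truncation to a compact set can.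
Test functions supported in the interior of `K` do not notice the truncation, so the weak derivative
survives there. -/
theorem fderiv_mollify_indicator {K : Set (Space N × ℝ)} (hK : IsCompact K)
    (hKs : K ⊆ spaceTime N) {y d : Space N × ℝ → ℝ} {e : Space N × ℝ}
    (hy : LocallyIntegrableOn y (spaceTime N))
    (hw : ∀ η, IsTest η →
      ∫ z in spaceTime N, y z * fderiv ℝ η z e = -∫ z in spaceTime N, d z * η z)
    {n : ℕ} {x : Space N × ℝ}
    (hx : Metric.closedBall x (stdBump (Space N × ℝ) n).rOut ⊆ interior K) :
    fderiv ℝ (mollify volume n (K.indicator y)) x e = mollify volume n (K.indicator d) x := by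
  have hyi : Integrable (K.indicator y) :=
    (hy.integrableOn_compact_subset hKs hK).integrable_indicator hK.measurableSet
  refine fderiv_mollify_apply hyi.locallyIntegrable (fun η h1 h2 h3 => ?_) hx
  have hη : IsTest η := ⟨h1, h2, h3.trans (interior_subset.trans hKs)⟩
  have e1 : ∀ h c : Space N × ℝ → ℝ, (∀ z ∉ tsupport η, c z = 0) →
      ∫ z, K.indicator h z * c z = ∫ z in spaceTime N, h z * c z := fun h c hc => by
    rw [← integral_indicator measurableSet_spaceTime]
    refine integral_congr_ae (Eventually.of_forall fun z => ?_)
    by_cases hz : z ∈ tsupport η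
    · simp [indicator_of_mem (interior_subset (h3 hz)), indicator_of_mem (hη.supp hz)]
    · simp [indicator, hc z hz]
  rw [e1 y (fun z => fderiv ℝ η z e) fun z hz => by simp [hη.fderiv_eq_zero hz],
    e1 d η fun z hz => hη.eq_zero hz]
  exact hw η hη

theorem IsWeakGradX.integral_mul_fderiv {w : Space N × ℝ → ℝ} {V : Space N × ℝ → Space N}
    (h : IsWeakGradX w V) (e : Space N) {η : Space N × ℝ → ℝ} (hη : IsTest η) :
    ∫ z in spaceTime N, w z * fderiv ℝ η z (e, 0)
      = -∫ z in spaceTime N, inner ℝ (V z) e * η z := by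
  have i1 : IntegrableOn (fun z => w z • gradX η z) (spaceTime N) :=
    integrableOn_of_eq_zero_off ((h.locInt.integrableOn_compact_subset hη.supp
      hη.compact).smul_continuousOn hη.continuous_gradX.continuousOn hη.compact)
      fun z hz => by simp [hη.gradX_eq_zero hz]
  have i2 : IntegrableOn (fun z => η z • V z) (spaceTime N) :=
    integrableOn_of_eq_zero_off ((h.locIntGrad.integrableOn_compact_subset hη.supp
      hη.compact).continuousOn_smul hη.smooth.continuous.continuousOn hη.compact)
      fun z hz => by simp [hη.eq_zero hz]
  have := congrArg (fun v => inner ℝ e v) (h.byParts η hη)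
  simp only [inner_neg_right] at this
  rw [← integral_inner i1, ← integral_inner i2] at this
  refine (integral_congr_ae (Eventually.of_forall fun z => ?_)).trans (this.trans
    (congrArg _ (integral_congr_ae (Eventually.of_forall fun z => ?_))))
  · simp only [inner_smul_right]
    rw [real_inner_comm, inner_gradX (hη.differentiable z)]
  · simp only [inner_smul_right]
    rw [real_inner_comm, mul_comm]

theorem inner_mollify {V : Space N × ℝ → Space N} (hV : LocallyIntegrable V) (n : ℕ)
    (x : Space N × ℝ) (e : Space N) :
    inner ℝ (mollify volume n V x) e = mollify volume n (fun z => inner ℝ (V z) e) x := by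
  have hc : Integrable fun y => (stdBump (Space N × ℝ) n).normed volume y • V (x - y) :=
    HasCompactSupport.convolutionExists_left (ContinuousLinearMap.lsmul ℝ ℝ)
      (stdBump _ n).hasCompactSupport_normed (stdBump _ n).continuous_normed hV x
  rw [mollify_apply, mollify_apply, real_inner_comm, ← integral_inner hc]
  refine integral_congr_ae (Eventually.of_forall fun y => ?_)
  simp only [inner_smul_right, smul_eq_mul]
  rw [real_inner_comm]

theorem eventually_closedBall_subset {K U : Set (Space N × ℝ)} (hK : IsCompact K) (hU : IsOpen U)
    (hKU : K ⊆ U) :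
    ∀ᶠ n in atTop, ∀ x ∈ K, Metric.closedBall x (stdBump (Space N × ℝ) n).rOut ⊆ U := by
  obtain ⟨δ, hδ, h⟩ := hK.exists_cthickening_subset_open hU hKU
  filter_upwards [(tendsto_stdBump_rOut (X := Space N × ℝ)).eventually_lt_const hδ] with n hn x hx
  exact ((Metric.closedBall_subset_closedBall hn.le).trans
    (Metric.closedBall_subset_cthickening hx δ)).trans h

/-- The composition of a mollified function with a smooth function, cut off by a test function. -/
theorem IsTest.comp_mollify_mul {χ : Space N × ℝ → ℝ} (hχ : IsTest χ) {S : ℝ → ℝ}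
    (hS : ContDiff ℝ ∞ S) {y : Space N × ℝ → ℝ} (hy : LocallyIntegrable y) (n : ℕ) :
    IsTest fun z => S (mollify volume n y z) * χ z :=
  hχ.mul_left (hS.comp (contDiff_mollify hy n))

theorem fderiv_comp_mollify_mul {χ : Space N × ℝ → ℝ} (hχ : IsTest χ) {S : ℝ → ℝ}
    (hS : ContDiff ℝ ∞ S) {y : Space N × ℝ → ℝ} (hy : LocallyIntegrable y) (n : ℕ)
    (z e : Space N × ℝ) :
    fderiv ℝ (fun z => S (mollify volume n y z) * χ z) z e
      = deriv S (mollify volume n y z) * χ z * fderiv ℝ (mollify volume n y) z e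
        + S (mollify volume n y z) * fderiv ℝ χ z e := by
  have h1 : HasFDerivAt (mollify volume n y) (fderiv ℝ (mollify volume n y) z) z :=
    ((contDiff_mollify hy n).differentiable (by simp) z).hasFDerivAt
  have h2 : HasDerivAt S (deriv S (mollify volume n y z)) (mollify volume n y z) :=
    (hS.differentiable (by simp) _).hasDerivAt
  have h3 : HasFDerivAt (fun z => S (mollify volume n y z)) _ z := h2.comp_hasFDerivAt z h1
  have h4 : HasFDerivAt (fun z => S (mollify volume n y z) * χ z) _ z :=
    h3.mul (hχ.differentiable z).hasFDerivAt
  rw [h4.fderiv]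
  simp only [add_apply, smul_apply, smul_eq_mul]
  ring

/-- Testing a differential inequality with `S z`, where `z` has the weak gradient `V` and the
flux `B` satisfies `B · V ≥ 0`. -/
theorem integral_nonlinear_test_le {p q : ℝ} (hpq : p.HolderConjugate q) {f : Space N → ℝ}
    (hf : Continuous f) (hf0 : ∀ x, 0 ≤ f x) {z d : Space N × ℝ → ℝ}
    {V B : Space N × ℝ → Space N} (hz : IsWeakGradX z V) (hV : MemLpLoc p V) (hB : MemLpLoc q B)
    (hd : LocallyIntegrableOn d (spaceTime N))
    (hineq : ∀ η, IsTest η → (∀ ζ, 0 ≤ η ζ) →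
      ∫ ζ in spaceTime N, (d ζ * η ζ + inner ℝ (B ζ) (gradX η ζ)) * f ζ.1 ≤ 0)
    (hmono : ∀ ζ, 0 ≤ inner ℝ (B ζ) (V ζ))
    {S : ℝ → ℝ} (hS : ContDiff ℝ ∞ S) (hS0 : ∀ s, 0 ≤ S s) (hS1 : ∀ s, S s ≤ 1)
    (hS' : ∀ s, 0 ≤ deriv S s) {C : ℝ} (hSC : ∀ s, deriv S s ≤ C)
    {χ : Space N × ℝ → ℝ} (hχ : IsTest χ) (hχ0 : ∀ ζ, 0 ≤ χ ζ) :
    (∫ ζ in spaceTime N, d ζ * χ ζ * f ζ.1 * S (z ζ))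
      + ∫ ζ in spaceTime N, inner ℝ (B ζ) (gradX χ ζ) * f ζ.1 * S (z ζ) ≤ 0 := by
  set K := tsupport χ with hKdef
  have hK : IsCompact K := hχ.compact
  -- Truncation takes place on a compact neighbourhood of the support of `χ`: for large `n` the
  -- mollifier centred at a point of `K` sees only `K'`.
  obtain ⟨K', hK', hKK', hK's⟩ := exists_compact_between hK isOpen_spaceTime hχ.supp
  set z' := K'.indicator z with hz'
  set V' := K'.indicator V with hV'
  have hz'i : Integrable z' :=
    (hz.locInt.integrableOn_compact_subset hK's hK').integrable_indicator hK'.measurableSet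
  have hV'i : Integrable V' :=
    (hz.locIntGrad.integrableOn_compact_subset hK's hK').integrable_indicator hK'.measurableSet
  have hV'p : MemLp V' (ENNReal.ofReal p) :=
    (memLp_indicator_iff_restrict hK'.measurableSet).2 (hV K' hK' hK's)
  set P := ENNReal.ofReal p with hP
  set Q := ENNReal.ofReal q with hQ
  have hPQ : ENNReal.HolderConjugate Q P := hpq.symm.ennrealOfReal
  have hP1 : 1 ≤ P := by rw [hP, ENNReal.one_le_ofReal]; exact hpq.lt.le
  have hPt : P ≠ ⊤ := ENNReal.ofReal_ne_top
  have hfc : Continuous fun ζ : Space N × ℝ => f ζ.1 := hf.comp continuous_fst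
  set zn : ℕ → Space N × ℝ → ℝ := fun n => mollify volume n z' with hzn
  set Vn : ℕ → Space N × ℝ → Space N := fun n => mollify volume n V' with hVn
  have hznc : ∀ n, Continuous (zn n) := fun n =>
    (contDiff_mollify hz'i.locallyIntegrable n).continuous
  have hVnc : ∀ n, Continuous (Vn n) := fun n =>
    (contDiff_mollify hV'i.locallyIntegrable n).continuous
  have hBK : MemLp B Q (volume.restrict K) := hB K hK hχ.supp
  have hinnI : ∀ W : Space N × ℝ → Space N, MemLp W P (volume.restrict K) →
      IntegrableOn (fun ζ => inner ℝ (B ζ) (W ζ)) K := fun W hW => by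
    rw [IntegrableOn, ← memLp_one_iff_integrable]
    exact MemLp.of_bilin (fun a b => inner ℝ a b) 1 hBK hW (hBK.1.inner hW.1)
      (Eventually.of_forall fun ζ => by
        simpa using nnnorm_inner_le_nnnorm (𝕜 := ℝ) (B ζ) (W ζ))
  -- the gradient of the approximate test function
  set ηn : ℕ → Space N × ℝ → ℝ := fun n ζ => S (zn n ζ) * χ ζ with hηn
  have hηt : ∀ n, IsTest (ηn n) := fun n =>
    hχ.comp_mollify_mul hS hz'i.locallyIntegrable n
  have hgrad : ∀ᶠ n in atTop, ∀ ζ, gradX (ηn n) ζ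
      = (deriv S (zn n ζ) * χ ζ) • Vn n ζ + S (zn n ζ) • gradX χ ζ := by
    filter_upwards [eventually_closedBall_subset hK isOpen_interior hKK'] with n hn ζ
    refine ext_inner_right ℝ fun e => ?_
    rw [inner_gradX ((hηt n).differentiable ζ), inner_add_left, inner_smul_left, inner_smul_left,
      inner_gradX (hχ.differentiable ζ)]
    simp only [conj_trivial]
    rw [hηn]
    simp only [hzn]
    rw [fderiv_comp_mollify_mul hχ hS hz'i.locallyIntegrable n ζ (e, 0)]
    by_cases hζ : ζ ∈ K
    · rw [fderiv_mollify_indicator hK' hK's hz.locInt (fun η hη => hz.integral_mul_fderiv e hη)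
        (hn ζ hζ), hVn, inner_mollify hV'i.locallyIntegrable]
      congr 3
      ext w
      by_cases hw : w ∈ K' <;> simp [hV', hw]
    · rw [hχ.eq_zero hζ]; simp
  -- the three terms
  have iA : IntegrableOn (fun ζ => d ζ * χ ζ * f ζ.1) (spaceTime N) := by
    have := hχ.integrableOn_mul hd (c := fun ζ => χ ζ * f ζ.1) (hχ.smooth.continuous.mul hfc)
      fun ζ hζ => by simp [hχ.eq_zero hζ]
    simpa only [mul_assoc] using this
  have iC : IntegrableOn (fun ζ => inner ℝ (B ζ) (gradX χ ζ) * f ζ.1) (spaceTime N) := by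
    refine integrableOn_of_eq_zero_off (K := K) ?_ fun ζ hζ => by simp [hχ.gradX_eq_zero hζ]
    refine IntegrableOn.mul_continuousOn (hinnI _ ?_) hfc.continuousOn hK
    have : MemLp (gradX χ) P volume :=
      hχ.continuous_gradX.memLp_of_hasCompactSupport
        (HasCompactSupport.intro hK fun ζ hζ => hχ.gradX_eq_zero hζ)
    exact this.restrict K
  have iB : IntegrableOn (fun ζ => inner ℝ (B ζ) (V' ζ) * (χ ζ * f ζ.1)) (spaceTime N) := by
    refine integrableOn_of_eq_zero_off (K := K) ?_ fun ζ hζ => by simp [hχ.eq_zero hζ]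
    exact (hinnI _ (hV'p.restrict K)).mul_continuousOn
      (hχ.smooth.continuous.mul hfc).continuousOn hK
  have hae : ∀ᵐ ζ ∂(volume.restrict (spaceTime N)), Tendsto (fun n => zn n ζ) atTop (𝓝 (z' ζ)) :=
    ae_restrict_of_ae (ae_tendsto_mollify hz'i.locallyIntegrable)
  have hzz : ∀ ζ ∈ K, z' ζ = z ζ := fun ζ hζ => indicator_of_mem (interior_subset (hKK' hζ)) _
  have hSb : ∀ s, |S s| ≤ 1 := fun s => abs_le.2 ⟨by linarith [hS0 s], hS1 s⟩
  have hS'b : ∀ s, |deriv S s| ≤ C := fun s => abs_le.2 ⟨by linarith [hS' s, hSC s], hSC s⟩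
  have hS'c : Continuous (deriv S) := hS.continuous_deriv (by simp)
  have tA : Tendsto (fun n => ∫ ζ in spaceTime N, d ζ * χ ζ * f ζ.1 * S (zn n ζ)) atTop
      (𝓝 (∫ ζ in spaceTime N, d ζ * χ ζ * f ζ.1 * S (z ζ))) := by
    refine tendsto_integral_mul_of_bounded iA
      (fun n => (hS.continuous.comp (hznc n)).aestronglyMeasurable) (fun n ζ => hSb _) ?_
    filter_upwards [hae] with ζ h1 h2
    have : ζ ∈ K := by
      by_contra h; exact h2 (by simp [hχ.eq_zero h])
    rw [← hzz ζ this]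
    exact (hS.continuous.tendsto _).comp h1
  have tC : Tendsto (fun n => ∫ ζ in spaceTime N, inner ℝ (B ζ) (gradX χ ζ) * f ζ.1 * S (zn n ζ))
      atTop (𝓝 (∫ ζ in spaceTime N, inner ℝ (B ζ) (gradX χ ζ) * f ζ.1 * S (z ζ))) := by
    refine tendsto_integral_mul_of_bounded iC
      (fun n => (hS.continuous.comp (hznc n)).aestronglyMeasurable) (fun n ζ => hSb _) ?_
    filter_upwards [hae] with ζ h1 h2
    have : ζ ∈ K := by
      by_contra h; exact h2 (by simp [hχ.gradX_eq_zero h])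
    rw [← hzz ζ this]
    exact (hS.continuous.tendsto _).comp h1
  have tB : Tendsto (fun n => ∫ ζ in spaceTime N,
      inner ℝ (B ζ) (V' ζ) * (χ ζ * f ζ.1) * deriv S (zn n ζ)) atTop
      (𝓝 (∫ ζ in spaceTime N, inner ℝ (B ζ) (V' ζ) * (χ ζ * f ζ.1) * deriv S (z' ζ))) := by
    refine tendsto_integral_mul_of_bounded iB
      (fun n => (hS'c.comp (hznc n)).aestronglyMeasurable) (fun n ζ => hS'b _) ?_
    filter_upwards [hae] with ζ h1 _
    exact (hS'c.tendsto _).comp h1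
  obtain ⟨M, hM⟩ : ∃ M : ℝ, ∀ ζ, |χ ζ * f ζ.1| ≤ M := by
    have hcs : HasCompactSupport fun ζ : Space N × ℝ => χ ζ * f ζ.1 := hχ.compact.mul_right
    obtain ⟨M, hM⟩ := (hχ.smooth.continuous.mul hfc).bounded_above_of_compact_support hcs
    exact ⟨M, fun ζ => by simpa using hM ζ⟩
  have hDV : ∀ n, MemLp (fun ζ => Vn n ζ - V' ζ) P (volume.restrict K) := fun n => by
    refine MemLp.sub ?_ (hV'p.restrict K)
    have : IsFiniteMeasure (volume.restrict K) := ⟨by simpa using hK.measure_lt_top⟩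
    obtain ⟨M, hM⟩ := hK.exists_bound_of_continuousOn (hVnc n).continuousOn
    exact MemLp.of_bound (hVnc n).aestronglyMeasurable M
      ((ae_restrict_iff' hK.measurableSet).2 (Eventually.of_forall hM))
  -- Error made by replacing the mollified gradient with the true one. Hölder with `B` in L^q on `K`
  -- and the L^p convergence of the mollified gradients make it vanish, since `deriv S` stays
  -- bounded.
  have tD : Tendsto (fun n => ∫ ζ in spaceTime N,
      inner ℝ (B ζ) (Vn n ζ - V' ζ) * (χ ζ * f ζ.1) * deriv S (zn n ζ)) atTop (𝓝 0) := by
    have hlim := tendsto_eLpNorm_mollify_sub hP1 hPt hV'p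
    have hcon : ENNReal.ofReal (M * C) * (eLpNorm B Q (volume.restrict K)) ≠ ⊤ :=
      ENNReal.mul_ne_top ENNReal.ofReal_ne_top hBK.2.ne
    have hb := ENNReal.Tendsto.const_mul hlim (Or.inr hcon)
    rw [mul_zero] at hb
    refine integral_eq_zero_of_tendsto_enorm hb (Eventually.of_forall fun n => ?_)
    have h1 : ∀ ζ, ‖inner ℝ (B ζ) (Vn n ζ - V' ζ) * (χ ζ * f ζ.1) * deriv S (zn n ζ)‖ₑ
        ≤ ENNReal.ofReal (M * C) * K.indicator (fun ζ => ‖inner ℝ (B ζ) (Vn n ζ - V' ζ)‖ₑ) ζ := by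
      intro ζ
      by_cases hζ : ζ ∈ K
      · rw [indicator_of_mem hζ, mul_assoc, enorm_mul, mul_comm]
        gcongr
        rw [Real.enorm_eq_ofReal_abs]
        apply ENNReal.ofReal_le_ofReal
        rw [abs_mul]
        exact mul_le_mul (hM ζ) (hS'b _) (abs_nonneg _) ((abs_nonneg _).trans (hM ζ))
      · simp [hχ.eq_zero hζ]
    calc _ ≤ ∫⁻ ζ in spaceTime N, ENNReal.ofReal (M * C)
            * K.indicator (fun ζ => ‖inner ℝ (B ζ) (Vn n ζ - V' ζ)‖ₑ) ζ := lintegral_mono h1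
      _ ≤ ∫⁻ ζ, ENNReal.ofReal (M * C)
            * K.indicator (fun ζ => ‖inner ℝ (B ζ) (Vn n ζ - V' ζ)‖ₑ) ζ := setLIntegral_le_lintegral _ _
      _ = ENNReal.ofReal (M * C) * ∫⁻ ζ in K, ‖inner ℝ (B ζ) (Vn n ζ - V' ζ)‖ₑ := by
          rw [lintegral_const_mul' _ _ ENNReal.ofReal_ne_top,
            lintegral_indicator hK.measurableSet]
      _ ≤ ENNReal.ofReal (M * C) * (eLpNorm B Q (volume.restrict K)
            * eLpNorm (fun ζ => Vn n ζ - V' ζ) P volume) := by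
          gcongr
          rw [← eLpNorm_one_eq_lintegral_enorm]
          refine (eLpNorm_le_eLpNorm_mul_eLpNorm'_of_norm (p := Q) (q := P) (r := 1) hBK.1 (hDV n).1
            (fun a b => inner ℝ a b) 1 (Eventually.of_forall fun ζ => by
              simpa using norm_inner_le_norm (𝕜 := ℝ) (B ζ) (Vn n ζ - V' ζ))).trans ?_
          simp only [ENNReal.coe_one, one_mul]
          exact mul_le_mul_right (eLpNorm_mono_measure _ Measure.restrict_le_self) _
      _ = _ := by rw [mul_assoc]
  -- The only place where monotonicity enters. This limit term is discarded at the end, which turns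
  -- the tested relation into an inequality for the other two.
  have hBnn : 0 ≤ ∫ ζ in spaceTime N, inner ℝ (B ζ) (V' ζ) * (χ ζ * f ζ.1) * deriv S (z' ζ) := by
    refine integral_nonneg fun ζ => ?_
    refine mul_nonneg (mul_nonneg ?_ (mul_nonneg (hχ0 _) (hf0 _))) (hS' _)
    by_cases hζ : ζ ∈ K'
    · rw [hV', indicator_of_mem hζ]; exact hmono ζ
    · rw [hV', indicator_of_notMem hζ]; simp
  have hsum := (tA.add tC).add (tB.add tD)
  have hle : ∀ᶠ n in atTop, ((∫ ζ in spaceTime N, d ζ * χ ζ * f ζ.1 * S (zn n ζ))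
      + ∫ ζ in spaceTime N, inner ℝ (B ζ) (gradX χ ζ) * f ζ.1 * S (zn n ζ))
      + ((∫ ζ in spaceTime N, inner ℝ (B ζ) (V' ζ) * (χ ζ * f ζ.1) * deriv S (zn n ζ))
      + ∫ ζ in spaceTime N,
        inner ℝ (B ζ) (Vn n ζ - V' ζ) * (χ ζ * f ζ.1) * deriv S (zn n ζ)) ≤ 0 := by
    filter_upwards [hgrad] with n hn
    have jS : ∀ {G : Space N × ℝ → ℝ}, IntegrableOn G (spaceTime N) →
        IntegrableOn (fun ζ => G ζ * S (zn n ζ)) (spaceTime N) := fun hG =>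
      hG.mul_bdd (c := 1) (hS.continuous.comp (hznc n)).aestronglyMeasurable
        (Eventually.of_forall fun ζ => hSb _)
    have jS' : ∀ {G : Space N × ℝ → ℝ}, IntegrableOn G (spaceTime N) →
        IntegrableOn (fun ζ => G ζ * deriv S (zn n ζ)) (spaceTime N) := fun hG =>
      hG.mul_bdd (c := C) (hS'c.comp (hznc n)).aestronglyMeasurable
        (Eventually.of_forall fun ζ => hS'b _)
    have iD : IntegrableOn (fun ζ => inner ℝ (B ζ) (Vn n ζ - V' ζ) * (χ ζ * f ζ.1))
        (spaceTime N) := by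
      refine integrableOn_of_eq_zero_off (K := K) ?_ fun ζ hζ => by simp [hχ.eq_zero hζ]
      exact (hinnI _ (hDV n)).mul_continuousOn (hχ.smooth.continuous.mul hfc).continuousOn hK
    refine le_of_eq_of_le ?_ (hineq (ηn n) (hηt n) fun ζ => mul_nonneg (hS0 _) (hχ0 _))
    rw [← integral_add (jS iA) (jS iC), ← integral_add (jS' iB) (jS' iD)]
    refine (integral_add ((jS iA).add (jS iC)) ((jS' iB).add (jS' iD))).symm.trans ?_
    refine integral_congr_ae (Eventually.of_forall fun ζ => ?_)
    simp only [Pi.add_apply, hn ζ, inner_add_right, inner_smul_right, inner_sub_right]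
    simp only [hηn]
    ring
  have := le_of_tendsto hsum hle
  linarith

end

section

/-! ### The chain rule in time and the evolution of the positive part -/

variable {N : ℕ}

theorem tendsto_integral_sub_mul_zero {G : ℕ → Space N × ℝ → ℝ} {H : Space N × ℝ → ℝ}
    {c : ℕ → Space N × ℝ → ℝ} {M : ℝ} (hc : ∀ n z, |c n z| ≤ M)
    (hG : Tendsto (fun n => eLpNorm (fun z => G n z - H z) 1 volume) atTop (𝓝 0)) :
    Tendsto (fun n => ∫ z in spaceTime N, (G n z - H z) * c n z) atTop (𝓝 0) := by
  have hb := ENNReal.Tendsto.const_mul hG (Or.inr (ENNReal.ofReal_ne_top (r := M)))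
  rw [mul_zero] at hb
  refine integral_eq_zero_of_tendsto_enorm hb (Eventually.of_forall fun n => ?_)
  rw [eLpNorm_one_eq_lintegral_enorm, ← lintegral_const_mul' _ _ ENNReal.ofReal_ne_top]
  refine (setLIntegral_le_lintegral _ _).trans (lintegral_mono fun z => ?_)
  rw [enorm_mul, mul_comm]
  gcongr
  rw [Real.enorm_eq_ofReal_abs]
  exact ENNReal.ofReal_le_ofReal (hc n z)

theorem tendsto_eLpNorm_comp_sub {F : ℝ → ℝ} (hF : ∀ a b, |F a - F b| ≤ |a - b|)
    {G : ℕ → Space N × ℝ → ℝ} {H : Space N × ℝ → ℝ}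
    (hG : Tendsto (fun n => eLpNorm (fun z => G n z - H z) 1 volume) atTop (𝓝 0)) :
    Tendsto (fun n => eLpNorm (fun z => F (G n z) - F (H z)) 1 volume) atTop (𝓝 0) :=
  tendsto_of_tendsto_of_tendsto_of_le_of_le tendsto_const_nhds hG (fun _ => zero_le)
    fun n => eLpNorm_mono fun z => hF _ _

/-- Chain rule for weak time derivatives, in weighted form. -/
theorem integral_time_chain_rule {f : Space N → ℝ} (hf : Continuous f)
    {y d : Space N × ℝ → ℝ} (hy : LocallyIntegrableOn y (spaceTime N))
    (hd : LocallyIntegrableOn d (spaceTime N))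
    (hw : ∀ η, IsTest η →
      ∫ z in spaceTime N, y z * derivT η z = -∫ z in spaceTime N, d z * η z)
    {F : ℝ → ℝ} (hF : ContDiff ℝ ∞ F) (hF1 : ∀ s, |deriv F s| ≤ 1)
    {χ : Space N × ℝ → ℝ} (hχ : IsTest χ) :
    ∫ ζ in spaceTime N, d ζ * χ ζ * f ζ.1 * deriv F (y ζ)
      = -∫ ζ in spaceTime N, F (y ζ) * (derivT χ ζ * f ζ.1) := by
  set K := tsupport χ with hKdef
  have hK : IsCompact K := hχ.compact
  obtain ⟨K', hK', hKK', hK's⟩ := exists_compact_between hK isOpen_spaceTime hχ.supp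
  set y' := K'.indicator y with hy'
  set d' := K'.indicator d with hd'
  have hy'i : Integrable y' :=
    (hy.integrableOn_compact_subset hK's hK').integrable_indicator hK'.measurableSet
  have hd'i : Integrable d' :=
    (hd.integrableOn_compact_subset hK's hK').integrable_indicator hK'.measurableSet
  have hfc : Continuous fun ζ : Space N × ℝ => f ζ.1 := hf.comp continuous_fst
  have hFL : ∀ a b, |F a - F b| ≤ |a - b| := fun a b => by
    have := Convex.norm_image_sub_le_of_norm_deriv_le (f := F) (C := 1) (s := univ) (x := b)
      (y := a) (fun x _ => hF.differentiable (by simp) x) (fun x _ => hF1 x) convex_univ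
      (mem_univ _) (mem_univ _)
    simpa using this
  have hF'c : Continuous (deriv F) := hF.continuous_deriv (by simp)
  set yn : ℕ → Space N × ℝ → ℝ := fun n => mollify volume n y' with hyn
  set dn : ℕ → Space N × ℝ → ℝ := fun n => mollify volume n d' with hdn
  have hync : ∀ n, Continuous (yn n) := fun n =>
    (contDiff_mollify hy'i.locallyIntegrable n).continuous
  have hdnc : ∀ n, Continuous (dn n) := fun n =>
    (contDiff_mollify hd'i.locallyIntegrable n).continuous
  set ηn : ℕ → Space N × ℝ → ℝ := fun n ζ => F (yn n ζ) * χ ζ with hηn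
  have hηt : ∀ n, IsTest (ηn n) := fun n => hχ.comp_mollify_mul hF hy'i.locallyIntegrable n
  have hder : ∀ᶠ n in atTop, ∀ ζ, derivT (ηn n) ζ
      = deriv F (yn n ζ) * χ ζ * dn n ζ + F (yn n ζ) * derivT χ ζ := by
    filter_upwards [eventually_closedBall_subset hK isOpen_interior hKK'] with n hn ζ
    rw [derivT_eq ((hηt n).differentiable ζ), derivT_eq (hχ.differentiable ζ)]
    simp only [hηn, hyn]
    rw [fderiv_comp_mollify_mul hχ hF hy'i.locallyIntegrable n ζ (0, 1)]
    by_cases hζ : ζ ∈ K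
    · rw [fderiv_mollify_indicator (d := d) hK' hK's hy (fun η hη => ?_) (hn ζ hζ)]
      rw [← hw η hη]
      exact integral_congr_ae (Eventually.of_forall fun z => by
        simp only [derivT_eq (hη.differentiable z)])
    · rw [hχ.eq_zero hζ]; simp
  have hae : ∀ᵐ ζ ∂(volume.restrict (spaceTime N)), Tendsto (fun n => yn n ζ) atTop (𝓝 (y' ζ)) :=
    ae_restrict_of_ae (ae_tendsto_mollify hy'i.locallyIntegrable)
  have hyy : ∀ ζ ∈ K, y' ζ = y ζ := fun ζ hζ => indicator_of_mem (interior_subset (hKK' hζ)) _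
  have hdd : ∀ ζ ∈ K, d' ζ = d ζ := fun ζ hζ => indicator_of_mem (interior_subset (hKK' hζ)) _
  obtain ⟨M, hM⟩ : ∃ M : ℝ, ∀ ζ, |χ ζ * f ζ.1| ≤ M := by
    have hcs : HasCompactSupport fun ζ : Space N × ℝ => χ ζ * f ζ.1 := hχ.compact.mul_right
    obtain ⟨M, hM⟩ := (hχ.smooth.continuous.mul hfc).bounded_above_of_compact_support hcs
    exact ⟨M, fun ζ => by simpa using hM ζ⟩
  obtain ⟨M', hM'⟩ : ∃ M : ℝ, ∀ ζ, |derivT χ ζ * f ζ.1| ≤ M := by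
    have hcs : HasCompactSupport fun ζ : Space N × ℝ => derivT χ ζ * f ζ.1 :=
      HasCompactSupport.intro hK fun ζ hζ => by simp [hχ.derivT_eq_zero hζ]
    obtain ⟨M, hM⟩ := (hχ.continuous_derivT.mul hfc).bounded_above_of_compact_support hcs
    exact ⟨M, fun ζ => by simpa using hM ζ⟩
  have iA : IntegrableOn (fun ζ => d ζ * χ ζ * f ζ.1) (spaceTime N) := by
    have := hχ.integrableOn_mul hd (c := fun ζ => χ ζ * f ζ.1) (hχ.smooth.continuous.mul hfc)
      fun ζ hζ => by simp [hχ.eq_zero hζ]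
    simpa only [mul_assoc] using this
  have tA : Tendsto (fun n => ∫ ζ in spaceTime N, d ζ * χ ζ * f ζ.1 * deriv F (yn n ζ)) atTop
      (𝓝 (∫ ζ in spaceTime N, d ζ * χ ζ * f ζ.1 * deriv F (y ζ))) := by
    refine tendsto_integral_mul_of_bounded iA
      (fun n => (hF'c.comp (hync n)).aestronglyMeasurable) (fun n ζ => hF1 _) ?_
    filter_upwards [hae] with ζ h1 h2
    have : ζ ∈ K := by
      by_contra h; exact h2 (by simp [hχ.eq_zero h])
    rw [← hyy ζ this]
    exact (hF'c.tendsto _).comp h1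
  have tB := tendsto_integral_sub_mul_zero (N := N) (G := dn) (H := d')
    (c := fun n ζ => χ ζ * f ζ.1 * deriv F (yn n ζ)) (M := M) (fun n z => by
      rw [abs_mul]
      exact (mul_le_mul (hM z) (hF1 _) (abs_nonneg _) ((abs_nonneg _).trans (hM z))).trans_eq
        (mul_one M))
    (tendsto_eLpNorm_mollify_sub le_rfl (by simp) ((memLp_one_iff_integrable).2 hd'i))
  have tC := tendsto_integral_sub_mul_zero (N := N) (G := fun n z => F (yn n z))
    (H := fun z => F (y' z)) (c := fun _ ζ => derivT χ ζ * f ζ.1) (M := M') (fun n z => hM' z)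
    (tendsto_eLpNorm_comp_sub hFL
      (tendsto_eLpNorm_mollify_sub le_rfl (by simp) ((memLp_one_iff_integrable).2 hy'i)))
  have iB : ∀ n, IntegrableOn (fun ζ => (dn n ζ - d' ζ) * (χ ζ * f ζ.1 * deriv F (yn n ζ)))
      (spaceTime N) := fun n => by
    refine integrableOn_of_eq_zero_off (K := K) ?_ fun ζ hζ => by simp [hχ.eq_zero hζ]
    exact (((hdnc n).continuousOn.integrableOn_compact hK).sub
      hd'i.integrableOn).mul_continuousOn
      ((hχ.smooth.continuous.mul hfc).mul (hF'c.comp (hync n))).continuousOn hK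
  -- `F 0` may be nonzero; subtracting it leaves a function dominated by |y'|, and the constant is
  -- integrable on the compact set.
  have iF' : IntegrableOn (fun ζ => F (y' ζ)) K := by
    have h1 : IntegrableOn (fun ζ => F (y' ζ) - F 0) K := by
      refine Integrable.mono hy'i.integrableOn
        ((hF.continuous.comp_aestronglyMeasurable hy'i.1.restrict).sub
          aestronglyMeasurable_const) (Eventually.of_forall fun ζ => ?_)
      simpa using hFL (y' ζ) 0
    have h2 := h1.add (integrableOn_const (C := F 0) hK.measure_lt_top.ne)
    exact h2.congr_fun (fun ζ _ => by simp) hK.measurableSet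
  have iC' : IntegrableOn (fun ζ => F (y' ζ) * (derivT χ ζ * f ζ.1)) (spaceTime N) := by
    refine integrableOn_of_eq_zero_off (K := K) ?_ fun ζ hζ => by simp [hχ.derivT_eq_zero hζ]
    exact iF'.mul_continuousOn (hχ.continuous_derivT.mul hfc).continuousOn hK
  have iC : ∀ n, IntegrableOn (fun ζ => (F (yn n ζ) - F (y' ζ)) * (derivT χ ζ * f ζ.1))
      (spaceTime N) := fun n => by
    refine integrableOn_of_eq_zero_off (K := K) ?_ fun ζ hζ => by simp [hχ.derivT_eq_zero hζ]
    exact (((hF.continuous.comp (hync n)).continuousOn.integrableOn_compact hK).sub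
      iF').mul_continuousOn (hχ.continuous_derivT.mul hfc).continuousOn hK
  -- For mollified `y` the chain rule is classical, and the integral of ∂_t(F(yₙ)χ) f is exactly
  -- zero. Rewriting it with `d` and `F (y' ζ)` leaves the two error terms of `tB` and `tC`.
  have hzero : ∀ᶠ n in atTop, (∫ ζ in spaceTime N, d ζ * χ ζ * f ζ.1 * deriv F (yn n ζ))
      + (∫ ζ in spaceTime N, (dn n ζ - d' ζ) * (χ ζ * f ζ.1 * deriv F (yn n ζ)))
      + ((∫ ζ in spaceTime N, (F (yn n ζ) - F (y' ζ)) * (derivT χ ζ * f ζ.1))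
      + ∫ ζ in spaceTime N, F (y' ζ) * (derivT χ ζ * f ζ.1)) = 0 := by
    filter_upwards [hder] with n hn
    have iA' : IntegrableOn (fun ζ => d ζ * χ ζ * f ζ.1 * deriv F (yn n ζ)) (spaceTime N) :=
      iA.mul_bdd (c := 1) (hF'c.comp (hync n)).aestronglyMeasurable
        (Eventually.of_forall fun ζ => hF1 _)
    rw [← integral_add iA' (iB n), ← integral_add (iC n) iC']
    refine (integral_add (iA'.add (iB n)) ((iC n).add iC')).symm.trans ?_
    rw [← (hηt n).integral_derivT_mul_weight hf]
    refine integral_congr_ae (Eventually.of_forall fun ζ => ?_)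
    simp only [Pi.add_apply, hn ζ]
    by_cases hζ : ζ ∈ K
    · rw [hdd ζ hζ]; ring
    · rw [hχ.eq_zero hζ, hχ.derivT_eq_zero hζ]; ring
  have hlim := (tA.add tB).add (tC.add_const
    (∫ ζ in spaceTime N, F (y' ζ) * (derivT χ ζ * f ζ.1)))
  have h0 := tendsto_nhds_unique (hlim.congr' hzero) tendsto_const_nhds
  have e : ∫ ζ in spaceTime N, F (y' ζ) * (derivT χ ζ * f ζ.1)
      = ∫ ζ in spaceTime N, F (y ζ) * (derivT χ ζ * f ζ.1) := by
    refine integral_congr_ae (Eventually.of_forall fun ζ => ?_)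
    by_cases hζ : ζ ∈ K
    · simp only [hyy ζ hζ]
    · simp only [hχ.derivT_eq_zero hζ]; ring
  rw [e] at h0
  linarith

/-! ### A smooth approximation of the positive part -/

theorem deriv_smoothTransition_nonneg (s : ℝ) : 0 ≤ deriv Real.smoothTransition s :=
  Real.smoothTransition.monotone.deriv_nonneg

theorem exists_deriv_smoothTransition_le : ∃ C, ∀ s, deriv Real.smoothTransition s ≤ C := by
  have hc : Continuous (deriv Real.smoothTransition) :=
    (Real.smoothTransition.contDiff (n := 1)).continuous_deriv (by simp)
  obtain ⟨C, hC⟩ := isCompact_Icc.exists_bound_of_continuousOn (s := Icc (0 : ℝ) 1)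
    hc.continuousOn
  have hC0 : 0 ≤ C := (norm_nonneg _).trans (hC 0 (by simp))
  refine ⟨C, fun s => ?_⟩
  rcases lt_or_ge s 0 with h | h
  · have : Real.smoothTransition =ᶠ[𝓝 s] fun _ => 0 := by
      filter_upwards [Iio_mem_nhds h] with x hx
      exact Real.smoothTransition.zero_of_nonpos (le_of_lt hx)
    rw [this.deriv_eq]; simpa using hC0
  rcases lt_or_ge 1 s with h' | h'
  · have : Real.smoothTransition =ᶠ[𝓝 s] fun _ => 1 := by
      filter_upwards [Ioi_mem_nhds h'] with x hx
      exact Real.smoothTransition.one_of_one_le (le_of_lt hx)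
    rw [this.deriv_eq]; simpa using hC0
  · exact (le_abs_self _).trans (hC s ⟨h, h'⟩)

/-- A smooth convex primitive that vanishes on the negative half-line and has slope `1` on
`[1, ∞)`. -/
def smoothRamp (s : ℝ) : ℝ := ∫ x in (0 : ℝ)..s, Real.smoothTransition x

theorem hasDerivAt_smoothRamp (s : ℝ) : HasDerivAt smoothRamp (Real.smoothTransition s) s :=
  intervalIntegral.integral_hasDerivAt_right
    (Real.smoothTransition.continuous.intervalIntegrable _ _)
    (Real.smoothTransition.continuous.stronglyMeasurableAtFilter _ _)
    Real.smoothTransition.continuous.continuousAt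

theorem deriv_smoothRamp : deriv smoothRamp = Real.smoothTransition :=
  funext fun s => (hasDerivAt_smoothRamp s).deriv

theorem contDiff_smoothRamp : ContDiff ℝ ∞ smoothRamp := by
  refine contDiff_infty_iff_deriv.2 ⟨fun s => (hasDerivAt_smoothRamp s).differentiableAt, ?_⟩
  rw [deriv_smoothRamp]
  exact Real.smoothTransition.contDiff (n := ⊤)

/-- The ramp and the positive part have the same slope outside [0, 1], so their difference is
bounded. Rescaling the argument by n+1 and dividing by n+1 turns this into a uniform error 1/(n+1).
-/
theorem abs_smoothRamp_sub_le (s : ℝ) : |smoothRamp s - max 0 s| ≤ 1 := by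
  have hi : ∀ a b, IntervalIntegrable Real.smoothTransition volume a b := fun a b =>
    Real.smoothTransition.continuous.intervalIntegrable _ _
  have hle : ∀ a b, a ≤ b → 0 ≤ ∫ x in a..b, Real.smoothTransition x := fun a b h =>
    intervalIntegral.integral_nonneg h fun x _ => Real.smoothTransition.nonneg x
  have hle1 : ∀ a b, a ≤ b → ∫ x in a..b, Real.smoothTransition x ≤ b - a := fun a b h => by
    have := intervalIntegral.integral_mono_on h (hi a b) intervalIntegrable_const
      fun x _ => Real.smoothTransition.le_one x
    simpa using this
  rcases le_total s 0 with h | h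
  · have : smoothRamp s = 0 := by
      rw [smoothRamp, intervalIntegral.integral_congr (g := fun _ => 0)]
      · simp
      · intro x hx
        rw [uIcc_of_ge h] at hx
        exact Real.smoothTransition.zero_of_nonpos hx.2
    rw [this, max_eq_left h]; simp
  · rw [max_eq_right h]
    rcases le_total s 1 with h1 | h1
    · rw [abs_le]
      constructor
      · linarith [hle 0 s h, show smoothRamp s = ∫ x in (0 : ℝ)..s, Real.smoothTransition x from rfl]
      · linarith [hle1 0 s h, show smoothRamp s = ∫ x in (0 : ℝ)..s, Real.smoothTransition x from rfl]
    · have e1 : smoothRamp s = (∫ x in (0 : ℝ)..1, Real.smoothTransition x)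
          + ∫ x in (1 : ℝ)..s, Real.smoothTransition x :=
        (intervalIntegral.integral_add_adjacent_intervals (hi _ _) (hi _ _)).symm
      have e2 : ∫ x in (1 : ℝ)..s, Real.smoothTransition x = s - 1 := by
        rw [intervalIntegral.integral_congr (g := fun _ => (1 : ℝ))]
        · simp
        · intro x hx
          rw [uIcc_of_le h1] at hx
          exact Real.smoothTransition.one_of_one_le hx.1
      rw [abs_le]
      constructor <;> linarith [hle 0 1 zero_le_one, hle1 0 1 zero_le_one]

theorem tendsto_smoothTransition_mul (s : ℝ) :
    Tendsto (fun n : ℕ => Real.smoothTransition (((n : ℝ) + 1) * s)) atTop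
      (𝓝 (if 0 < s then 1 else 0)) := by
  split_ifs with h
  · refine tendsto_const_nhds.congr' ?_
    obtain ⟨n₀, hn₀⟩ := exists_nat_gt (1 / s)
    filter_upwards [eventually_ge_atTop n₀] with n hn
    refine (Real.smoothTransition.one_of_one_le ?_).symm
    rw [div_lt_iff₀ h] at hn₀
    have : (n₀ : ℝ) ≤ n := by exact_mod_cast hn
    nlinarith
  · refine tendsto_const_nhds.congr fun n => ?_
    refine (Real.smoothTransition.zero_of_nonpos ?_).symm
    push Not at h
    exact mul_nonpos_of_nonneg_of_nonpos (by positivity) h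

theorem tendsto_smoothRamp_mul (s : ℝ) :
    Tendsto (fun n : ℕ => smoothRamp (((n : ℝ) + 1) * s) / (n + 1)) atTop (𝓝 (max 0 s)) := by
  rw [tendsto_iff_norm_sub_tendsto_zero]
  refine squeeze_zero (fun _ => norm_nonneg _) (fun n => ?_)
    (tendsto_one_div_add_atTop_nhds_zero_nat (𝕜 := ℝ))
  have hn : (0 : ℝ) < n + 1 := by positivity
  have e : smoothRamp (((n : ℝ) + 1) * s) / (n + 1) - max 0 s
      = (smoothRamp (((n : ℝ) + 1) * s) - max 0 (((n : ℝ) + 1) * s)) / (n + 1) := by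
    have : max 0 (((n : ℝ) + 1) * s) = (n + 1) * max 0 s := by
      rw [mul_max_of_nonneg _ _ hn.le, mul_zero]
    rw [this]; field_simp
  rw [e, norm_div, Real.norm_eq_abs, Real.norm_eq_abs, abs_of_pos hn]
  gcongr
  exact abs_smoothRamp_sub_le _

/-- The positive part of `y` decreases in the weak sense, if the equation tested with a
function of `z`, which has the sign of `y`, gives a nonpositive value. -/
theorem integral_posPart_mul_derivT_nonneg {p q : ℝ} (hpq : p.HolderConjugate q) {f : Space N → ℝ}
    (hf : Continuous f) (hf0 : ∀ x, 0 ≤ f x) {y z d : Space N × ℝ → ℝ}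
    {V B : Space N × ℝ → Space N} (hz : IsWeakGradX z V) (hV : MemLpLoc p V) (hB : MemLpLoc q B)
    (hy : LocallyIntegrableOn y (spaceTime N)) (hd : LocallyIntegrableOn d (spaceTime N))
    (hw : ∀ η, IsTest η →
      ∫ z in spaceTime N, y z * derivT η z = -∫ z in spaceTime N, d z * η z)
    (hineq : ∀ η, IsTest η → (∀ ζ, 0 ≤ η ζ) →
      ∫ ζ in spaceTime N, (d ζ * η ζ + inner ℝ (B ζ) (gradX η ζ)) * f ζ.1 ≤ 0)
    (hmono : ∀ ζ, 0 ≤ inner ℝ (B ζ) (V ζ))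
    (hyz : ∀ᵐ ζ ∂(volume.restrict (spaceTime N)), (0 < z ζ ↔ 0 < y ζ))
    {χ : Space N × ℝ → ℝ} (hχ : IsTest χ) (hχ0 : ∀ ζ, 0 ≤ χ ζ)
    (hoff : ∀ᵐ ζ ∂(volume.restrict (spaceTime N)), gradX χ ζ ≠ 0 → z ζ ≤ 0) :
    0 ≤ ∫ ζ in spaceTime N, max 0 (y ζ) * (derivT χ ζ * f ζ.1) := by
  have hfc : Continuous fun ζ : Space N × ℝ => f ζ.1 := hf.comp continuous_fst
  have hσc : Continuous Real.smoothTransition := Real.smoothTransition.continuous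
  have iA : IntegrableOn (fun ζ => d ζ * χ ζ * f ζ.1) (spaceTime N) := by
    have := hχ.integrableOn_mul hd (c := fun ζ => χ ζ * f ζ.1) (hχ.smooth.continuous.mul hfc)
      fun ζ hζ => by simp [hχ.eq_zero hζ]
    simpa only [mul_assoc] using this
  have iY : IntegrableOn (fun ζ => y ζ * (derivT χ ζ * f ζ.1)) (spaceTime N) :=
    hχ.integrableOn_mul hy (c := fun ζ => derivT χ ζ * f ζ.1) (hχ.continuous_derivT.mul hfc)
      fun ζ hζ => by simp [hχ.derivT_eq_zero hζ]
  have hσb : ∀ s, |Real.smoothTransition s| ≤ 1 := fun s => by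
    rw [abs_of_nonneg (Real.smoothTransition.nonneg s)]; exact Real.smoothTransition.le_one s
  have tconv : ∀ w : Space N × ℝ → ℝ, LocallyIntegrableOn w (spaceTime N) →
      Tendsto (fun n : ℕ => ∫ ζ in spaceTime N, d ζ * χ ζ * f ζ.1
        * Real.smoothTransition (((n : ℝ) + 1) * w ζ)) atTop
      (𝓝 (∫ ζ in spaceTime N, d ζ * χ ζ * f ζ.1 * (if 0 < w ζ then 1 else 0))) := fun w hw => by
    refine tendsto_integral_mul_of_bounded iA (C := 1) (fun n => ?_) (fun n ζ => hσb _)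
      (Eventually.of_forall fun ζ _ => tendsto_smoothTransition_mul _)
    exact hσc.comp_aestronglyMeasurable (hw.aestronglyMeasurable.const_mul _)
  -- Test with ever steeper steps of `z`. They vanish for z ≤ 0, hence wherever the cut-off has a
  -- gradient, so only the time term survives.
  have h1 : ∫ ζ in spaceTime N, d ζ * χ ζ * f ζ.1 * (if 0 < z ζ then 1 else 0) ≤ 0 := by
    refine le_of_tendsto (tconv z hz.locInt) (Eventually.of_forall fun n => ?_)
    obtain ⟨C, hC⟩ := exists_deriv_smoothTransition_le
    have hn : (0 : ℝ) < n + 1 := by positivity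
    have hder : ∀ s, deriv (fun s => Real.smoothTransition (((n : ℝ) + 1) * s)) s
        = (n + 1) * deriv Real.smoothTransition ((n + 1) * s) := fun s => by
      rw [deriv_comp_mul_left, smul_eq_mul]
    have := integral_nonlinear_test_le hpq hf hf0 hz hV hB hd hineq hmono
      (S := fun s => Real.smoothTransition (((n : ℝ) + 1) * s))
      ((Real.smoothTransition.contDiff (n := ⊤)).comp (contDiff_const.mul contDiff_id))
      (fun s => Real.smoothTransition.nonneg _) (fun s => Real.smoothTransition.le_one _)
      (fun s => by rw [hder]; exact mul_nonneg hn.le (deriv_smoothTransition_nonneg _))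
      (C := (n + 1) * C) (fun s => by rw [hder]; gcongr; exact hC _) hχ hχ0
    have e : ∫ ζ in spaceTime N, inner ℝ (B ζ) (gradX χ ζ) * f ζ.1
        * Real.smoothTransition (((n : ℝ) + 1) * z ζ) = 0 := by
      rw [← integral_zero (Space N × ℝ) ℝ (μ := volume.restrict (spaceTime N))]
      refine integral_congr_ae ?_
      filter_upwards [hoff] with ζ hζ
      by_cases h : gradX χ ζ = 0
      · simp [h]
      · rw [Real.smoothTransition.zero_of_nonpos
          (mul_nonpos_of_nonneg_of_nonpos hn.le (hζ h)), mul_zero]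
    rw [e, add_zero] at this
    exact this
  -- The same steps, now evaluated at `y`, are derivatives of the rescaled ramps. The time chain
  -- rule applies to these, and they tend to the positive part.
  have h2 : ∫ ζ in spaceTime N, d ζ * χ ζ * f ζ.1 * (if 0 < y ζ then 1 else 0)
      = -∫ ζ in spaceTime N, max 0 (y ζ) * (derivT χ ζ * f ζ.1) := by
    refine tendsto_nhds_unique (tconv y hy) ?_
    have hrampd : ∀ (n : ℕ) (s : ℝ), HasDerivAt
        (fun s => smoothRamp (((n : ℝ) + 1) * s) / (n + 1))
        (Real.smoothTransition (((n : ℝ) + 1) * s)) s := fun n s => by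
      have hn : (n : ℝ) + 1 ≠ 0 := by positivity
      have h := ((hasDerivAt_smoothRamp (((n : ℝ) + 1) * s)).comp s
        ((hasDerivAt_id s).const_mul ((n : ℝ) + 1))).div_const ((n : ℝ) + 1)
      refine h.congr_deriv ?_
      field_simp
    have hrampD : ∀ n : ℕ, deriv (fun s => smoothRamp (((n : ℝ) + 1) * s) / (n + 1))
        = fun s => Real.smoothTransition (((n : ℝ) + 1) * s) := fun n =>
      funext fun s => (hrampd n s).deriv
    have hch : ∀ n : ℕ, ∫ ζ in spaceTime N, d ζ * χ ζ * f ζ.1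
          * Real.smoothTransition (((n : ℝ) + 1) * y ζ)
        = -∫ ζ in spaceTime N, smoothRamp (((n : ℝ) + 1) * y ζ) / (n + 1)
          * (derivT χ ζ * f ζ.1) := fun n => by
      have := integral_time_chain_rule hf hy hd hw
        (F := fun s => smoothRamp (((n : ℝ) + 1) * s) / (n + 1))
        ((contDiff_smoothRamp.comp (contDiff_const.mul contDiff_id)).div_const _)
        (fun s => by rw [hrampD]; exact hσb _) hχ
      rwa [hrampD] at this
    simp_rw [hch]
    refine Tendsto.neg ?_
    have hK0 : ∀ (n : ℕ) (s : ℝ), |smoothRamp (((n : ℝ) + 1) * s) / (n + 1)| ≤ |s| :=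
      fun n s => by
      have := Convex.norm_image_sub_le_of_norm_deriv_le
        (f := fun s => smoothRamp (((n : ℝ) + 1) * s) / (n + 1)) (C := 1) (s := univ) (x := 0)
        (y := s) (fun x _ => (hrampd n x).differentiableAt)
        (fun x _ => by rw [hrampD]; exact hσb _) convex_univ (mem_univ _) (mem_univ _)
      simpa [smoothRamp, abs_div] using this
    refine tendsto_integral_of_dominated_convergence
      (fun ζ => ‖y ζ * (derivT χ ζ * f ζ.1)‖) (fun n => ?_) iY.norm
      (fun n => Eventually.of_forall fun ζ => ?_) (Eventually.of_forall fun ζ => ?_)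
    · refine AEStronglyMeasurable.mul ?_
        (hχ.continuous_derivT.mul hfc).aestronglyMeasurable
      have hc : Continuous fun s => smoothRamp (((n : ℝ) + 1) * s) / (n + 1) :=
        (contDiff_smoothRamp.continuous.comp (continuous_const.mul continuous_id)).div_const _
      exact hc.comp_aestronglyMeasurable hy.aestronglyMeasurable
    · rw [norm_mul, norm_mul (y ζ)]
      exact mul_le_mul_of_nonneg_right (hK0 n _) (norm_nonneg _)
    · exact (tendsto_smoothRamp_mul _).mul_const _
  -- The two smooth approximations differ, but their limits are the same indicator. This allows `z`
  -- to carry the gradient while `y` carries the time derivative.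
  have h3 : ∫ ζ in spaceTime N, d ζ * χ ζ * f ζ.1 * (if 0 < z ζ then 1 else 0)
      = ∫ ζ in spaceTime N, d ζ * χ ζ * f ζ.1 * (if 0 < y ζ then 1 else 0) := by
    refine integral_congr_ae ?_
    filter_upwards [hyz] with ζ hζ
    simp only [hζ]
  linarith

end

section

/-! ### The comparison principle -/

variable {N : ℕ}

theorem hasDerivAt_smoothStep (s ε τ : ℝ) :
    HasDerivAt (fun τ => Real.smoothTransition ((τ - s) / ε))
      (deriv Real.smoothTransition ((τ - s) / ε) / ε) τ := by
  have h1 : HasDerivAt Real.smoothTransition (deriv Real.smoothTransition ((τ - s) / ε))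
      ((τ - s) / ε) :=
    ((Real.smoothTransition.contDiff (n := 1)).differentiable (by simp) _).hasDerivAt
  have h2 : HasDerivAt (fun τ : ℝ => (τ - s) / ε) (1 / ε) τ :=
    ((hasDerivAt_id τ).sub_const s).div_const ε
  refine (h1.comp τ h2).congr_deriv ?_
  ring

/-- A function with nonpositive distributional derivative is nonincreasing. -/
theorem le_of_forall_integral_deriv_mul_nonneg {h : ℝ → ℝ} (hc : ContinuousOn h (Ioi 0))
    (H : ∀ θ : ℝ → ℝ, ContDiff ℝ ∞ θ → HasCompactSupport θ → tsupport θ ⊆ Ioi 0 →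
      (∀ t, 0 ≤ θ t) → 0 ≤ ∫ t in Ioi (0 : ℝ), deriv θ t * h t)
    {s r : ℝ} (hs : 0 < s) (hsr : s < r) : h r ≤ h s := by
  by_contra! hlt
  set c₁ := h s + (h r - h s) / 3 with hc₁
  set c₂ := h s + 2 * (h r - h s) / 3 with hc₂
  have hr : 0 < r := hs.trans hsr
  have n1 : ∀ᶠ t in 𝓝 s, h t < c₁ :=
    (hc.continuousAt (Ioi_mem_nhds hs)).eventually_lt_const (by rw [hc₁]; linarith)
  have n2 : ∀ᶠ t in 𝓝 r, c₂ < h t :=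
    (hc.continuousAt (Ioi_mem_nhds hr)).eventually_const_lt (by rw [hc₂]; linarith)
  obtain ⟨ε₁, hε₁, b1⟩ := Metric.eventually_nhds_iff.1 n1
  obtain ⟨ε₂, hε₂, b2⟩ := Metric.eventually_nhds_iff.1 n2
  set ε := min (min ε₁ ε₂) (r - s) / 2 with hε
  have hm : 0 < min (min ε₁ ε₂) (r - s) := lt_min (lt_min hε₁ hε₂) (by linarith)
  have hε0 : 0 < ε := by positivity
  have hεε₁ : ε < ε₁ := by
    have : min (min ε₁ ε₂) (r - s) ≤ ε₁ := (min_le_left _ _).trans (min_le_left _ _)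
    linarith
  have hεε₂ : ε < ε₂ := by
    have : min (min ε₁ ε₂) (r - s) ≤ ε₂ := (min_le_left _ _).trans (min_le_right _ _)
    linarith
  have hεr : ε < r - s := by
    have : min (min ε₁ ε₂) (r - s) ≤ r - s := min_le_right _ _
    linarith
  set σ := Real.smoothTransition
  have s0 : ∀ x, x ≤ 0 → σ x = 0 := fun x hx => Real.smoothTransition.zero_of_nonpos hx
  have s1 : ∀ x, 1 ≤ x → σ x = 1 := fun x hx => Real.smoothTransition.one_of_one_le hx
  have d0 : ∀ x y, x ≤ y → σ ((x - y) / ε) = 0 := fun x y h =>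
    s0 _ (div_nonpos_of_nonpos_of_nonneg (by linarith) hε0.le)
  have d1 : ∀ x y, y + ε ≤ x → σ ((x - y) / ε) = 1 := fun x y h =>
    s1 _ (by rw [le_div_iff₀ hε0]; linarith)
  -- A smooth plateau whose derivative is a bump of mass one just after `s` minus a bump of mass one
  -- just after `r`. On the first h < c₁ and on the second h > c₂, so the tested integral is at most
  -- c₁ - c₂ < 0.
  set θ : ℝ → ℝ := fun τ => σ ((τ - s) / ε) - σ ((τ - r) / ε) with hθ
  set a : ℝ → ℝ := fun τ => deriv σ ((τ - s) / ε) / ε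
  set b : ℝ → ℝ := fun τ => deriv σ ((τ - r) / ε) / ε
  have hθd : ∀ τ, HasDerivAt θ (a τ - b τ) τ := fun τ =>
    (hasDerivAt_smoothStep s ε τ).sub (hasDerivAt_smoothStep r ε τ)
  have hσs : ContDiff ℝ ∞ σ := Real.smoothTransition.contDiff (n := ⊤)
  have hθs : ContDiff ℝ ∞ θ := by
    refine (hσs.comp ?_).sub (hσs.comp ?_) <;>
    exact (contDiff_id.sub contDiff_const).div_const _
  have hsupp : Function.support θ ⊆ Icc s (r + ε) := by
    intro τ hτ
    by_contra hn
    apply hτ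
    rw [mem_Icc, not_and_or, not_le, not_le] at hn
    rcases hn with hn | hn
    · simp only [hθ]
      rw [d0 _ _ hn.le, d0 _ _ (hn.le.trans hsr.le), sub_zero]
    · simp only [hθ]
      rw [d1 _ _ (by linarith), d1 _ _ hn.le, sub_self]
  have hts : tsupport θ ⊆ Icc s (r + ε) := closure_minimal hsupp isClosed_Icc
  have hcs : HasCompactSupport θ := HasCompactSupport.of_support_subset_isCompact isCompact_Icc hsupp
  have hθ0 : ∀ τ, 0 ≤ θ τ := fun τ => by
    simp only [hθ, sub_nonneg]
    exact Real.smoothTransition.monotone (by gcongr)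
  have key := H θ hθs hcs (hts.trans fun τ hτ => hs.trans_le hτ.1) hθ0
  have hac : Continuous a := by
    refine Continuous.div_const ((hσs.continuous_deriv (by simp)).comp ?_) _
    fun_prop
  have hbc : Continuous b := by
    refine Continuous.div_const ((hσs.continuous_deriv (by simp)).comp ?_) _
    fun_prop
  have hzero : ∀ (q τ : ℝ), τ < q ∨ q + ε < τ → deriv σ ((τ - q) / ε) / ε = 0 := by
    intro q τ h
    rcases h with h | h
    · have : (fun τ => σ ((τ - q) / ε)) =ᶠ[𝓝 τ] fun _ => 0 := by
        filter_upwards [Iio_mem_nhds h] with x hx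
        exact d0 _ _ (mem_Iio.1 hx).le
      rw [← (hasDerivAt_smoothStep q ε τ).deriv, this.deriv_eq]; simp
    · have : (fun τ => σ ((τ - q) / ε)) =ᶠ[𝓝 τ] fun _ => 1 := by
        filter_upwards [Ioi_mem_nhds h] with x hx
        exact d1 _ _ (mem_Ioi.1 hx).le
      rw [← (hasDerivAt_smoothStep q ε τ).deriv, this.deriv_eq]; simp
  have hnn : ∀ q τ : ℝ, 0 ≤ deriv σ ((τ - q) / ε) / ε := fun q τ =>
    div_nonneg (deriv_smoothTransition_nonneg _) hε0.le
  set T := r + 2 * ε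
  have hsT : s ≤ T := by simp only [T]; linarith
  have e1 : ∫ t in Ioi (0 : ℝ), deriv θ t * h t = ∫ t in s..T, (a t - b t) * h t := by
    rw [intervalIntegral.integral_of_le hsT]
    rw [setIntegral_eq_of_subset_of_forall_sdiff_eq_zero measurableSet_Ioi
      (s := Ioc s T) (fun t ht => hs.trans ht.1)]
    · exact setIntegral_congr_fun measurableSet_Ioc fun t _ => by simp only [(hθd t).deriv]
    · intro t ht
      have : t ∉ Ioc s T := ht.2
      rw [mem_Ioc, not_and_or, not_lt, not_le] at this
      have : deriv θ t = 0 := by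
        rcases this with h1 | h1
        · rcases h1.lt_or_eq with h2 | h2
          · exact image_eq_zero_of_notMem_tsupport fun h3 =>
              absurd (hts (tsupport_deriv_subset h3)).1 (by linarith)
          · rw [h2]
            -- The endpoint `s` may lie in the closed support, so the derivative vanishes there
            -- because `θ` attains its minimum.
            have hmin : IsLocalMin θ s := Eventually.of_forall fun x => by
              have : θ s = 0 := by
                simp only [hθ]
                rw [d0 _ _ le_rfl, d0 _ _ hsr.le, sub_zero]
              rw [this]; exact hθ0 x
            exact hmin.deriv_eq_zero
        · exact image_eq_zero_of_notMem_tsupport fun h3 =>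
            absurd (hts (tsupport_deriv_subset h3)).2 (by simp only [T] at h1; linarith)
      rw [this, zero_mul]
  have hint : ∀ q : ℝ, s ≤ q → q + ε ≤ T → ∫ t in s..T, deriv σ ((t - q) / ε) / ε = 1 := by
    intro q h1 h2
    have hcq : Continuous fun t => deriv σ ((t - q) / ε) / ε := by
      refine Continuous.div_const ((hσs.continuous_deriv (by simp)).comp ?_) _
      fun_prop
    rw [intervalIntegral.integral_eq_sub_of_hasDerivAt
      (fun t _ => hasDerivAt_smoothStep q ε t) (hcq.intervalIntegrable _ _)]
    change σ _ - σ _ = 1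
    rw [d1 _ _ h2, d0 _ _ h1, sub_zero]
  have e2 : ∫ t in s..T, (a t - b t) * h t ≤ ∫ t in s..T, (c₁ * a t - c₂ * b t) := by
    refine intervalIntegral.integral_mono_on hsT ?_ ?_ fun t ht => ?_
    · refine ContinuousOn.intervalIntegrable ?_
      rw [uIcc_of_le hsT]
      exact (hac.sub hbc).continuousOn.mul (hc.mono fun t ht => hs.trans_le ht.1)
    · exact ((continuous_const.mul hac).sub (continuous_const.mul hbc)).intervalIntegrable _ _
    · have ha : a t * h t ≤ c₁ * a t := by
        by_cases hh : t < s ∨ s + ε < t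
        · have : a t = 0 := hzero s t hh
          rw [this]; simp
        · push Not at hh
          rw [mul_comm]
          refine mul_le_mul_of_nonneg_right (b1 ?_).le (hnn s t)
          rw [Real.dist_eq, abs_lt]; constructor <;> linarith
      have hb : c₂ * b t ≤ b t * h t := by
        by_cases hh : t < r ∨ r + ε < t
        · have : b t = 0 := hzero r t hh
          rw [this]; simp
        · push Not at hh
          rw [mul_comm (b t)]
          refine mul_le_mul_of_nonneg_right (b2 ?_).le (hnn r t)
          rw [Real.dist_eq, abs_lt]; constructor <;> linarith
      linarith
  have e3 : ∫ t in s..T, (c₁ * a t - c₂ * b t) = c₁ - c₂ := by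
    have i1 : IntervalIntegrable (fun t => c₁ * a t) volume s T :=
      (continuous_const.mul hac).intervalIntegrable _ _
    have i2 : IntervalIntegrable (fun t => c₂ * b t) volume s T :=
      (continuous_const.mul hbc).intervalIntegrable _ _
    rw [intervalIntegral.integral_sub i1 i2, intervalIntegral.integral_const_mul,
      intervalIntegral.integral_const_mul, hint s le_rfl (by simp only [T]; linarith),
      hint r hsr.le (by simp only [T]; linarith)]
    ring
  rw [e1] at key
  have : c₁ - c₂ < 0 := by rw [hc₁, hc₂]; linarith
  linarith

/-- By Cauchy–Schwarz the product is at least a positive constant times (|v|^{p-1} - |w|^{p-1})(|v|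
- |w|), whose factors have the same sign. No distinction between p < 2 and p ≥ 2 is needed. -/
theorem flux_monotone {p m : ℝ} (hp : 1 < p) (hq : 0 < gradExponent p m) (v w : Space N) :
    0 ≤ inner ℝ (flux p m v - flux p m w) (v - w) := by
  set c := gradExponent p m ^ (-(p - 1))
  have hc : 0 ≤ c := Real.rpow_nonneg hq.le _
  -- At v = 0 the value assigned to the possibly negative power p - 2 is immaterial, since it is
  -- multiplied by zero.
  have hpow : ∀ v : Space N, ‖v‖ ^ (p - 2) * ‖v‖ = ‖v‖ ^ (p - 1) := fun v => by
    rcases eq_or_ne v 0 with rfl | hv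
    · simp [Real.zero_rpow (show p - 1 ≠ 0 by linarith)]
    · rw [← Real.rpow_add_one (norm_ne_zero_iff.2 hv)]
      ring_nf
  have hn : ∀ v : Space N, 0 ≤ ‖v‖ ^ (p - 2) := fun v => Real.rpow_nonneg (norm_nonneg _) _
  have e : inner ℝ (flux p m v - flux p m w) (v - w)
      = c * (‖v‖ ^ (p - 2) * ‖v‖ ^ 2 + ‖w‖ ^ (p - 2) * ‖w‖ ^ 2
        - (‖v‖ ^ (p - 2) + ‖w‖ ^ (p - 2)) * inner ℝ v w) := by
    simp only [flux, inner_sub_left, inner_sub_right, real_inner_smul_left,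
      real_inner_self_eq_norm_sq, real_inner_comm v w]
    ring
  rw [e]
  refine mul_nonneg hc ?_
  have h1 : inner ℝ v w ≤ ‖v‖ * ‖w‖ := real_inner_le_norm v w
  have h2 : 0 ≤ (‖v‖ ^ (p - 1) - ‖w‖ ^ (p - 1)) * (‖v‖ - ‖w‖) := by
    rcases le_total ‖v‖ ‖w‖ with h | h
    · exact mul_nonneg_of_nonpos_of_nonpos
        (sub_nonpos.2 (Real.rpow_le_rpow (norm_nonneg _) h (by linarith))) (by linarith)
    · exact mul_nonneg (sub_nonneg.2 (Real.rpow_le_rpow (norm_nonneg _) h (by linarith)))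
        (by linarith)
  rw [← hpow v, ← hpow w] at h2
  have h3 := mul_le_mul_of_nonneg_left h1 (add_nonneg (hn v) (hn w))
  nlinarith

/-! ### Local integrability of the flux, the solution and its time derivative. -/

theorem norm_flux {p m : ℝ} (hp : 1 < p) (hq : 0 < gradExponent p m) (v : Space N) :
    ‖flux p m v‖ = gradExponent p m ^ (-(p - 1)) * ‖v‖ ^ (p - 1) := by
  rw [flux, norm_smul, Real.norm_eq_abs, abs_of_nonneg (mul_nonneg (Real.rpow_nonneg hq.le _)
    (Real.rpow_nonneg (norm_nonneg _) _)), mul_assoc]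
  congr 1
  rcases eq_or_ne v 0 with rfl | hv
  · simp [Real.zero_rpow (show p - 1 ≠ 0 by linarith)]
  · rw [← Real.rpow_add_one (norm_ne_zero_iff.2 hv)]
    ring_nf

/-- The norm of the flux is a multiple of |V|^{p-1}, and p - 1 times the conjugate exponent is p. -/
theorem MemLpLoc.flux {p m : ℝ} (hp : 1 < p) (hq : 0 < gradExponent p m)
    {V : Space N × ℝ → Space N} (hV : MemLpLoc p V) :
    MemLpLoc p.conjExponent fun z => flux p m (V z) := by
  intro K hK hKs
  have h := hV K hK hKs
  have h1 := h.norm_rpow_div (ENNReal.ofReal (p - 1))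
  rw [ENNReal.toReal_ofReal (by linarith), ← ENNReal.ofReal_div_of_pos (by linarith)] at h1
  refine h1.of_le_mul (c := gradExponent p m ^ (-(p - 1))) ?_ (Eventually.of_forall fun z => ?_)
  · exact ((h.1.norm.aemeasurable.pow_const _).const_mul _).aestronglyMeasurable.smul h.1
  · rw [norm_flux hp hq, Real.norm_eq_abs, abs_of_nonneg (Real.rpow_nonneg (norm_nonneg _) _)]

/-- A compact subset of the open half-space stays away from t = 0, where no bound is assumed. -/
theorem locallyIntegrableOn_of_bounded {u : Space N × ℝ → ℝ}
    (h : ∀ tbar, 0 < tbar → MemLp u ∞ (volume.restrict (univ ×ˢ Ioi tbar))) :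
    LocallyIntegrableOn u (spaceTime N) := by
  refine (locallyIntegrableOn_iff isOpen_spaceTime.isLocallyClosed).2 fun K hKs hK => ?_
  obtain rfl | hne := K.eq_empty_or_nonempty
  · simp
  obtain ⟨z₀, hz₀, hmin⟩ := hK.exists_isMinOn hne continuous_snd.continuousOn
  have h0 : 0 < z₀.2 := (hKs hz₀).2
  have hsub : K ⊆ univ ×ˢ Ioi (z₀.2 / 2) := fun z hz =>
    ⟨mem_univ _, by have := hmin hz; simp only [mem_ofPred_eq] at this; rw [mem_Ioi]; linarith⟩
  have hf : IsFiniteMeasure (volume.restrict K) := ⟨by simpa using hK.measure_lt_top⟩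
  exact ((h (z₀.2 / 2) (by linarith)).mono_measure
    (Measure.restrict_mono hsub le_rfl)).integrable le_top

theorem locallyIntegrableOn_timeDeriv {g : ℝ → ℝ} (hg : ∀ s, 0 ≤ s → 0 ≤ g s)
    {w : Space N × ℝ → ℝ} (hm : AEStronglyMeasurable w (volume.restrict (spaceTime N)))
    (hb : ∀ K : Set (Space N), IsCompact K → ∀ a b : ℝ, 0 < a → ∃ C : ℝ,
      ∀ᵐ t ∂(volume.restrict (Icc a b)),
        ∫⁻ x in K, ‖w (x, t)‖ₑ ∂(weightMeasure N g) ≤ ENNReal.ofReal C) :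
    LocallyIntegrableOn w (spaceTime N) := by
  refine (locallyIntegrableOn_iff isOpen_spaceTime.isLocallyClosed).2 fun K hKs hK => ?_
  obtain rfl | hne := K.eq_empty_or_nonempty
  · simp
  obtain ⟨z₀, hz₀, hmin⟩ := hK.exists_isMinOn hne continuous_snd.continuousOn
  obtain ⟨z₁, hz₁, hmax⟩ := hK.exists_isMaxOn hne continuous_snd.continuousOn
  have h0 : 0 < z₀.2 := (hKs hz₀).2
  set K₁ := Prod.fst '' K
  have hK₁ : IsCompact K₁ := hK.image continuous_fst
  have hsub : K ⊆ K₁ ×ˢ Icc z₀.2 z₁.2 := fun z hz => ⟨⟨z, hz, rfl⟩, hmin hz, hmax hz⟩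
  have hsub2 : K₁ ×ˢ Icc z₀.2 z₁.2 ⊆ spaceTime N := fun z hz =>
    ⟨mem_univ _, h0.trans_le hz.2.1⟩
  refine IntegrableOn.mono_set ?_ hsub
  obtain ⟨C, hC⟩ := hb K₁ hK₁ z₀.2 z₁.2 h0
  have hmeas : AEStronglyMeasurable w (volume.restrict (K₁ ×ˢ Icc z₀.2 z₁.2)) :=
    hm.mono_measure (Measure.restrict_mono hsub2 le_rfl)
  refine ⟨hmeas, ?_⟩
  -- The weight is at least one because g ≥ 0, so weighted bounds imply Lebesgue bounds.
  have hle : (volume : Measure (Space N)) ≤ weightMeasure N g := by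
    conv_lhs => rw [← withDensity_one (μ := (volume : Measure (Space N)))]
    refine withDensity_mono (Eventually.of_forall fun x => ?_)
    rw [Pi.one_apply, ENNReal.one_le_ofReal, weight]
    exact Real.one_le_exp (hg _ (norm_nonneg _))
  have hmeq : (volume : Measure (Space N × ℝ)).restrict (K₁ ×ˢ Icc z₀.2 z₁.2)
      = (volume.restrict K₁).prod (volume.restrict (Icc z₀.2 z₁.2)) := by
    rw [Measure.prod_restrict]; rfl
  rw [HasFiniteIntegral, hmeq, lintegral_prod_symm _ (by rw [← hmeq]; exact hmeas.enorm)]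
  calc ∫⁻ t in Icc z₀.2 z₁.2, ∫⁻ x in K₁, ‖w (x, t)‖ₑ
      ≤ ∫⁻ _ in Icc z₀.2 z₁.2, ENNReal.ofReal C := by
        refine lintegral_mono_ae ?_
        filter_upwards [hC] with t ht
        exact (lintegral_mono' (Measure.restrict_mono_measure hle _) le_rfl).trans ht
    _ < ⊤ := by
        rw [lintegral_const]
        exact ENNReal.mul_lt_top ENNReal.ofReal_lt_top (by simp)

theorem continuous_weight {g : ℝ → ℝ} (hg : ContinuousOn g (Ici 0)) :
    Continuous (weight g : Space N → ℝ) :=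
  Real.continuous_exp.comp (hg.comp_continuous continuous_norm fun x => norm_nonneg x)

theorem weight_pos (g : ℝ → ℝ) (x : Space N) : 0 < weight g x := Real.exp_pos _

theorem integrableOn_inner_gradX {q : ℝ} (hq : 1 ≤ q) {A : Space N × ℝ → Space N}
    (hA : MemLpLoc q A) {f : Space N → ℝ} (hf : Continuous f) {η : Space N × ℝ → ℝ}
    (hη : IsTest η) :
    IntegrableOn (fun ζ => inner ℝ (A ζ) (gradX η ζ) * f ζ.1) (spaceTime N) := by
  have hK := hη.compact.isCompact
  refine integrableOn_of_eq_zero_off (K := tsupport η) ?_ fun z hz => by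
    simp [hη.gradX_eq_zero hz]
  refine IntegrableOn.mul_continuousOn ?_ (hf.comp continuous_fst).continuousOn hK
  have : IsFiniteMeasure (volume.restrict (tsupport η)) := ⟨by simpa using hK.measure_lt_top⟩
  have hAi := (hA _ hK hη.supp).integrable (by rwa [ENNReal.one_le_ofReal])
  obtain ⟨M, hM⟩ := hK.exists_bound_of_continuousOn hη.continuous_gradX.continuousOn
  refine Integrable.mono (hAi.norm.mul_const M)
    (hAi.1.inner hη.continuous_gradX.aestronglyMeasurable)
    ((ae_restrict_iff' hK.measurableSet).2 (Eventually.of_forall fun z hz => ?_))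
  rw [norm_mul, norm_norm]
  refine (norm_inner_le_norm _ _).trans ?_
  gcongr
  exact (hM z hz).trans (le_abs_self M)

/-- Here strongness is used: the time derivative moves from the test function to u. Test functions
that themselves depend on the solutions then become usable, as no time derivative falls on them. -/
theorem weakForm_eq {p m : ℝ} (hp : 1 < p) (hq : 0 < gradExponent p m) {g : ℝ → ℝ}
    (hg : ContinuousOn g (Ici 0)) {u w : Space N × ℝ → ℝ} {V : Space N × ℝ → Space N}
    (hV : MemLpLoc p V) (hu : LocallyIntegrableOn u (spaceTime N))
    (hwi : LocallyIntegrableOn w (spaceTime N))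
    (hw : ∀ η, IsTest η →
      ∫ z in spaceTime N, u z * derivT η z = -∫ z in spaceTime N, w z * η z)
    {η : Space N × ℝ → ℝ} (hη : IsTest η) :
    weakForm p m g u V η = (∫ z in spaceTime N, w z * (η z * weight g z.1))
      + ∫ z in spaceTime N, inner ℝ (flux p m (V z)) (gradX η z) * weight g z.1 := by
  have hf : Continuous (weight g : Space N → ℝ) := continuous_weight hg
  have hfc : Continuous fun ζ : Space N × ℝ => weight g ζ.1 := hf.comp continuous_fst
  have hpq := Real.HolderConjugate.conjExponent hp
  have i1 : IntegrableOn (fun z => u z * (derivT η z * weight g z.1)) (spaceTime N) :=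
    hη.integrableOn_mul hu (c := fun ζ => derivT η ζ * weight g ζ.1)
      (hη.continuous_derivT.mul hfc) fun z hz => by simp [hη.derivT_eq_zero hz]
  have i2 := integrableOn_inner_gradX hpq.symm.lt.le (hV.flux hp hq) hf hη
  have := integral_mul_derivT_mul_weight hf hu hwi hw hη
  rw [← neg_eq_iff_eq_neg, ← integral_neg] at this
  rw [← this]
  refine Eq.trans ?_ (integral_add i1.neg i2)
  rw [weakForm]
  refine integral_congr_ae (Eventually.of_forall fun z => ?_)
  simp only
  ring

/-- The exceptional null set may depend on t; Tonelli for the negative part merges the slices. -/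
theorem ae_nonneg_of_slices {u : Space N × ℝ → ℝ}
    (hm : AEStronglyMeasurable u (volume.restrict (spaceTime N)))
    (h : ∀ t, 0 ≤ t → ∀ᵐ x : Space N, 0 ≤ u (x, t)) :
    ∀ᵐ z ∂(volume.restrict (spaceTime N)), 0 ≤ u z := by
  have hm' : AEMeasurable (fun z => ENNReal.ofReal (-u z))
      (volume.restrict (spaceTime N)) := hm.aemeasurable.neg.ennreal_ofReal
  have h0 : ∫⁻ z in spaceTime N, ENNReal.ofReal (-u z) = 0 := by
    rw [volume_restrict_spaceTime] at hm' ⊢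
    rw [lintegral_prod_symm _ hm']
    rw [lintegral_eq_zero_of_ae_eq_zero]
    filter_upwards [ae_restrict_mem measurableSet_Ioi] with t ht
    rw [Pi.zero_apply]
    apply lintegral_eq_zero_of_ae_eq_zero
    filter_upwards [h t (le_of_lt ht)] with x hx
    rw [Pi.zero_apply, ENNReal.ofReal_eq_zero]; linarith
  filter_upwards [(lintegral_eq_zero_iff' hm').1 h0] with z hz
  rw [Pi.zero_apply, ENNReal.ofReal_eq_zero] at hz
  linarith

end

section

/-! ### Comparison of strong subsolutions and solutions -/

variable {N : ℕ}

theorem IsWeakGradX.integrableOn_smul_gradX {w : Space N × ℝ → ℝ} {V : Space N × ℝ → Space N}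
    (h : IsWeakGradX w V) {η : Space N × ℝ → ℝ} (hη : IsTest η) :
    IntegrableOn (fun z => w z • gradX η z) (spaceTime N) :=
  integrableOn_of_eq_zero_off ((h.locInt.integrableOn_compact_subset hη.supp
    hη.compact).smul_continuousOn hη.continuous_gradX.continuousOn hη.compact)
    fun z hz => by simp [hη.gradX_eq_zero hz]

theorem IsWeakGradX.integrableOn_test_smul {w : Space N × ℝ → ℝ} {V : Space N × ℝ → Space N}
    (h : IsWeakGradX w V) {η : Space N × ℝ → ℝ} (hη : IsTest η) :
    IntegrableOn (fun z => η z • V z) (spaceTime N) :=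
  integrableOn_of_eq_zero_off ((h.locIntGrad.integrableOn_compact_subset hη.supp
    hη.compact).continuousOn_smul hη.smooth.continuous.continuousOn hη.compact)
    fun z hz => by simp [hη.eq_zero hz]

theorem IsWeakGradX.sub {w₁ w₂ : Space N × ℝ → ℝ} {V₁ V₂ : Space N × ℝ → Space N}
    (h₁ : IsWeakGradX w₁ V₁) (h₂ : IsWeakGradX w₂ V₂) :
    IsWeakGradX (fun z => w₁ z - w₂ z) (fun z => V₁ z - V₂ z) where
  locInt := h₁.locInt.sub h₂.locInt
  locIntGrad := h₁.locIntGrad.sub h₂.locIntGrad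
  byParts η hη := by
    simp_rw [sub_smul, smul_sub]
    rw [integral_sub (h₁.integrableOn_smul_gradX hη) (h₂.integrableOn_smul_gradX hη),
      integral_sub (h₁.integrableOn_test_smul hη) (h₂.integrableOn_test_smul hη),
      h₁.byParts η hη, h₂.byParts η hη]
    abel

theorem gradExponent_pos {p m : ℝ} (hp : 1 < p) (hpm : 0 < p + m - 3) : 0 < gradExponent p m :=
  div_pos (by linarith) (by linarith)

/-- The positive part of the difference has a mass that depends continuously on time. -/
theorem continuousOn_integral_posPart {g : ℝ → ℝ} {v u : Space N × ℝ → ℝ}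
    (hv : IsAdmissible g v) (hu : IsAdmissible g u) :
    ContinuousOn (fun t => ∫ x, max 0 (v (x, t) - u (x, t)) ∂(weightMeasure N g)) (Ici 0) := by
  intro t ht
  have hint : ∀ s, 0 ≤ s →
      Integrable (fun x => max 0 (v (x, s) - u (x, s))) (weightMeasure N g) := fun s hs => by
    have := (memLp_one_iff_integrable.1 ((hv.memL1 s hs).sub (hu.memL1 s hs))).pos_part
    refine this.congr (Eventually.of_forall fun x => ?_)
    simp only [Pi.sub_apply]
    exact max_comm _ _
  have hlim := (hv.continuousL1 t ht).add (hu.continuousL1 t ht)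
  rw [add_zero] at hlim
  refine tendsto_iff_edist_tendsto_0.2 (tendsto_of_tendsto_of_tendsto_of_le_of_le'
    tendsto_const_nhds hlim (Eventually.of_forall fun _ => zero_le) ?_)
  filter_upwards [self_mem_nhdsWithin] with s hs
  rw [edist_eq_enorm_sub, ← integral_sub (hint s hs) (hint t ht)]
  refine (enorm_integral_le_lintegral_enorm _).trans ?_
  rw [eLpNorm_one_eq_lintegral_enorm, eLpNorm_one_eq_lintegral_enorm,
    ← lintegral_add_left' (f := fun x => ‖v (x, s) - v (x, t)‖ₑ)
      ((hv.memL1 s hs).1.sub (hv.memL1 t ht).1).enorm]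
  refine lintegral_mono fun x => ?_
  rw [← ofReal_norm, ← ofReal_norm, ← ofReal_norm,
    ← ENNReal.ofReal_add (norm_nonneg _) (norm_nonneg _)]
  apply ENNReal.ofReal_le_ofReal
  simp only [Real.norm_eq_abs]
  have h1 := abs_max_sub_max_le_abs (v (x, s) - u (x, s)) (v (x, t) - u (x, t)) 0
  rw [max_comm _ (0 : ℝ), max_comm _ (0 : ℝ)] at h1
  refine h1.trans ?_
  rw [show v (x, s) - u (x, s) - (v (x, t) - u (x, t))
    = (v (x, s) - v (x, t)) - (u (x, s) - u (x, t)) by ring]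
  exact abs_sub _ _

/-- **Comparison principle**: a strong subsolution whose support is bounded, locally uniformly in
time, stays below every strong solution that is above it initially. -/
theorem IsStrongSubsolution.le_of_isStrongSolution {p m : ℝ} {g : ℝ → ℝ} (hp : 1 < p)
    (hpm : 0 < p + m - 3) (hg : ContinuousOn g (Ici 0)) (hg0 : ∀ s, 0 ≤ s → 0 ≤ g s)
    {v u : Space N × ℝ → ℝ} (hv : IsStrongSubsolution p m g v) (hu : IsStrongSolution p m g u)
    (hinit : ∀ᵐ x : Space N, v (x, 0) ≤ u (x, 0))
    (hsupp : ∀ T : ℝ, ∃ ρ, 0 < ρ ∧ ∀ t, 0 ≤ t → t ≤ T → ∀ x, ρ ≤ ‖x‖ → v (x, t) = 0)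
    (t : ℝ) (ht : 0 ≤ t) : ∀ᵐ x : Space N, v (x, t) ≤ u (x, t) := by
  obtain ⟨⟨hva, Vv, hvV, hvp, hvw⟩, wv, hwvm, hwvb, hwv⟩ := hv
  obtain ⟨⟨hua, Vu, huV, hup, huw⟩, wu, hwum, hwub, hwu⟩ := hu
  have hq := gradExponent_pos hp hpm
  set q := gradExponent p m with hqdef
  have hpq := Real.HolderConjugate.conjExponent hp
  have hvl := locallyIntegrableOn_of_bounded hva.bounded
  have hul := locallyIntegrableOn_of_bounded hua.bounded
  have hwvl := locallyIntegrableOn_timeDeriv hg0 hwvm hwvb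
  have hwul := locallyIntegrableOn_timeDeriv hg0 hwum hwub
  have hf : Continuous (weight g : Space N → ℝ) := continuous_weight hg
  have hfc : Continuous fun ζ : Space N × ℝ => weight g ζ.1 := hf.comp continuous_fst
  have hv0 := ae_nonneg_of_slices hvl.aestronglyMeasurable hva.nonneg
  have hu0 := ae_nonneg_of_slices hul.aestronglyMeasurable hua.nonneg
  have hw : ∀ η, IsTest η → ∫ z in spaceTime N, (v z - u z) * derivT η z
      = -∫ z in spaceTime N, (wv z - wu z) * η z := fun η hη => by
    simp_rw [sub_mul]
    rw [integral_sub (hη.integrableOn_mul hvl hη.continuous_derivT fun z hz => hη.derivT_eq_zero hz)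
      (hη.integrableOn_mul hul hη.continuous_derivT fun z hz => hη.derivT_eq_zero hz),
      integral_sub (hη.integrableOn_mul hwvl hη.smooth.continuous fun z hz => hη.eq_zero hz)
      (hη.integrableOn_mul hwul hη.smooth.continuous fun z hz => hη.eq_zero hz), hwv η hη, hwu η hη]
    ring
  have hineq : ∀ η, IsTest η → (∀ ζ, 0 ≤ η ζ) → ∫ ζ in spaceTime N, ((wv ζ - wu ζ) * η ζ
      + inner ℝ (flux p m (Vv ζ) - flux p m (Vu ζ)) (gradX η ζ)) * weight g ζ.1 ≤ 0 := by
    intro η hη hη0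
    have h1 := hvw η hη hη0
    have h2 := huw η hη
    rw [weakForm_eq hp hq hg hvp hvl hwvl hwv hη] at h1
    rw [weakForm_eq hp hq hg hup hul hwul hwu hη] at h2
    have c0 : ∀ z ∉ tsupport η, η z * weight g z.1 = 0 := fun z hz => by simp [hη.eq_zero hz]
    have i1 := hη.integrableOn_mul hwvl (hη.smooth.continuous.mul hfc) c0
    have i2 := hη.integrableOn_mul hwul (hη.smooth.continuous.mul hfc) c0
    have i3 := integrableOn_inner_gradX hpq.symm.lt.le (hvp.flux hp hq) hf hη
    have i4 := integrableOn_inner_gradX hpq.symm.lt.le (hup.flux hp hq) hf hη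
    have e : ∫ ζ in spaceTime N, ((wv ζ - wu ζ) * η ζ
        + inner ℝ (flux p m (Vv ζ) - flux p m (Vu ζ)) (gradX η ζ)) * weight g ζ.1
        = ((∫ z in spaceTime N, wv z * (η z * weight g z.1))
          + ∫ z in spaceTime N, inner ℝ (flux p m (Vv z)) (gradX η z) * weight g z.1)
        - ((∫ z in spaceTime N, wu z * (η z * weight g z.1))
          + ∫ z in spaceTime N, inner ℝ (flux p m (Vu z)) (gradX η z) * weight g z.1) := by
      have e1 := integral_add i1 i3
      have e2 := integral_add i2 i4
      have e3 := integral_sub (i1.add i3) (i2.add i4)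
      simp only [Pi.mul_apply, Pi.add_apply] at e1 e2 e3
      rw [← e1, ← e2, ← e3]
      refine integral_congr_ae (Eventually.of_forall fun ζ => ?_)
      simp only [inner_sub_left]
      ring
    rw [e]; linarith
  have hmono : ∀ ζ, 0 ≤ inner ℝ (flux p m (Vv ζ) - flux p m (Vu ζ)) (Vv ζ - Vu ζ) := fun ζ =>
    flux_monotone hp hq _ _
  -- The power q > 0 is strictly increasing on nonnegative numbers, so the difference that has a
  -- gradient and the one that has a time derivative are positive on the same set.
  have hyz : ∀ᵐ ζ ∂(volume.restrict (spaceTime N)),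
      (0 < v ζ ^ q - u ζ ^ q ↔ 0 < v ζ - u ζ) := by
    filter_upwards [hv0, hu0] with ζ h1 h2
    rw [sub_pos, sub_pos, Real.rpow_lt_rpow_iff h2 h1 hq]
  set μ := weightMeasure N g with hμ
  set h : ℝ → ℝ := fun t => ∫ x, max 0 (v (x, t) - u (x, t)) ∂μ with hh
  have hhc : ContinuousOn h (Ici 0) := continuousOn_integral_posPart hva hua
  have hfm : Measurable fun x : Space N => ENNReal.ofReal (weight g x) :=
    hf.measurable.ennreal_ofReal
  have hμi : ∀ k : Space N → ℝ, ∫ x, k x ∂μ = ∫ x, weight g x * k x := fun k => by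
    rw [hμ, weightMeasure, integral_withDensity_eq_integral_toReal_smul hfm (by simp)]
    simp [ENNReal.toReal_ofReal (weight_pos g _).le]
  have hdec : ∀ s r, 0 < s → s < r → h r ≤ h s := by
    intro s r hs hsr
    refine le_of_forall_integral_deriv_mul_nonneg (hhc.mono Ioi_subset_Ici_self) ?_ hs hsr
    intro θ hθs hθc hθt hθ0
    obtain ⟨T, hT⟩ : ∃ T, ∀ τ ∈ tsupport θ, τ ≤ T := hθc.isCompact.bddAbove
    obtain ⟨ρ, hρ, hρv⟩ := hsupp T
    -- The cut-off equals one on a ball containing the support of `v` up to time `T`. Its gradient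
    -- therefore lives where v = 0 ≤ u, and no estimate at infinity is needed.
    let b : ContDiffBump (0 : Space N) := ⟨ρ, ρ + 1, hρ, by linarith⟩
    set χ : Space N × ℝ → ℝ := fun ζ => b ζ.1 * θ ζ.2 with hχdef
    have hb : ∀ x : Space N, ‖x‖ ≤ ρ → b x = 1 := fun x hx =>
      b.one_of_mem_closedBall (by simpa using hx)
    have hsub : Function.support χ ⊆ Metric.closedBall (0 : Space N) (ρ + 1) ×ˢ tsupport θ := by
      intro ζ hζ
      refine ⟨?_, subset_tsupport θ fun h0 => hζ (by simp [hχdef, h0])⟩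
      by_contra hn
      refine hζ ?_
      simp only [hχdef]
      rw [b.zero_of_le_dist, zero_mul]
      rw [Metric.mem_closedBall, not_le] at hn
      exact hn.le
    have hcomp : IsCompact (Metric.closedBall (0 : Space N) (ρ + 1) ×ˢ tsupport θ) :=
      (isCompact_closedBall _ _).prod hθc
    have hχ : IsTest χ :=
      { smooth := (b.contDiff.comp contDiff_fst).mul (hθs.comp contDiff_snd)
        compact := HasCompactSupport.of_support_subset_isCompact hcomp hsub
        supp := (closure_minimal hsub hcomp.isClosed).trans fun ζ hζ => ⟨mem_univ _, hθt hζ.2⟩ }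
    have hχ0 : ∀ ζ, 0 ≤ χ ζ := fun ζ => mul_nonneg b.nonneg (hθ0 _)
    have hoff : ∀ᵐ ζ ∂(volume.restrict (spaceTime N)),
        gradX χ ζ ≠ 0 → v ζ ^ q - u ζ ^ q ≤ 0 := by
      filter_upwards [hu0] with ζ h1 h2
      have h3 : ζ.2 ∈ tsupport θ := by
        by_contra hn
        apply h2
        have : (fun y => χ (y, ζ.2)) = fun _ => 0 := by
          funext y; simp [hχdef, image_eq_zero_of_notMem_tsupport hn]
        rw [gradX, this]; simp [gradient]
      have h4 : ρ ≤ ‖ζ.1‖ := by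
        by_contra! hn
        apply h2
        have : (fun y => χ (y, ζ.2)) =ᶠ[𝓝 ζ.1] fun _ => θ ζ.2 := by
          filter_upwards [Metric.isOpen_ball.mem_nhds
            (show ζ.1 ∈ Metric.ball (0 : Space N) ρ by simpa using hn)] with y hy
          simp [hχdef, hb y (by simpa using (Metric.mem_ball.1 hy).le)]
        rw [gradX, gradient, this.fderiv_eq]; simp
      have h5 : v ζ = 0 := hρv ζ.2 (le_of_lt (hθt h3)) (hT _ h3) ζ.1 h4
      rw [h5, Real.zero_rpow hq.ne']
      have := Real.rpow_nonneg h1 q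
      linarith
    have hmain := integral_posPart_mul_derivT_nonneg hpq hf (fun x => (weight_pos g x).le)
      (hvV.sub huV)
      (fun K hK hKs => (hvp K hK hKs).sub (hup K hK hKs))
      (fun K hK hKs => ((hvp.flux hp hq) K hK hKs).sub ((hup.flux hp hq) K hK hKs))
      (hvl.sub hul) (hwvl.sub hwul) hw hineq hmono hyz hχ hχ0 hoff
    have hder : ∀ ζ, derivT χ ζ = b ζ.1 * deriv θ ζ.2 := fun ζ => by
      simp only [derivT, hχdef]
      exact deriv_const_mul _ (hθs.differentiable (by simp) _)
    refine hmain.trans_eq ?_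
    have hint : IntegrableOn (fun ζ => max 0 (v ζ - u ζ) * (derivT χ ζ * weight g ζ.1))
        (spaceTime N) := by
      have i0 := hχ.integrableOn_mul (hvl.sub hul) (c := fun ζ => derivT χ ζ * weight g ζ.1)
        (hχ.continuous_derivT.mul hfc) fun z hz => by simp [hχ.derivT_eq_zero hz]
      refine Integrable.mono i0 ?_ (Eventually.of_forall fun ζ => ?_)
      · refine AEStronglyMeasurable.mul ?_ (hχ.continuous_derivT.mul hfc).aestronglyMeasurable
        have hc : Continuous fun s : ℝ => max 0 s := by fun_prop
        exact hc.comp_aestronglyMeasurable (hvl.sub hul).aestronglyMeasurable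
      · rw [norm_mul, norm_mul ((v - u) ζ)]
        refine mul_le_mul_of_nonneg_right ?_ (norm_nonneg _)
        rw [Pi.sub_apply, Real.norm_eq_abs, Real.norm_eq_abs, abs_of_nonneg (le_max_left _ _)]
        exact max_le (abs_nonneg _) (le_abs_self _)
    rw [IntegrableOn] at hint
    rw [volume_restrict_spaceTime] at hint ⊢
    refine (integral_prod_symm _ hint).trans ?_
    refine setIntegral_congr_fun measurableSet_Ioi fun τ hτ => ?_
    simp only [hder, hh]
    by_cases hτ2 : τ ∈ tsupport θ
    · rw [hμi, ← integral_const_mul]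
      refine integral_congr_ae ?_
      filter_upwards [hua.nonneg τ (le_of_lt hτ)] with x hx
      rcases le_total ‖x‖ ρ with h1 | h1
      · rw [hb x h1]; ring
      · rw [hρv τ (le_of_lt hτ) (hT _ hτ2) x h1, max_eq_left (by linarith)]; ring
    · have : deriv θ τ = 0 :=
        image_eq_zero_of_notMem_tsupport fun h => hτ2 (tsupport_deriv_subset h)
      simp [this]
  have habs : μ ≪ volume := withDensity_absolutelyContinuous _ _
  have habs' : (volume : Measure (Space N)) ≪ μ :=
    withDensity_absolutelyContinuous' hfm.aemeasurable
      (Eventually.of_forall fun x => by simp [weight_pos g x])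
  have h00 : h 0 = 0 := by
    rw [hh]
    refine integral_eq_zero_of_ae (habs.ae_le ?_)
    filter_upwards [hinit] with x hx
    simpa using hx
  rcases ht.eq_or_lt with rfl | ht'
  · exact hinit
  -- Test functions vanish near t = 0, so monotonicity is known for positive times only; continuity
  -- of the mass at t = 0 brings in the initial comparison.
  have hle : h t ≤ 0 := by
    have h1 : Tendsto h (𝓝[>] 0) (𝓝 (h 0)) :=
      ((hhc 0 self_mem_Ici).mono Ioi_subset_Ici_self)
    rw [h00] at h1
    refine ge_of_tendsto h1 ?_
    filter_upwards [Ioo_mem_nhdsGT ht'] with s hs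
    exact hdec s t hs.1 hs.2
  have hint : Integrable (fun x => max 0 (v (x, t) - u (x, t))) μ := by
    have := (memLp_one_iff_integrable.1 ((hva.memL1 t ht).sub (hua.memL1 t ht))).pos_part
    refine this.congr (Eventually.of_forall fun x => ?_)
    simp only [Pi.sub_apply]
    exact max_comm _ _
  have h2 : h t = 0 := le_antisymm hle (integral_nonneg fun x => le_max_left _ _)
  have h3 := (integral_eq_zero_iff_of_nonneg (fun x => le_max_left _ _) hint).1 h2
  filter_upwards [habs'.ae_le h3] with x hx
  have : max 0 (v (x, t) - u (x, t)) = 0 := hx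
  have := le_max_right 0 (v (x, t) - u (x, t))
  linarith

end

section

/-! ### The functions `G` and its inverse -/

namespace IsPowerlike

variable {g : ℝ → ℝ} {α₁ α₂ : ℝ}

theorem hasDerivAt (hg : IsPowerlike g α₁ α₂) {s : ℝ} (hs : 0 < s) : HasDerivAt g (deriv g s) s :=
  ((hg.contDiffOn.differentiableOn (by simp)).differentiableAt (Ioi_mem_nhds hs)).hasDerivAt

theorem deriv_nonneg (hg : IsPowerlike g α₁ α₂) (h₁ : 0 < α₁) {s : ℝ} (hs : 0 < s) :
    0 ≤ deriv g s :=
  le_trans (by have := hg.pos s hs; positivity) (hg.lower s hs)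

theorem nonneg (hg : IsPowerlike g α₁ α₂) {s : ℝ} (hs : 0 ≤ s) : 0 ≤ g s := by
  rcases hs.eq_or_lt with rfl | hs
  · exact hg.map_zero.ge
  · exact (hg.pos s hs).le

theorem strictMonoOn (hg : IsPowerlike g α₁ α₂) (h₁ : 0 < α₁) : StrictMonoOn g (Ici 0) := by
  refine strictMonoOn_of_deriv_pos (convex_Ici 0) hg.continuousOn fun x hx => ?_
  rw [interior_Ici] at hx
  exact lt_of_lt_of_le (by have := hg.pos x hx; have : (0:ℝ) < x := hx; positivity) (hg.lower x hx)

theorem continuousOn_div (hg : IsPowerlike g α₁ α₂) : ContinuousOn (fun s => g s / s) (Ioi 0) :=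
  (hg.continuousOn.mono Ioi_subset_Ici_self).div continuousOn_id fun _ hx => (ne_of_gt hx)

/-- The lower structural bound gives g(s)/s ≤ g'(s)/α₁, and g' is nonnegative with a primitive
continuous up to zero. -/
theorem intervalIntegrable_div (hg : IsPowerlike g α₁ α₂) (h₁ : 0 < α₁) {r : ℝ} (hr : 0 ≤ r) :
    IntervalIntegrable (fun s => g s / s) volume 0 r := by
  rw [intervalIntegrable_iff_integrableOn_Ioc_of_le hr]
  have h : IntegrableOn (deriv g) (Ioc 0 r) :=
    intervalIntegral.integrableOn_deriv_of_nonneg (hg.continuousOn.mono Icc_subset_Ici_self)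
      (fun x hx => hg.hasDerivAt hx.1) fun x hx => hg.deriv_nonneg h₁ hx.1
  refine (h.const_mul α₁⁻¹).mono'
    ((hg.continuousOn_div.mono fun x hx => hx.1).aestronglyMeasurable measurableSet_Ioc) ?_
  filter_upwards [ae_restrict_mem measurableSet_Ioc] with x hx
  have := hg.pos x hx.1
  have hx0 := hx.1
  rw [Real.norm_of_nonneg (by positivity), le_inv_mul_iff₀ h₁]
  exact hg.lower x hx.1

theorem hasDerivAt_bigG (hg : IsPowerlike g α₁ α₂) (h₁ : 0 < α₁) {r : ℝ} (hr : 0 < r) :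
    HasDerivAt (bigG g) (g r / r) r :=
  intervalIntegral.integral_hasDerivAt_right (hg.intervalIntegrable_div h₁ hr.le)
    (hg.continuousOn_div.stronglyMeasurableAtFilter isOpen_Ioi r hr)
    (hg.continuousOn_div.continuousAt (Ioi_mem_nhds hr))

theorem bigG_zero (g : ℝ → ℝ) : bigG g 0 = 0 := by simp [bigG]

theorem continuousOn_bigG (hg : IsPowerlike g α₁ α₂) (h₁ : 0 < α₁) :
    ContinuousOn (bigG g) (Ici 0) := by
  intro r hr
  rcases (mem_Ici.1 hr).eq_or_lt with rfl | hr
  · have h := intervalIntegral.continuousOn_primitive_interval'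
      (hg.intervalIntegrable_div h₁ zero_le_one) (a := 0) (by simp)
    rw [uIcc_of_le zero_le_one] at h
    exact (h 0 (by simp)).mono_of_mem_nhdsWithin (Icc_mem_nhdsGE one_pos)
  · exact (hg.hasDerivAt_bigG h₁ hr).continuousAt.continuousWithinAt

theorem strictMonoOn_bigG (hg : IsPowerlike g α₁ α₂) (h₁ : 0 < α₁) :
    StrictMonoOn (bigG g) (Ici 0) := by
  refine strictMonoOn_of_deriv_pos (convex_Ici 0) (hg.continuousOn_bigG h₁) fun x hx => ?_
  rw [interior_Ici] at hx
  rw [(hg.hasDerivAt_bigG h₁ hx).deriv]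
  exact div_pos (hg.pos x hx) hx

theorem bigG_pos (hg : IsPowerlike g α₁ α₂) (h₁ : 0 < α₁) {r : ℝ} (hr : 0 < r) : 0 < bigG g r := by
  rw [← bigG_zero g]
  exact hg.strictMonoOn_bigG h₁ self_mem_Ici hr.le hr

/-- Integrate the structural inequality from zero, where both sides vanish. With the companion upper
bound this makes g/G a quantity between α₁ and α₂, the form in which the hypotheses on g enter most
estimates below. -/
theorem mul_bigG_le (hg : IsPowerlike g α₁ α₂) (h₁ : 0 < α₁) {r : ℝ} (hr : 0 ≤ r) :
    α₁ * bigG g r ≤ g r := by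
  have h : MonotoneOn (fun r => g r - α₁ * bigG g r) (Ici 0) := by
    refine monotoneOn_of_hasDerivWithinAt_nonneg (f' := fun r => deriv g r - α₁ * (g r / r))
      (convex_Ici 0) (hg.continuousOn.sub (continuousOn_const.mul (hg.continuousOn_bigG h₁)))
      (fun x hx => ?_) fun x hx => ?_ <;> rw [interior_Ici] at hx
    · exact ((hg.hasDerivAt hx).sub ((hg.hasDerivAt_bigG h₁ hx).const_mul α₁)).hasDerivWithinAt
    · exact sub_nonneg.2 (hg.lower x hx)
  have := h self_mem_Ici hr hr
  simp only [hg.map_zero, bigG_zero] at this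
  linarith

theorem le_mul_bigG (hg : IsPowerlike g α₁ α₂) (h₁ : 0 < α₁) {r : ℝ} (hr : 0 ≤ r) :
    g r ≤ α₂ * bigG g r := by
  have h : MonotoneOn (fun r => α₂ * bigG g r - g r) (Ici 0) := by
    refine monotoneOn_of_hasDerivWithinAt_nonneg (f' := fun r => α₂ * (g r / r) - deriv g r)
      (convex_Ici 0) ((continuousOn_const.mul (hg.continuousOn_bigG h₁)).sub hg.continuousOn)
      (fun x hx => ?_) fun x hx => ?_ <;> rw [interior_Ici] at hx
    · exact (((hg.hasDerivAt_bigG h₁ hx).const_mul α₂).sub (hg.hasDerivAt hx)).hasDerivWithinAt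
    · exact sub_nonneg.2 (hg.upper x hx)
  have := h self_mem_Ici hr hr
  simp only [hg.map_zero, bigG_zero] at this
  linarith

/-- The derivative has the sign of g - α₁G. The resulting power growth of G drives the front bound,
the surjectivity of G and of g, and the choice of γ. -/
theorem monotoneOn_bigG_div_rpow (hg : IsPowerlike g α₁ α₂) (h₁ : 0 < α₁) :
    MonotoneOn (fun r => bigG g r * r ^ (-α₁)) (Ioi 0) := by
  have hd : ∀ x ∈ Ioi (0 : ℝ), HasDerivAt (fun r => bigG g r * r ^ (-α₁))
      (g x / x * x ^ (-α₁) + bigG g x * (-α₁ * x ^ (-α₁ - 1))) x := fun x hx =>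
    (hg.hasDerivAt_bigG h₁ hx).mul (Real.hasDerivAt_rpow_const (Or.inl (ne_of_gt hx)))
  refine monotoneOn_of_hasDerivWithinAt_nonneg (convex_Ioi 0)
    (fun x hx => (hd x hx).continuousAt.continuousWithinAt)
    (fun x hx => (hd x (interior_subset hx)).hasDerivWithinAt) fun x hx => ?_
  have hx : (0 : ℝ) < x := interior_subset hx
  rw [Real.rpow_sub_one hx.ne']
  have : g x / x * x ^ (-α₁) + bigG g x * (-α₁ * (x ^ (-α₁) / x))
    = (g x - α₁ * bigG g x) * (x ^ (-α₁) / x) := by field_simp; ring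
  rw [this]
  exact mul_nonneg (sub_nonneg.2 (hg.mul_bigG_le h₁ hx.le)) (by positivity)

theorem bigG_mul_rpow_le (hg : IsPowerlike g α₁ α₂) (h₁ : 0 < α₁) {r s : ℝ} (hr : 0 < r)
    (hrs : r ≤ s) : bigG g r * s ^ α₁ ≤ bigG g s * r ^ α₁ := by
  have hs := hr.trans_le hrs
  have h := hg.monotoneOn_bigG_div_rpow h₁ hr hs hrs
  simp only [Real.rpow_neg hr.le, Real.rpow_neg hs.le, ← div_eq_mul_inv] at h
  rwa [div_le_div_iff₀ (by positivity) (by positivity)] at h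

theorem tendsto_bigG (hg : IsPowerlike g α₁ α₂) (h₁ : 0 < α₁) :
    Tendsto (bigG g) atTop atTop := by
  refine tendsto_atTop_mono' _ ?_
    ((tendsto_rpow_atTop h₁).const_mul_atTop (hg.bigG_pos h₁ one_pos))
  filter_upwards [eventually_ge_atTop 1] with s hs
  simpa using hg.bigG_mul_rpow_le h₁ one_pos hs

theorem surjOn_bigG (hg : IsPowerlike g α₁ α₂) (h₁ : 0 < α₁) :
    SurjOn (bigG g) (Ici 0) (Ici 0) := by
  intro y hy
  obtain ⟨R, hR, hyR⟩ := ((eventually_ge_atTop 0).and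
    ((hg.tendsto_bigG h₁).eventually (eventually_ge_atTop y))).exists
  obtain ⟨x, hx, hxy⟩ := intermediate_value_Icc hR
    ((hg.continuousOn_bigG h₁).mono Icc_subset_Ici_self) ⟨(bigG_zero g).trans_le hy, hyR⟩
  exact ⟨x, hx.1, hxy⟩

theorem surjOn (hg : IsPowerlike g α₁ α₂) (h₁ : 0 < α₁) : SurjOn g (Ici 0) (Ici 0) := by
  intro y hy
  obtain ⟨R, hR, hyR⟩ := ((eventually_ge_atTop 0).and
    (((hg.tendsto_bigG h₁).const_mul_atTop h₁).eventually (eventually_ge_atTop y))).exists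
  obtain ⟨x, hx, hxy⟩ := intermediate_value_Icc hR
    (hg.continuousOn.mono Icc_subset_Ici_self)
    ⟨hg.map_zero.trans_le hy, hyR.trans (hg.mul_bigG_le h₁ hR)⟩
  exact ⟨x, hx.1, hxy⟩

theorem radialInv_mem {h : ℝ → ℝ} (hs : SurjOn h (Ici 0) (Ici 0)) {y : ℝ} (hy : 0 ≤ y) :
    0 ≤ radialInv h y :=
  Function.invFunOn_mem (hs hy)

theorem apply_radialInv {h : ℝ → ℝ} (hs : SurjOn h (Ici 0) (Ici 0)) {y : ℝ} (hy : 0 ≤ y) :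
    h (radialInv h y) = y :=
  Function.invFunOn_eq (hs hy)

theorem radialInv_bigG (hg : IsPowerlike g α₁ α₂) (h₁ : 0 < α₁) {r : ℝ} (hr : 0 ≤ r) :
    radialInv (bigG g) (bigG g r) = r := by
  have h0 : 0 ≤ bigG g r := by
    rw [← bigG_zero g]; exact (hg.strictMonoOn_bigG h₁).monotoneOn self_mem_Ici hr hr
  exact (hg.strictMonoOn_bigG h₁).injOn (radialInv_mem (hg.surjOn_bigG h₁) h0) hr
    (apply_radialInv (hg.surjOn_bigG h₁) h0)

theorem strictMonoOn_radialInv (hg : IsPowerlike g α₁ α₂) (h₁ : 0 < α₁) :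
    StrictMonoOn (radialInv (bigG g)) (Ici 0) := by
  intro x hx y hy hxy
  have hs := hg.surjOn_bigG h₁
  rw [← (hg.strictMonoOn_bigG h₁).lt_iff_lt (radialInv_mem hs hx) (radialInv_mem hs hy),
    apply_radialInv hs hx, apply_radialInv hs hy]
  exact hxy

theorem radialInv_pos (hg : IsPowerlike g α₁ α₂) (h₁ : 0 < α₁) {y : ℝ} (hy : 0 < y) :
    0 < radialInv (bigG g) y :=
  (radialInv_mem (hg.surjOn_bigG h₁) le_rfl).trans_lt
    (hg.strictMonoOn_radialInv h₁ self_mem_Ici hy.le hy)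

theorem hasDerivAt_radialInv (hg : IsPowerlike g α₁ α₂) (h₁ : 0 < α₁) {y : ℝ} (hy : 0 < y) :
    HasDerivAt (radialInv (bigG g))
      (g (radialInv (bigG g) y) / radialInv (bigG g) y)⁻¹ y := by
  have hx := hg.radialInv_pos h₁ hy
  have himg : Ioi 0 ⊆ radialInv (bigG g) '' Ioi 0 := fun r hr =>
    ⟨bigG g r, hg.bigG_pos h₁ hr, hg.radialInv_bigG h₁ (le_of_lt hr)⟩
  refine HasDerivAt.of_local_left_inverse (f := bigG g) ?_ (hg.hasDerivAt_bigG h₁ hx)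
    (div_pos (hg.pos _ hx) hx).ne' ?_
  · exact ((hg.strictMonoOn_radialInv h₁).mono Ioi_subset_Ici_self).continuousAt_of_image_mem_nhds
      (Ioi_mem_nhds hy) (mem_of_superset (Ioi_mem_nhds hx) himg)
  · filter_upwards [Ioi_mem_nhds hy] with z hz
    exact apply_radialInv (hg.surjOn_bigG h₁) (le_of_lt hz)

end IsPowerlike

end

section

/-! ### The shape of the barrier -/

/-- The function of `r` that is subtracted in `profile`, with the value of `ν₀` that makes it
continuously differentiable. -/
def shape (p : ℝ) (g : ℝ → ℝ) (r₀ r : ℝ) : ℝ :=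
  if r₀ ≤ r then bigJ p g r ^ (1 / (p - 1)) else bigI p g r₀ (1 - g r₀ / (p * bigG g r₀)) r

/-- The derivative of `shape`. -/
def shapeSlope (p : ℝ) (g : ℝ → ℝ) (r₀ r : ℝ) : ℝ :=
  (p - 1)⁻¹ * (r / bigG g (max r r₀)) ^ (1 / (p - 1)) *
    (p - g (max r r₀) / bigG g (max r r₀))

/-- The right derivative of `shapeSlope ^ (p - 1)`. -/
def shapeFluxDeriv (p : ℝ) (g : ℝ → ℝ) (r₀ r : ℝ) : ℝ :=
  if r₀ ≤ r then
    (p - 1)⁻¹ ^ (p - 1) * ((bigG g r - r * (g r / r)) / bigG g r ^ 2 *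
        (p - g r / bigG g r) ^ (p - 1)
      + r / bigG g r * (-((deriv g r * bigG g r - g r * (g r / r)) / bigG g r ^ 2) * (p - 1) *
        (p - g r / bigG g r) ^ (p - 1 - 1)))
  else (p - 1)⁻¹ ^ (p - 1) * (1 / bigG g r₀ * (p - g r₀ / bigG g r₀) ^ (p - 1))

namespace IsPowerlike

variable {g : ℝ → ℝ} {α₁ α₂ p : ℝ}

theorem ratio_lower (hg : IsPowerlike g α₁ α₂) (h₁ : 0 < α₁) {r : ℝ} (hr : 0 < r) :
    α₁ ≤ g r / bigG g r := by
  rw [le_div_iff₀ (hg.bigG_pos h₁ hr)]; exact hg.mul_bigG_le h₁ hr.le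

theorem ratio_upper (hg : IsPowerlike g α₁ α₂) (h₁ : 0 < α₁) {r : ℝ} (hr : 0 < r) :
    g r / bigG g r ≤ α₂ := by
  rw [div_le_iff₀ (hg.bigG_pos h₁ hr)]; exact hg.le_mul_bigG h₁ hr.le

/-- Isolating r/G makes the (p-1)-th power of the slope a bounded multiple of r/G. -/
theorem bigJ_rpow (hp : 1 < p) (hg : IsPowerlike g α₁ α₂) (h₁ : 0 < α₁) {r : ℝ} (hr : 0 < r) :
    bigJ p g r ^ (1 / (p - 1)) = r * (r / bigG g r) ^ (1 / (p - 1)) := by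
  have hG := hg.bigG_pos h₁ hr
  have h : bigJ p g r = r ^ (p - 1) * (r / bigG g r) := by
    rw [bigJ, mul_div_assoc', ← Real.rpow_add_one hr.ne', sub_add_cancel]
  rw [h, Real.mul_rpow (by positivity) (by positivity), ← Real.rpow_mul hr.le,
    mul_one_div_cancel (by linarith), Real.rpow_one]

theorem hasDerivAt_bigJ_rpow (hp : 1 < p) (hg : IsPowerlike g α₁ α₂) (h₁ : 0 < α₁) {r : ℝ}
    (hr : 0 < r) : HasDerivAt (fun r => bigJ p g r ^ (1 / (p - 1)))
      ((p - 1)⁻¹ * (r / bigG g r) ^ (1 / (p - 1)) * (p - g r / bigG g r)) r := by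
  have hG := hg.bigG_pos h₁ hr
  have hp1 : p - 1 ≠ 0 := by linarith
  have h : HasDerivAt (fun r => r * (r / bigG g r) ^ (1 / (p - 1))) _ r :=
    (hasDerivAt_id r).mul (((hasDerivAt_id r).div (hg.hasDerivAt_bigG h₁ hr) hG.ne').rpow_const
      (p := 1 / (p - 1)) (Or.inl (div_pos hr hG).ne'))
  refine (h.congr_of_eventuallyEq ?_).congr_deriv ?_
  · filter_upwards [Ioi_mem_nhds hr] with s hs
    exact bigJ_rpow hp hg h₁ hs
  · simp only [Pi.div_apply, id, Real.rpow_sub_one (show r / bigG g r ≠ 0 by positivity)]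
    field_simp
    ring

/-- The value of ν₀ satisfies pν₀ = p - g(r₀)/G(r₀), which is the last factor in the derivative of
the outer branch at r₀. The two branches thus meet with equal slopes. -/
theorem hasDerivAt_bigI {r₀ : ℝ} (hp : 1 < p) (hg : IsPowerlike g α₁ α₂)
    (h₁ : 0 < α₁) (h₀ : 0 < r₀) {r : ℝ} (hr : 0 < r) :
    HasDerivAt (bigI p g r₀ (1 - g r₀ / (p * bigG g r₀)))
      ((p - 1)⁻¹ * (r / bigG g r₀) ^ (1 / (p - 1)) * (p - g r₀ / bigG g r₀)) r := by
  have hG := hg.bigG_pos h₁ h₀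
  have hp1 : p - 1 ≠ 0 := by linarith
  have hp0 : p ≠ 0 := by linarith
  have h : HasDerivAt (fun r : ℝ => r * (r / bigG g r₀) ^ (1 / (p - 1))) _ r :=
    (hasDerivAt_id r).mul (((hasDerivAt_id r).div_const (bigG g r₀)).rpow_const
      (p := 1 / (p - 1)) (Or.inl (by simp only [id]; positivity)))
  have h' := (h.const_mul (1 - g r₀ / (p * bigG g r₀))).add_const
    ((1 - (1 - g r₀ / (p * bigG g r₀))) * bigJ p g r₀ ^ (1 / (p - 1)))
  refine (h'.congr_of_eventuallyEq ?_).congr_deriv ?_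
  · filter_upwards [Ioi_mem_nhds hr] with s hs
    have hs : 0 < s := hs
    have h : s ^ p / bigG g r₀ = s ^ (p - 1) * (s / bigG g r₀) := by
      rw [mul_div_assoc', ← Real.rpow_add_one hs.ne', sub_add_cancel]
    rw [bigI, h, Real.mul_rpow (by positivity) (by positivity), ← Real.rpow_mul hs.le,
      mul_one_div_cancel hp1, Real.rpow_one]
  · simp only [id, Real.rpow_sub_one (show r / bigG g r₀ ≠ 0 by positivity)]
    field_simp
    ring

theorem bigI_self {r₀ : ℝ} (ν : ℝ) : bigI p g r₀ ν r₀ = bigJ p g r₀ ^ (1 / (p - 1)) := by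
  rw [bigI, bigJ]; ring

theorem hasDerivAt_shape {r₀ : ℝ} (hp : 1 < p) (hg : IsPowerlike g α₁ α₂) (h₁ : 0 < α₁)
    (h₀ : 0 < r₀) {r : ℝ} (hr : 0 < r) : HasDerivAt (shape p g r₀) (shapeSlope p g r₀ r) r := by
  rcases lt_trichotomy r r₀ with h | rfl | h
  · rw [shapeSlope, max_eq_right h.le]
    refine (hasDerivAt_bigI hp hg h₁ h₀ hr).congr_of_eventuallyEq ?_
    filter_upwards [Iio_mem_nhds h] with s hs
    exact if_neg (not_le.2 hs)
  · rw [shapeSlope, max_self]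
    have hl := (hasDerivAt_bigI hp hg h₁ hr hr).hasDerivWithinAt (s := Iic r)
    have hu := (hasDerivAt_bigJ_rpow hp hg h₁ hr).hasDerivWithinAt (s := Ici r)
    have := (hl.congr_of_mem (f₁ := shape p g r) (fun s hs => ?_) self_mem_Iic).union
      (hu.congr_of_mem (f₁ := shape p g r) (fun s hs => if_pos hs) self_mem_Ici)
    · rwa [Iic_union_Ici, hasDerivWithinAt_univ] at this
    · rcases (mem_Iic.1 hs).eq_or_lt with rfl | hs
      · rw [shape, if_pos le_rfl, bigI_self]
      · exact if_neg (not_le.2 hs)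
  · rw [shapeSlope, max_eq_left h.le]
    refine (hasDerivAt_bigJ_rpow hp hg h₁ hr).congr_of_eventuallyEq ?_
    filter_upwards [Ioi_mem_nhds h] with s hs
    exact if_pos (le_of_lt hs)

theorem continuousOn_shapeSlope {r₀ : ℝ} (hp : 1 < p) (hg : IsPowerlike g α₁ α₂) (h₁ : 0 < α₁)
    (h₀ : 0 < r₀) : ContinuousOn (shapeSlope p g r₀) (Ici 0) := by
  have hm : MapsTo (fun r => max r r₀) (Ici 0) (Ici 0) := fun r hr =>
    le_max_of_le_left (mem_Ici.1 hr)
  have hc : ContinuousOn (fun r : ℝ => max r r₀) (Ici 0) := by fun_prop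
  have hG := (hg.continuousOn_bigG h₁).comp hc hm
  have hG0 : ∀ r ∈ Ici (0 : ℝ), bigG g (max r r₀) ≠ 0 := fun r _ =>
    (hg.bigG_pos h₁ (lt_max_of_lt_right h₀)).ne'
  refine ContinuousOn.mul (continuousOn_const.mul
    ((continuousOn_id.div hG hG0).rpow_const fun r _ => Or.inr ?_))
    (continuousOn_const.sub ((hg.continuousOn.comp hc hm).div hG hG0))
  have : 0 < p - 1 := by linarith
  positivity

theorem shapeSlope_zero {r₀ : ℝ} (hp : 1 < p) : shapeSlope p g r₀ 0 = 0 := by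
  have : (1 / (p - 1)) ≠ 0 := by have : p - 1 ≠ 0 := by linarith
                                 positivity
  simp only [shapeSlope, zero_div, Real.zero_rpow this, mul_zero, zero_mul]

theorem shapeSlope_pos {r₀ : ℝ} (hp : 1 < p) (h₂ : α₂ < p) (hg : IsPowerlike g α₁ α₂)
    (h₁ : 0 < α₁) (h₀ : 0 < r₀) {r : ℝ} (hr : 0 < r) : 0 < shapeSlope p g r₀ r := by
  have hm : 0 < max r r₀ := lt_max_of_lt_right h₀
  have hG := hg.bigG_pos h₁ hm
  have := hg.ratio_upper h₁ hm
  have h3 : 0 < p - g (max r r₀) / bigG g (max r r₀) := by linarith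
  have : 0 < p - 1 := by linarith
  unfold shapeSlope
  positivity

theorem continuous_bigI {r₀ : ℝ} (hp : 1 < p) (ν : ℝ) : Continuous (bigI p g r₀ ν) := by
  unfold bigI
  have : 0 < p - 1 := by linarith
  refine (continuous_const.mul (((Real.continuous_rpow_const (by linarith)).div_const _).rpow_const
    fun r => Or.inr (by positivity))).add continuous_const

/-- `shape` is flat at the origin. -/
theorem hasDerivWithinAt_shape_zero {r₀ : ℝ} (hp : 1 < p) (hg : IsPowerlike g α₁ α₂) (h₁ : 0 < α₁)
    (h₀ : 0 < r₀) : HasDerivWithinAt (shape p g r₀) 0 (Ici 0) 0 := by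
  have hev : shape p g r₀ =ᶠ[𝓝 0] bigI p g r₀ (1 - g r₀ / (p * bigG g r₀)) := by
    filter_upwards [Iio_mem_nhds h₀] with s hs
    exact if_neg (not_le.2 hs)
  refine HasDerivWithinAt.congr_deriv (f' := shapeSlope p g r₀ 0) ?_ (shapeSlope_zero hp)
  refine hasDerivWithinAt_Ici_of_tendsto_deriv (s := Ioi 0)
    (fun x hx => (hasDerivAt_shape hp hg h₁ h₀ hx).differentiableAt.differentiableWithinAt)
    ((continuous_bigI hp _).continuousAt.congr hev.symm).continuousWithinAt
    self_mem_nhdsWithin ?_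
  refine Tendsto.congr' ?_ (((continuousOn_shapeSlope hp hg h₁ h₀) 0 self_mem_Ici).mono
    Ioi_subset_Ici_self)
  filter_upwards [self_mem_nhdsWithin] with x hx
  exact (hasDerivAt_shape hp hg h₁ h₀ hx).deriv.symm

theorem continuousOn_shape {r₀ : ℝ} (hp : 1 < p) (hg : IsPowerlike g α₁ α₂) (h₁ : 0 < α₁)
    (h₀ : 0 < r₀) : ContinuousOn (shape p g r₀) (Ici 0) := by
  intro r hr
  rcases (mem_Ici.1 hr).eq_or_lt with rfl | hr
  · exact (hasDerivWithinAt_shape_zero hp hg h₁ h₀).continuousWithinAt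
  · exact (hasDerivAt_shape hp hg h₁ h₀ hr).continuousAt.continuousWithinAt

theorem strictMonoOn_shape {r₀ : ℝ} (hp : 1 < p) (h₂ : α₂ < p) (hg : IsPowerlike g α₁ α₂)
    (h₁ : 0 < α₁) (h₀ : 0 < r₀) : StrictMonoOn (shape p g r₀) (Ici 0) := by
  refine strictMonoOn_of_deriv_pos (convex_Ici 0) (continuousOn_shape hp hg h₁ h₀) fun x hx => ?_
  rw [interior_Ici] at hx
  rw [(hasDerivAt_shape hp hg h₁ h₀ hx).deriv]
  exact shapeSlope_pos hp h₂ hg h₁ h₀ hx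

theorem shape_of_le {r₀ : ℝ} (hp : 1 < p) (hg : IsPowerlike g α₁ α₂) (h₁ : 0 < α₁) (h₀ : 0 < r₀)
    {r : ℝ} (hr : r₀ ≤ r) : shape p g r₀ r = r * (r / bigG g r) ^ (1 / (p - 1)) := by
  rw [shape, if_pos hr, bigJ_rpow hp hg h₁ (h₀.trans_le hr)]

theorem shapeSlope_rpow {r₀ r : ℝ} (hp : 1 < p) (h₂ : α₂ < p) (hg : IsPowerlike g α₁ α₂)
    (h₁ : 0 < α₁) (h₀ : 0 < r₀) (hr : 0 ≤ r) : shapeSlope p g r₀ r ^ (p - 1) =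
      (p - 1)⁻¹ ^ (p - 1) * (r / bigG g (max r r₀) *
        (p - g (max r r₀) / bigG g (max r r₀)) ^ (p - 1)) := by
  have hm : 0 < max r r₀ := lt_max_of_lt_right h₀
  have hG := hg.bigG_pos h₁ hm
  have := hg.ratio_upper h₁ hm
  have h3 : 0 < p - g (max r r₀) / bigG g (max r r₀) := by linarith
  have : 0 < p - 1 := by linarith
  rw [shapeSlope, Real.mul_rpow (by positivity) h3.le, Real.mul_rpow (by positivity) (by positivity),
    ← Real.rpow_mul (by positivity), one_div_mul_cancel this.ne', Real.rpow_one, mul_assoc]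

/-- One-sided because the inner branch is linear in r while the outer one involves g', so the
derivative may jump at r₀. Right derivatives suffice for the integration along rays. -/
theorem hasDerivWithinAt_shapeSlope_rpow {r₀ r : ℝ} (hp : 1 < p) (h₂ : α₂ < p)
    (hg : IsPowerlike g α₁ α₂) (h₁ : 0 < α₁) (h₀ : 0 < r₀) (hr : 0 < r) :
    HasDerivWithinAt (fun r => shapeSlope p g r₀ r ^ (p - 1)) (shapeFluxDeriv p g r₀ r)
      (Ioi r) r := by
  rcases le_or_gt r₀ r with h | h
  · have hG := hg.bigG_pos h₁ hr
    have := hg.ratio_upper h₁ hr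
    have hd : HasDerivAt (fun r => (p - 1)⁻¹ ^ (p - 1) * (r / bigG g r *
        (p - g r / bigG g r) ^ (p - 1))) _ r :=
      ((((hasDerivAt_id r).div (hg.hasDerivAt_bigG h₁ hr) hG.ne')).mul
      ((((hg.hasDerivAt hr).div (hg.hasDerivAt_bigG h₁ hr) hG.ne').const_sub p).rpow_const
        (p := p - 1) (Or.inl (by simp only [Pi.div_apply]; linarith)))).const_mul _
    refine (hd.hasDerivWithinAt.congr (fun s hs => ?_) ?_).congr_deriv ?_
    · have hs : r < s := hs
      rw [shapeSlope_rpow hp h₂ hg h₁ h₀ (hr.trans hs).le, max_eq_left (h.trans hs.le)]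
    · rw [shapeSlope_rpow hp h₂ hg h₁ h₀ hr.le, max_eq_left h]
    · simp only [shapeFluxDeriv, if_pos h, Pi.div_apply, id, one_mul]
  · have hd : HasDerivAt (fun r : ℝ => (p - 1)⁻¹ ^ (p - 1) * (r / bigG g r₀ *
        (p - g r₀ / bigG g r₀) ^ (p - 1))) _ r :=
      ((((hasDerivAt_id r).div_const (bigG g r₀)).mul_const _)).const_mul _
    refine HasDerivAt.hasDerivWithinAt ((hd.congr_of_eventuallyEq ?_).congr_deriv ?_)
    · filter_upwards [Iio_mem_nhds h, Ioi_mem_nhds hr] with s hs hs0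
      rw [shapeSlope_rpow hp h₂ hg h₁ h₀ (le_of_lt hs0), max_eq_right (le_of_lt hs)]
    · simp only [shapeFluxDeriv, if_neg (not_le.2 h)]

end IsPowerlike

end

section

/-! ### Estimates for the shape -/

namespace IsPowerlike

variable {g : ℝ → ℝ} {α₁ α₂ p r₀ : ℝ}

/-- Every term reduces to r/G times bounded factors. After division by r it is at most a multiple of
1/G(r₀); multiplied by g' ≤ α₂g/r it is controlled by α₂². In the derivative, the power P^{p-2} of P
= p - g/G is written P^{p-1}/P, which is bounded because P ≥ p - α₂ > 0. -/
theorem exists_shapeFlux_bound (hp : 1 < p) (h₂ : α₂ < p) (hg : IsPowerlike g α₁ α₂)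
    (h₁ : 0 < α₁) (h₀ : 0 < r₀) {k : ℝ} (hk : 0 ≤ k) :
    ∃ M, 0 < M ∧ ∀ r, 0 < r → k * (shapeSlope p g r₀ r ^ (p - 1) / r)
      + deriv g r * shapeSlope p g r₀ r ^ (p - 1) + shapeFluxDeriv p g r₀ r ≤ M := by
  have hG₀ := hg.bigG_pos h₁ h₀
  have hα : 0 < α₂ := h₁.trans_le ((hg.ratio_lower h₁ h₀).trans (hg.ratio_upper h₁ h₀))
  have hp1 : 0 < p - 1 := by linarith
  have hpα : 0 < p - α₂ := by linarith
  obtain ⟨c, hc⟩ : ∃ c, c = (p - 1)⁻¹ ^ (p - 1) := ⟨_, rfl⟩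
  obtain ⟨Q, hQ⟩ : ∃ Q, Q = p ^ (p - 1) := ⟨_, rfl⟩
  obtain ⟨H, hH⟩ : ∃ H, H = bigG g r₀ := ⟨_, rfl⟩
  have hc0 : 0 < c := by rw [hc]; positivity
  have hQ0 : 0 < Q := by rw [hQ]; positivity
  refine ⟨c * (k * (Q / H) + α₂ ^ 2 * Q + (Q / H + α₂ ^ 2 * ((p - 1) * (Q / (p - α₂))) / H)),
    by rw [hH]; positivity, fun r hr => ?_⟩
  have key : ∀ s, 0 < s → 0 < p - g s / bigG g s ∧ (p - g s / bigG g s) ^ (p - 1) ≤ Q := by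
    intro s hs
    have h3 := hg.ratio_upper h₁ hs
    have h4 := hg.ratio_lower h₁ hs
    refine ⟨by linarith, hQ ▸ Real.rpow_le_rpow (by linarith) (by linarith) hp1.le⟩
  have hgr := hg.pos r hr
  have hup := hg.upper r hr
  rw [shapeSlope_rpow hp h₂ hg h₁ h₀ hr.le, shapeFluxDeriv, ← hc]
  split_ifs with h
  · rw [max_eq_left h]
    have hG := hg.bigG_pos h₁ hr
    have hGle : H ≤ bigG g r := hH ▸ (hg.strictMonoOn_bigG h₁).monotoneOn h₀.le hr.le h
    obtain ⟨hP, hPQ⟩ := key r hr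
    have hθ := hg.ratio_upper h₁ hr
    have hθ0 : 0 < g r / bigG g r := by positivity
    have hd := hg.deriv_nonneg h₁ hr
    obtain ⟨P, hPd⟩ : ∃ P, P = p - g r / bigG g r := ⟨_, rfl⟩
    rw [← hPd] at hP hPQ ⊢
    have hPp : 0 < P ^ (p - 1) := by positivity
    have e1 : r / bigG g r * P ^ (p - 1) / r = P ^ (p - 1) / bigG g r := by field_simp
    have hHp : 0 < H := hH ▸ hG₀
    have b1 : P ^ (p - 1) / bigG g r ≤ Q / H := by gcongr
    have b2 : deriv g r * (r / bigG g r * P ^ (p - 1)) ≤ α₂ ^ 2 * Q := by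
      calc deriv g r * (r / bigG g r * P ^ (p - 1))
          ≤ α₂ * (g r / r) * (r / bigG g r * P ^ (p - 1)) := by gcongr
        _ = α₂ * ((g r / bigG g r) * P ^ (p - 1)) := by field_simp
        _ ≤ α₂ * (α₂ * Q) := by gcongr
        _ = _ := by ring
    have b3 : (bigG g r - r * (g r / r)) / bigG g r ^ 2 * P ^ (p - 1) ≤ Q / H := by
      refine le_trans ?_ b1
      rw [div_eq_inv_mul _ (bigG g r)]
      gcongr
      rw [div_le_iff₀ (by positivity), mul_div_cancel₀ _ hr.ne', sq, inv_mul_cancel_left₀ hG.ne']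
      linarith
    have b4 : r / bigG g r * (-((deriv g r * bigG g r - g r * (g r / r)) / bigG g r ^ 2) * (p - 1) *
        P ^ (p - 1 - 1)) ≤ α₂ ^ 2 * ((p - 1) * (Q / (p - α₂))) / H := by
      -- The contribution of g' has a favourable sign and is dropped, so no second-order information
      -- on G is needed.
      have hle : -((deriv g r * bigG g r - g r * (g r / r)) / bigG g r ^ 2)
          ≤ g r * (g r / r) / bigG g r ^ 2 := by
        rw [← neg_div]
        gcongr
        have : 0 ≤ deriv g r * bigG g r := by positivity
        linarith
      calc r / bigG g r * (-((deriv g r * bigG g r - g r * (g r / r)) / bigG g r ^ 2) * (p - 1) *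
        P ^ (p - 1 - 1))
          ≤ r / bigG g r * (g r * (g r / r) / bigG g r ^ 2 * (p - 1) * P ^ (p - 1 - 1)) := by gcongr
        _ = (g r / bigG g r) ^ 2 * ((p - 1) * (P ^ (p - 1) / P)) / bigG g r := by
            rw [Real.rpow_sub_one hP.ne']; field_simp
        _ ≤ _ := by
            gcongr
            rw [hPd]; linarith
    rw [mul_div_assoc, e1, mul_left_comm k, mul_left_comm (deriv g r), ← mul_add, ← mul_add]
    gcongr
  · have h := not_le.1 h
    rw [max_eq_right h.le, ← hH]
    obtain ⟨hP, hPQ⟩ := key r₀ h₀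
    have hθ := hg.ratio_upper h₁ h₀
    rw [← hH] at hG₀ hP hPQ hθ
    have hgg : g r ≤ g r₀ := (hg.strictMonoOn h₁).monotoneOn hr.le h₀.le h.le
    have b1 : (p - g r₀ / H) ^ (p - 1) / H ≤ Q / H := by gcongr
    have b2 : deriv g r * (r / H * (p - g r₀ / H) ^ (p - 1)) ≤ α₂ ^ 2 * Q := by
      have : 0 < (p - g r₀ / H) ^ (p - 1) := by positivity
      calc deriv g r * (r / H * (p - g r₀ / H) ^ (p - 1))
          ≤ α₂ * (g r / r) * (r / H * (p - g r₀ / H) ^ (p - 1)) := by gcongr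
        _ = α₂ * ((g r / H) * (p - g r₀ / H) ^ (p - 1)) := by field_simp
        _ ≤ α₂ * (α₂ * Q) := by
          gcongr
          exact le_trans (by gcongr) hθ
        _ = _ := by ring
    have e1 : r / H * (p - g r₀ / H) ^ (p - 1) / r = (p - g r₀ / H) ^ (p - 1) / H := by field_simp
    rw [show ∀ x y, x * (c * y / r) = c * (x * (y / r)) from
      fun x y => by ring, mul_left_comm (deriv g r), ← mul_add, ← mul_add, e1, one_div_mul_eq_div]
    have : 0 ≤ α₂ ^ 2 * ((p - 1) * (Q / (p - α₂))) / H := by positivity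
    gcongr
    linarith

theorem shape_pos (hp : 1 < p) (hg : IsPowerlike g α₁ α₂) (h₁ : 0 < α₁) (h₀ : 0 < r₀)
    {r : ℝ} (hr : r₀ ≤ r) : 0 < shape p g r₀ r := by
  have h := h₀.trans_le hr
  have := hg.bigG_pos h₁ h
  rw [shape_of_le hp hg h₁ h₀ hr]
  positivity

/-- If the front moves slowly enough, its contribution is absorbed by diffusion near the front
and by the decay of the amplitude elsewhere. -/
theorem exists_front_speed (hp : 1 < p) (h₂ : α₂ < p) (hg : IsPowerlike g α₁ α₂)
    (h₁ : 0 < α₁) (h₀ : 0 < r₀) {ℓ a b S : ℝ} (hℓ : r₀ < ℓ) (ha : 0 < a) (hb : 0 < b)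
    (hS : 0 < S) : ∃ Γ, 0 < Γ ∧ ∀ R, ℓ ≤ R → ∀ r, 0 < r → shape p g r₀ r < shape p g r₀ R →
      b * (Γ * (shapeSlope p g r₀ R * (R / g R))) ≤
        S * (b * shapeSlope p g r₀ r ^ p) + a / 2 * (shape p g r₀ R - shape p g r₀ r) := by
  have hp1 : 0 < p - 1 := by linarith
  have hℓ0 := h₀.trans hℓ
  have hGℓ := hg.bigG_pos h₁ hℓ0
  have hpα : 0 < p - α₂ := by linarith
  obtain ⟨k, hk⟩ : ∃ k, k = ((p - α₂) / (p - 1)) ^ p := ⟨_, rfl⟩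
  have hk0 : 0 < k := by rw [hk]; positivity
  -- As the front stays beyond ℓ > r₀, the gap Φ(R) - Φ(r) is at least κΦ(R) whenever r < r₀.
  obtain ⟨κ, hκ⟩ : ∃ κ, κ = 1 - shape p g r₀ r₀ / shape p g r₀ ℓ := ⟨_, rfl⟩
  have hΦℓ := shape_pos hp hg h₁ h₀ hℓ.le
  have hmono := strictMonoOn_shape hp h₂ hg h₁ h₀
  have hκ0 : 0 < κ := by
    rw [hκ, sub_pos, div_lt_one hΦℓ]
    exact hmono h₀.le hℓ0.le hℓ
  obtain ⟨K, hK⟩ : ∃ K, K = b * (p / ((p - 1) * α₁)) := ⟨_, rfl⟩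
  have hK0 : 0 < K := by rw [hK]; positivity
  -- `K` is the constant with which the front term is at most ΓK Φ(R)/G(R). The first entry of the
  -- minimum serves the region near the front, the second the rest.
  refine ⟨min (S * b * k / 2) (bigG g ℓ * (a / 2 * min (1 / 2) κ)) / K, by positivity, ?_⟩
  intro R hR r hr hrR
  obtain ⟨Γ, hΓ⟩ : ∃ Γ, Γ = min (S * b * k / 2) (bigG g ℓ * (a / 2 * min (1 / 2) κ)) / K := ⟨_, rfl⟩
  rw [← hΓ]
  have hΓK : Γ * K = min (S * b * k / 2) (bigG g ℓ * (a / 2 * min (1 / 2) κ)) := by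
    rw [hΓ, div_mul_cancel₀ _ hK0.ne']
  have hΓ0 : 0 < Γ := by rw [hΓ]; positivity
  have hR0 := hℓ0.trans_le hR
  have hrR' : r < R := (hmono.lt_iff_lt hr.le hR0.le).1 hrR
  have hGR := hg.bigG_pos h₁ hR0
  have hGle : bigG g ℓ ≤ bigG g R := (hg.strictMonoOn_bigG h₁).monotoneOn hℓ0.le hR0.le hR
  have hΦR := shape_pos hp hg h₁ h₀ (hℓ.le.trans hR)
  have hgR := hg.pos R hR0
  have hleft : b * (Γ * (shapeSlope p g r₀ R * (R / g R)))
      ≤ Γ * K * (shape p g r₀ R / bigG g R) := by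
    rw [shapeSlope, max_eq_left (hℓ.le.trans hR), shape_of_le hp hg h₁ h₀ (hℓ.le.trans hR), hK]
    have hθ := hg.ratio_lower h₁ hR0
    have hup := hg.ratio_upper h₁ hR0
    have hl := hg.mul_bigG_le h₁ hR0.le
    have hY : 0 < (R / bigG g R) ^ (1 / (p - 1)) := by positivity
    calc b * (Γ * ((p - 1)⁻¹ * (R / bigG g R) ^ (1 / (p - 1)) * (p - g R / bigG g R) * (R / g R)))
        ≤ b * (Γ * ((p - 1)⁻¹ * (R / bigG g R) ^ (1 / (p - 1)) * p * (R / (α₁ * bigG g R)))) := by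
          have : 0 ≤ p - g R / bigG g R := by linarith
          have : 0 < α₁ * bigG g R := by positivity
          gcongr
          linarith [div_pos hgR hGR]
      _ = _ := by field_simp
  refine hleft.trans ?_
  have hslope : 0 < shapeSlope p g r₀ r := shapeSlope_pos hp h₂ hg h₁ h₀ hr
  -- Away from the front the decay of the amplitude pays: the gap is a fixed fraction of Φ(R), and
  -- 1/G(R) is at most 1/G(ℓ).
  have hfar : min (1 / 2) κ * shape p g r₀ R ≤ shape p g r₀ R - shape p g r₀ r →
      Γ * K * (shape p g r₀ R / bigG g R) ≤
        S * (b * shapeSlope p g r₀ r ^ p) + a / 2 * (shape p g r₀ R - shape p g r₀ r) := by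
    intro h
    have h1 : Γ * K * (shape p g r₀ R / bigG g R)
        ≤ a / 2 * (min (1 / 2) κ * shape p g r₀ R) := by
      calc Γ * K * (shape p g r₀ R / bigG g R)
          ≤ (bigG g R * (a / 2 * min (1 / 2) κ)) * (shape p g r₀ R / bigG g R) := by
            rw [hΓK]
            gcongr
            exact (min_le_right _ _).trans (by gcongr)
        _ = _ := by field_simp
    have h2 : 0 < S * (b * shapeSlope p g r₀ r ^ p) := by positivity
    have h3 : a / 2 * (min (1 / 2) κ * shape p g r₀ R) ≤
      a / 2 * (shape p g r₀ R - shape p g r₀ r) := by gcongr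
    linarith
  rcases lt_or_ge r r₀ with h | h
  · refine hfar ?_
    have h1 : shape p g r₀ r ≤ shape p g r₀ r₀ := hmono.monotoneOn hr.le h₀.le h.le
    have h2 : shape p g r₀ ℓ ≤ shape p g r₀ R := hmono.monotoneOn hℓ0.le hR0.le hR
    have h3 : min (1 / 2) κ * shape p g r₀ R ≤ κ * shape p g r₀ R := by
      gcongr; exact min_le_right _ _
    have h4 : shape p g r₀ r₀ ≤ (1 - κ) * shape p g r₀ R := by
      have : shape p g r₀ r₀ = (1 - κ) * shape p g r₀ ℓ := by rw [hκ]; field_simp; ring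
      rw [this]
      refine mul_le_mul_of_nonneg_left h2 ?_
      rw [hκ, sub_sub_cancel]
      exact div_nonneg (shape_pos hp hg h₁ h₀ le_rfl).le hΦℓ.le
    linarith
  · rcases lt_or_ge (shape p g r₀ r) (shape p g r₀ R / 2) with h5 | h5
    · refine hfar ?_
      have h3 : min (1 / 2) κ * shape p g r₀ R ≤ 1 / 2 * shape p g r₀ R := by
        gcongr; exact min_le_left _ _
      linarith
    · have hG := hg.bigG_pos h₁ hr
      have hGrR : bigG g r ≤ bigG g R := (hg.strictMonoOn_bigG h₁).monotoneOn hr.le hR0.le hrR'.le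
      have hup := hg.ratio_upper h₁ hr
      -- Near the front diffusion pays: for r ≥ r₀ the p-th power of the slope is exactly ((p -
      -- g/G)/(p-1))^p Φ/G at r. Here Φ(r) ≥ Φ(R)/2 and G(r) ≤ G(R).
      have hpow : k * (shape p g r₀ R / 2 / bigG g R) ≤ shapeSlope p g r₀ r ^ p := by
        have hP : 0 < p - g r / bigG g r := by linarith
        have hshape := shape_pos hp hg h₁ h₀ h
        have hsplit : ∀ x : ℝ, 0 < x → x ^ p = x * x ^ (p - 1) := fun x hx => by
          rw [Real.rpow_sub_one hx.ne', mul_div_cancel₀ _ hx.ne']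
        have h6 : shapeSlope p g r₀ r ^ p
            = ((p - g r / bigG g r) / (p - 1)) ^ p * (shape p g r₀ r / bigG g r) := by
          rw [hsplit _ hslope, shapeSlope_rpow hp h₂ hg h₁ h₀ hr.le, shapeSlope, shape_of_le hp hg h₁ h₀ h,
            max_eq_left h]
          have h8 : ((p - g r / bigG g r) / (p - 1)) ^ p = ((p - g r / bigG g r) / (p - 1)) *
              ((p - 1)⁻¹ ^ (p - 1) * (p - g r / bigG g r) ^ (p - 1)) := by
            rw [← Real.mul_rpow (by positivity) hP.le, ← div_eq_inv_mul,
              hsplit _ (div_pos hP hp1)]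
          rw [h8]
          ring
        rw [h6, hk]
        gcongr
      have h9 : 0 ≤ a / 2 * (shape p g r₀ R - shape p g r₀ r) :=
        mul_nonneg (by linarith) (sub_nonneg.2 hrR.le)
      calc Γ * K * (shape p g r₀ R / bigG g R)
          ≤ S * b * k / 2 * (shape p g r₀ R / bigG g R) := by
            rw [hΓK]; gcongr; exact min_le_left _ _
        _ = S * (b * (k * (shape p g r₀ R / 2 / bigG g R))) := by ring
        _ ≤ S * (b * shapeSlope p g r₀ r ^ p) := by gcongr
        _ ≤ _ := by linarith

/-! ### The level of the front -/

theorem bigE_rpow_eq_shape {τ : ℝ} (h : r₀ ≤ radialInv (bigG g) τ) :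
    bigE p g τ ^ (1 / (p - 1)) = shape p g r₀ (radialInv (bigG g) τ) := by
  rw [shape, if_pos h, bigE]

/-- The choice of t₀ says Γ log t₀ = G(ℓ): the front starts at radius ℓ and only advances. -/
theorem le_radialInv_log (hg : IsPowerlike g α₁ α₂) (h₁ : 0 < α₁) {ℓ Γ t₀ t : ℝ} (hℓ : 0 < ℓ)
    (hΓ : 0 < Γ) (ht₀ : t₀ = Real.exp (bigG g ℓ / Γ)) (ht : 0 ≤ t) :
    bigG g ℓ ≤ Γ * Real.log (t + t₀) ∧ ℓ ≤ radialInv (bigG g) (Γ * Real.log (t + t₀)) := by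
  have h1 : bigG g ℓ ≤ Γ * Real.log (t + t₀) := by
    rw [← div_le_iff₀' hΓ, Real.le_log_iff_exp_le, ht₀]
    · linarith
    · rw [ht₀]; positivity
  refine ⟨h1, ?_⟩
  have h2 := hg.bigG_pos h₁ hℓ
  rw [← hg.radialInv_bigG h₁ hℓ.le]
  exact (hg.strictMonoOn_radialInv h₁).monotoneOn h2.le (h2.le.trans h1) h1

/-- The inverse of G has derivative R/g(R), and the logarithm supplies 1/(t+t₀). The product
(t+t₀)e' therefore depends on time only through the front radius R. -/
theorem hasDerivAt_front (hp : 1 < p) (hg : IsPowerlike g α₁ α₂) (h₁ : 0 < α₁) (h₀ : 0 < r₀)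
    {ℓ Γ t₀ t : ℝ} (hℓ : r₀ < ℓ) (hΓ : 0 < Γ) (ht₀ : t₀ = Real.exp (bigG g ℓ / Γ)) (ht : 0 ≤ t) :
    HasDerivAt (fun t => bigE p g (Γ * Real.log (t + t₀)) ^ (1 / (p - 1)))
      (Γ * (shapeSlope p g r₀ (radialInv (bigG g) (Γ * Real.log (t + t₀))) *
        (radialInv (bigG g) (Γ * Real.log (t + t₀)) /
          g (radialInv (bigG g) (Γ * Real.log (t + t₀))))) / (t + t₀)) t := by
  have hℓ0 := h₀.trans hℓ
  obtain ⟨hτ, hρ⟩ := hg.le_radialInv_log h₁ hℓ0 hΓ ht₀ ht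
  have hτ0 := (hg.bigG_pos h₁ hℓ0).trans_le hτ
  have hT : 0 < t + t₀ := by rw [ht₀]; positivity
  have hd1 : HasDerivAt (fun t => Γ * Real.log (t + t₀)) (Γ * (1 / (t + t₀))) t :=
    (((hasDerivAt_id t).add_const t₀).log hT.ne').const_mul Γ
  have hd2 := (hg.hasDerivAt_radialInv h₁ hτ0).comp t hd1
  have hd3 := (hasDerivAt_shape hp hg h₁ h₀ (hℓ0.trans_le hρ)).comp t hd2
  refine (hd3.congr_of_eventuallyEq ?_).congr_deriv ?_
  · filter_upwards [hd2.continuousAt.eventually (Ioi_mem_nhds (hℓ.trans_le hρ))] with s hs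
    exact bigE_rpow_eq_shape (le_of_lt hs)
  · rw [inv_div]; ring

theorem continuousOn_deriv_front (hp : 1 < p) (hg : IsPowerlike g α₁ α₂) (h₁ : 0 < α₁)
    (h₀ : 0 < r₀)
    {ℓ Γ t₀ : ℝ} (hℓ : r₀ < ℓ) (hΓ : 0 < Γ) (ht₀ : t₀ = Real.exp (bigG g ℓ / Γ)) :
    ContinuousOn (fun t => Γ * (shapeSlope p g r₀ (radialInv (bigG g) (Γ * Real.log (t + t₀))) *
        (radialInv (bigG g) (Γ * Real.log (t + t₀)) /
          g (radialInv (bigG g) (Γ * Real.log (t + t₀))))) / (t + t₀)) (Ici 0) := by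
  have hℓ0 := h₀.trans hℓ
  have hT : ∀ t, 0 ≤ t → 0 < t + t₀ := fun t ht => by rw [ht₀]; positivity
  have hρ : ContinuousOn (fun t => radialInv (bigG g) (Γ * Real.log (t + t₀))) (Ici 0) := by
    intro t ht
    have hτ0 := (hg.bigG_pos h₁ hℓ0).trans_le (hg.le_radialInv_log h₁ hℓ0 hΓ ht₀ ht).1
    refine ContinuousAt.continuousWithinAt (ContinuousAt.comp (g := radialInv (bigG g))
      (hg.hasDerivAt_radialInv h₁ hτ0).continuousAt ?_)
    exact continuousAt_const.mul
      ((continuousAt_id.add continuousAt_const).log (hT t ht).ne')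
  have hm : MapsTo (fun t => radialInv (bigG g) (Γ * Real.log (t + t₀))) (Ici 0) (Ioi 0) :=
    fun t ht => hℓ0.trans_le (hg.le_radialInv_log h₁ hℓ0 hΓ ht₀ ht).2
  refine (continuousOn_const.mul ((((continuousOn_shapeSlope hp hg h₁ h₀).mono
    Ioi_subset_Ici_self).comp hρ hm).mul
    (hρ.div ((hg.continuousOn.mono Ioi_subset_Ici_self).comp hρ hm) fun t ht =>
      (hg.pos _ (hm ht)).ne'))).div (by fun_prop) fun t ht => (hT t ht).ne'

/-- Since G grows at least like r^{α₁}, the front satisfies R^{α₁} ≲ log(t+t₀) ≲ (t+t₀)^{α₁/p}, that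
is R^p ≲ t+t₀. This crude bound is enough for boundedness of the barrier. -/
theorem exists_front_bound (hp : 1 < p) (hg : IsPowerlike g α₁ α₂) (h₁ : 0 < α₁)
    {ℓ Γ t₀ : ℝ} (hℓ : 0 < ℓ) (hΓ : 0 < Γ) (ht₀ : t₀ = Real.exp (bigG g ℓ / Γ)) :
    ∃ B, ∀ t, 0 ≤ t → bigE p g (Γ * Real.log (t + t₀)) ≤ B * (t + t₀) := by
  have hGℓ := hg.bigG_pos h₁ hℓ
  have hp0 : 0 < p := by linarith
  refine ⟨(ℓ ^ α₁ * Γ / bigG g ℓ * (1 / (α₁ / p))) ^ (p / α₁) / bigG g ℓ, fun t ht => ?_⟩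
  obtain ⟨hτ, hρ⟩ := hg.le_radialInv_log h₁ hℓ hΓ ht₀ ht
  have hT : 0 < t + t₀ := by rw [ht₀]; positivity
  have hlog : 0 < Real.log (t + t₀) := by
    have := hGℓ.trans_le hτ
    exact pos_of_mul_pos_right this hΓ.le
  have hG : bigG g (radialInv (bigG g) (Γ * Real.log (t + t₀))) = Γ * Real.log (t + t₀) :=
    apply_radialInv (hg.surjOn_bigG h₁) (hGℓ.le.trans hτ)
  rw [bigE, bigJ, hG]
  have hcmp := hg.bigG_mul_rpow_le h₁ hℓ hρ
  rw [hG] at hcmp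
  set R := radialInv (bigG g) (Γ * Real.log (t + t₀))
  have hR : 0 < R := hℓ.trans_le hρ
  have hl := Real.log_le_rpow_div hT.le (show 0 < α₁ / p by positivity)
  have hRα : R ^ α₁ ≤ ℓ ^ α₁ * Γ / bigG g ℓ * (1 / (α₁ / p)) * (t + t₀) ^ (α₁ / p) := by
    calc R ^ α₁ ≤ Γ * Real.log (t + t₀) * ℓ ^ α₁ / bigG g ℓ := by
          rw [le_div_iff₀ hGℓ]; linarith
      _ ≤ Γ * ((t + t₀) ^ (α₁ / p) / (α₁ / p)) * ℓ ^ α₁ / bigG g ℓ := by gcongr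
      _ = _ := by ring
  have hRp : R ^ p = (R ^ α₁) ^ (p / α₁) := by
    rw [← Real.rpow_mul hR.le, mul_div_cancel₀ _ h₁.ne']
  have : R ^ p ≤ (ℓ ^ α₁ * Γ / bigG g ℓ * (1 / (α₁ / p))) ^ (p / α₁) * (t + t₀) := by
    rw [hRp]
    refine (Real.rpow_le_rpow (by positivity) hRα (by positivity)).trans_eq ?_
    rw [Real.mul_rpow (by positivity) (by positivity), ← Real.rpow_mul hT.le,
      show α₁ / p * (p / α₁) = 1 by field_simp, Real.rpow_one]
  calc R ^ p / (Γ * Real.log (t + t₀)) ≤ R ^ p / bigG g ℓ := by gcongr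
    _ ≤ (ℓ ^ α₁ * Γ / bigG g ℓ * (1 / (α₁ / p))) ^ (p / α₁) * (t + t₀) / bigG g ℓ := by gcongr
    _ = _ := by ring

end IsPowerlike

end

section

variable {N : ℕ}

/-! ### Integration by parts for radial fields -/

/-- An integral is nonpositive if it is nonpositive along almost every ray from the origin. -/
theorem integral_nonpos_of_rays [NeZero N] {F : Space N → ℝ} (hF : Integrable F)
    (h : ∀ θ : Space N, ‖θ‖ = 1 → IntegrableOn (fun r : ℝ => r ^ (N - 1) * F (r • θ)) (Ioi 0) →
      ∫ r in Ioi (0 : ℝ), r ^ (N - 1) * F (r • θ) ≤ 0) : ∫ x, F x ≤ 0 := by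
  have hmp := (volume : Measure (Space N)).measurePreserving_homeomorphUnitSphereProd
  have hemb := (homeomorphUnitSphereProd (Space N)).measurableEmbedding
  obtain ⟨Φ, hΦ⟩ : ∃ Φ : Metric.sphere (0 : Space N) 1 × Ioi (0 : ℝ) → ℝ,
      Φ = fun q => F (q.2.1 • q.1.1) := ⟨_, rfl⟩
  have hcomp : ∀ x : ({0}ᶜ : Set (Space N)), Φ (homeomorphUnitSphereProd (Space N) x) = F x := by
    intro x
    have hx : ‖(x : Space N)‖ ≠ 0 := norm_ne_zero_iff.2 x.2
    simp [hΦ, smul_smul, hx]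
  have hfin : Module.finrank ℝ (Space N) - 1 = N - 1 := by simp
  rw [hfin] at hmp
  have hint : Integrable Φ ((volume : Measure (Space N)).toSphere.prod
      (Measure.volumeIoiPow (N - 1))) := by
    rw [← hmp.integrable_comp_emb hemb]
    simp only [Function.comp_def, hcomp]
    exact (integrableOn_iff_comap_subtypeVal (measurableSet_singleton _).compl).1 hF.integrableOn
  have heq : ∫ x, F x = ∫ q, Φ q ∂((volume : Measure (Space N)).toSphere.prod
      (Measure.volumeIoiPow (N - 1))) := by
    rw [← hmp.integral_comp hemb]
    simp only [hcomp]
    rw [integral_subtype_comap (measurableSet_singleton _).compl F, restrict_compl_singleton]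
  rw [heq, integral_prod _ hint]
  refine integral_nonpos_of_ae ?_
  filter_upwards [hint.prod_right_ae] with θ hθ
  have hmeas : Measurable fun r : Ioi (0 : ℝ) => Real.toNNReal (r.1 ^ (N - 1)) :=
    (measurable_subtype_coe.pow_const _).real_toNNReal
  have hvol : Measure.volumeIoiPow (N - 1) = (Measure.comap Subtype.val volume).withDensity
      fun r : Ioi (0 : ℝ) => ((Real.toNNReal (r.1 ^ (N - 1)) : NNReal) : ℝ≥0∞) := rfl
  have hconv : ∀ r ∈ Ioi (0 : ℝ), Real.toNNReal (r ^ (N - 1)) • F (r • θ.1)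
      = r ^ (N - 1) * F (r • θ.1) := fun r hr => by
    rw [NNReal.smul_def, Real.coe_toNNReal _ (pow_nonneg (le_of_lt hr) _), smul_eq_mul]
  rw [hvol] at hθ ⊢
  rw [integrable_withDensity_iff_integrable_smul hmeas] at hθ
  rw [integral_withDensity_eq_integral_smul hmeas]
  simp only [hΦ] at hθ ⊢
  rw [integral_subtype_comap measurableSet_Ioi
    fun r : ℝ => Real.toNNReal (r ^ (N - 1)) • F (r • θ.1),
    setIntegral_congr_fun measurableSet_Ioi hconv]
  refine h θ.1 (by simpa using θ.2) ?_
  rw [← integrableOn_congr_fun hconv measurableSet_Ioi,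
    integrableOn_iff_comap_subtypeVal measurableSet_Ioi]
  exact hθ

theorem exists_radius_of_hasCompactSupport {ζ : Space N → ℝ} (hζ : HasCompactSupport ζ) :
    ∃ R, 0 < R ∧ ∀ x, R ≤ ‖x‖ → ζ x = 0 ∧ fderiv ℝ ζ x = 0 := by
  obtain ⟨R, hR⟩ := hζ.isCompact.isBounded.subset_ball (0 : Space N)
  refine ⟨max R 1, by positivity, fun x hx => ?_⟩
  have : x ∉ tsupport ζ := fun h => by
    have := hR h
    rw [mem_ball_zero_iff] at this
    exact absurd (this.trans_le (le_max_left R 1)) (not_lt.2 hx)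
  exact ⟨image_eq_zero_of_notMem_tsupport this,
    Function.notMem_support.1 fun h => this (support_fderiv_subset ℝ h)⟩

/-- Weak form of a differential inequality `div (k(|x|) x/|x|) + y ≤ 0` off the origin. -/
theorem integral_radial_field_nonpos (hN : 2 ≤ N) {k k' : ℝ → ℝ} {y : Space N → ℝ}
    {ζ : Space N → ℝ} (hk : ContinuousOn k (Ici 0))
    (hk' : ∀ r, 0 < r → HasDerivWithinAt k (k' r) (Ioi r) r)
    (hy : ∀ x, x ≠ 0 → ((N : ℝ) - 1) * k ‖x‖ / ‖x‖ + k' ‖x‖ + y x ≤ 0)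
    (hζ : ContDiff ℝ 1 ζ) (hζc : HasCompactSupport ζ) (hζ0 : ∀ x, 0 ≤ ζ x)
    (hint : Integrable fun x => y x * ζ x - k ‖x‖ * (‖x‖⁻¹ * fderiv ℝ ζ x x)) :
    ∫ x, (y x * ζ x - k ‖x‖ * (‖x‖⁻¹ * fderiv ℝ ζ x x)) ≤ 0 := by
  have : NeZero N := ⟨by omega⟩
  obtain ⟨n, rfl⟩ : ∃ n, N = n + 1 + 1 := ⟨N - 2, by omega⟩
  obtain ⟨R, hR, hRζ⟩ := exists_radius_of_hasCompactSupport hζc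
  refine integral_nonpos_of_rays hint fun θ hθ hi => ?_
  simp only [Nat.add_sub_cancel] at hi ⊢
  set F : ℝ → ℝ := fun r => r ^ (n + 1) * (y (r • θ) * ζ (r • θ)
    - k ‖r • θ‖ * (‖r • θ‖⁻¹ * fderiv ℝ ζ (r • θ) (r • θ))) with hF
  have hnorm : ∀ r : ℝ, 0 ≤ r → ‖r • θ‖ = r := fun r hr => by
    rw [norm_smul, hθ, mul_one, Real.norm_of_nonneg hr]
  have hcut : ∫ r in Ioi (0 : ℝ), F r = ∫ r in (0 : ℝ)..R, F r := by
    rw [intervalIntegral.integral_of_le hR.le]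
    refine (setIntegral_eq_of_subset_of_forall_sdiff_eq_zero measurableSet_Ioi
      Ioc_subset_Ioi_self fun r hr => ?_)
    have hr0 : (0 : ℝ) < r := hr.1
    have hrR : R < r := by
      by_contra hc; exact hr.2 ⟨hr0, not_lt.1 hc⟩
    obtain ⟨h1, h2⟩ := hRζ (r • θ) (by rw [hnorm r hr0.le]; exact hrR.le)
    simp [hF, h1, h2]
  rw [hcut]
  -- This function vanishes at both ends: at r = 0 because N ≥ 2 leaves a positive power of r, and
  -- at R because the support of ζ ends before.
  have hc : ContinuousOn (fun r : ℝ => r ^ (n + 1) * k r * ζ (r • θ)) (Icc 0 R) := by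
    have h1 : Continuous fun r : ℝ => ζ (r • θ) := hζ.continuous.comp (by fun_prop)
    exact ((continuousOn_pow _).mul (hk.mono Icc_subset_Ici_self)).mul h1.continuousOn
  have hd : ∀ r ∈ Ioo 0 R, HasDerivWithinAt (fun r : ℝ => r ^ (n + 1) * k r * ζ (r • θ))
      ((((n : ℝ) + 1) * r ^ n * k r + r ^ (n + 1) * k' r) * ζ (r • θ)
        + r ^ (n + 1) * k r * fderiv ℝ ζ (r • θ) θ) (Ioi r) r := by
    intro r hr
    have h1 : HasDerivAt (fun r : ℝ => r • θ) θ r := by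
      simpa using (hasDerivAt_id r).smul_const θ
    have h2 : HasDerivAt (fun r : ℝ => ζ (r • θ)) (fderiv ℝ ζ (r • θ) θ) r :=
      (hζ.differentiable one_ne_zero _).hasFDerivAt.comp_hasDerivAt r h1
    have h3 := ((hasDerivAt_pow (n + 1) r).hasDerivWithinAt (s := Ioi r)).mul (hk' r hr.1)
    refine (h3.mul h2.hasDerivWithinAt).congr_deriv ?_
    push_cast
    simp
  have hFi : IntegrableOn (fun r => -F r) (Icc 0 R) := by
    rw [integrableOn_Icc_iff_integrableOn_Ioc]
    exact (hi.mono_set Ioc_subset_Ioi_self).neg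
  -- An inequality form of the fundamental theorem that asks only for a right derivative, bounded
  -- above by the integrable function -F.
  have := intervalIntegral.sub_le_integral_of_hasDeriv_right_of_le hR.le hc hd hFi fun r hr => by
    have hr0 := hr.1
    have hθ0 : r • θ ≠ 0 := by rw [← norm_ne_zero_iff, hnorm r hr0.le]; exact hr0.ne'
    have hy' := hy (r • θ) hθ0
    rw [hnorm r hr0.le] at hy'
    have hz := hζ0 (r • θ)
    have e : (((n : ℝ) + 1) * r ^ n * k r + r ^ (n + 1) * k' r) * ζ (r • θ)
        + r ^ (n + 1) * k r * fderiv ℝ ζ (r • θ) θ + F r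
        = r ^ (n + 1) * ζ (r • θ) * ((((n + 1 + 1 : ℕ) : ℝ) - 1) * k r / r + k' r + y (r • θ)) := by
      simp only [hF, hnorm r hr0.le, map_smul, smul_eq_mul]
      push_cast
      field_simp
      ring
    have := mul_nonpos_of_nonneg_of_nonpos (mul_nonneg (pow_nonneg hr0.le (n + 1)) hz) hy'
    linarith
  rw [(hRζ (R • θ) (by rw [hnorm R hR.le])).1, intervalIntegral.integral_neg] at this
  simp at this
  linarith

/-- A function of `|x|` that is flat at the origin is differentiable. -/
theorem hasFDerivAt_comp_norm {h h' : ℝ → ℝ} (hd : ∀ r, 0 < r → HasDerivAt h (h' r) r)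
    (h0 : HasDerivWithinAt h 0 (Ici 0) 0) (hh' : h' 0 = 0) (x : Space N) :
    HasFDerivAt (fun x => h ‖x‖) ((h' ‖x‖ * ‖x‖⁻¹) • innerSL ℝ x) x := by
  by_cases hx : x = 0
  · subst hx
    simp only [norm_zero, hh', zero_mul, zero_smul]
    refine .of_isLittleO ?_
    have h1 : (fun s => h s - h 0) =o[𝓝[Ici 0] 0] fun s : ℝ => s := by
      simpa using h0.hasFDerivWithinAt.isLittleO
    have h2 : Tendsto (fun x : Space N => ‖x‖) (𝓝 0) (𝓝[Ici 0] 0) :=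
      tendsto_nhdsWithin_iff.2 ⟨by simpa using tendsto_norm_zero,
        Eventually.of_forall fun x => norm_nonneg x⟩
    have h3 := h1.comp_tendsto h2
    simpa [Function.comp_def] using Asymptotics.isLittleO_norm_right.1 h3
  · have hx' : 0 < ‖x‖ := norm_pos_iff.2 hx
    have h1 : HasFDerivAt (fun x : Space N => ‖x‖) (‖x‖⁻¹ • innerSL ℝ x) x := by
      have h2 := (hasStrictFDerivAt_norm_sq x).hasFDerivAt.sqrt (by positivity)
      refine (h2.congr_fderiv ?_).congr_of_eventuallyEq (Eventually.of_forall fun y => ?_)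
      · rw [Real.sqrt_sq (norm_nonneg x)]
        ext v
        simp
        field_simp
      · simp [Real.sqrt_sq]
    have := (hd _ hx').comp_hasFDerivAt x h1
    rwa [smul_smul] at this

/-- Powers `(e - Φ(|x|))_+ ^ (b - 1)` with `b > 0` are integrable, uniformly in `e`. -/
theorem exists_lintegral_rpow_sub_bound [NeZero N] {Φ φ : ℝ → ℝ} {b δ c ρ B : ℝ} (hb : 0 < b)
    (hΦc : ContinuousOn Φ (Ici 0)) (hΦ : ∀ r, 0 < r → HasDerivAt Φ (φ r) r)
    (hΦm : StrictMonoOn Φ (Ici 0)) (hφ : ∀ r, 0 < r → 0 < φ r) (hφc : ContinuousOn φ (Ici 0))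
    (hδ : 0 < δ) (hδρ : δ < ρ) (hc : Φ δ < c) (hρ : B ≤ Φ ρ) :
    ∃ D, ∀ e, c ≤ e → e ≤ B →
      ∫⁻ x : Space N, ENNReal.ofReal (if Φ ‖x‖ < e then (e - Φ ‖x‖) ^ (b - 1) else 0)
        ≤ ENNReal.ofReal D := by
  have hρ0 := hδ.trans hδρ
  obtain ⟨r₁, hr₁, hmin⟩ := isCompact_Icc.exists_isMinOn (nonempty_Icc.2 hδρ.le)
    (hφc.mono fun r hr => hδ.le.trans hr.1)
  have hφ1 : 0 < φ r₁ := hφ _ (hδ.trans_le hr₁.1)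
  -- On [0, δ] the slope may degenerate, but the gap stays between c - Φ(δ) and B - Φ(0); the two
  -- terms cover b ≤ 1 and b ≥ 1. Beyond δ the slope is at least φ(r₁), and `Λ` compares the power
  -- with an exact derivative.
  obtain ⟨A, hA⟩ : ∃ A, A = (c - Φ δ) ^ (b - 1) + (B - Φ 0) ^ (b - 1) := ⟨_, rfl⟩
  obtain ⟨Λ, hΛ⟩ : ∃ Λ, Λ = (φ r₁ * b)⁻¹ := ⟨_, rfl⟩
  have hΛ0 : 0 ≤ Λ := by rw [hΛ]; positivity
  refine ⟨Module.finrank ℝ (Space N) • volume.real (Metric.ball (0 : Space N) 1) •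
    (ρ ^ (N - 1) * (A * ρ + Λ * (B - Φ 0) ^ b)), fun e hce heB => ?_⟩
  have h0δ : Φ 0 < Φ δ := hΦm self_mem_Ici hδ.le hδ
  have hA0 : 0 ≤ A := by
    rw [hA]
    exact add_nonneg (Real.rpow_nonneg (by linarith) _) (Real.rpow_nonneg (by linarith) _)
  obtain ⟨s, hs, hse⟩ := intermediate_value_Icc hρ0.le (hΦc.mono Icc_subset_Ici_self)
    (show e ∈ Icc (Φ 0) (Φ ρ) from ⟨by linarith, by linarith⟩)
  have hδs : δ < s := (hΦm.lt_iff_lt hδ.le hs.1).1 (by linarith)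
  have hs0 := hδ.trans hδs
  have hlt : ∀ r ∈ Ioo 0 s, Φ r < e := fun r hr => hse ▸ hΦm hr.1.le hs.1 hr.2
  have hge : ∀ r, s ≤ r → ¬ Φ r < e := fun r hr =>
    not_lt.2 (hse ▸ hΦm.monotoneOn hs.1 (hs.1.trans hr) hr)
  -- This primitive is continuous up to the front s and has a nonnegative derivative. Its derivative
  -- is hence integrable even when b < 1 makes it singular at s.
  have hcont : ContinuousOn (fun r => -(e - Φ r) ^ b) (Icc 0 s) :=
    ((continuousOn_const.sub (hΦc.mono Icc_subset_Ici_self)).rpow_const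
      fun _ _ => Or.inr hb.le).neg
  have hderiv : ∀ r ∈ Ioo 0 s, HasDerivAt (fun r => -(e - Φ r) ^ b)
      (φ r * b * (e - Φ r) ^ (b - 1)) r := fun r hr => by
    have := (((hΦ r hr.1).const_sub e).rpow_const (p := b)
      (Or.inl (sub_pos.2 (hlt r hr)).ne')).fun_neg
    simpa using this
  have hpos : ∀ r ∈ Ioo 0 s, 0 ≤ φ r * b * (e - Φ r) ^ (b - 1) := fun r hr => by
    have := hφ r hr.1
    have := sub_pos.2 (hlt r hr)
    positivity
  have hint := intervalIntegral.integrableOn_deriv_of_nonneg hcont hderiv hpos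
  have hval := intervalIntegral.integral_eq_sub_of_hasDerivAt_of_le hs0.le hcont hderiv
    ((intervalIntegrable_iff_integrableOn_Ioc_of_le hs0.le).2 hint)
  rw [hse, sub_self, Real.zero_rpow hb.ne', neg_zero, zero_sub, neg_neg,
    intervalIntegral.integral_of_le hs0.le, integral_Ioc_eq_integral_Ioo] at hval
  have hint' := hint.mono_set Ioo_subset_Ioc_self
  set f : ℝ → ℝ := fun r => if Φ r < e then (e - Φ r) ^ (b - 1) else 0 with hf
  have hf0 : ∀ r, 0 ≤ f r := fun r => by
    simp only [hf]; split_ifs with h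
    · exact Real.rpow_nonneg (sub_pos.2 h).le _
    · exact le_rfl
  have hbd : ∀ r ∈ Ioo 0 s, r ^ (N - 1) * f r
      ≤ ρ ^ (N - 1) * (A + Λ * (φ r * b * (e - Φ r) ^ (b - 1))) := fun r hr => by
    have h1 : r ^ (N - 1) ≤ ρ ^ (N - 1) := pow_le_pow_left₀ hr.1.le (hr.2.le.trans hs.2) _
    have hW := sub_pos.2 (hlt r hr)
    refine mul_le_mul h1 ?_ (hf0 r) (by positivity)
    simp only [hf, if_pos (hlt r hr)]
    rcases le_or_gt r δ with h | h
    · have h2 : Φ r ≤ Φ δ := hΦm.monotoneOn hr.1.le hδ.le h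
      have h3 : Φ 0 ≤ Φ r := hΦm.monotoneOn self_mem_Ici hr.1.le hr.1.le
      refine le_trans ?_ (le_add_of_nonneg_right (mul_nonneg hΛ0 (hpos r hr)))
      rw [hA]
      rcases le_total 1 b with hb1 | hb1
      · exact le_trans (Real.rpow_le_rpow hW.le (by linarith) (by linarith))
          (le_add_of_nonneg_left (Real.rpow_nonneg (by linarith) _))
      · exact le_trans (Real.rpow_le_rpow_of_nonpos (by linarith) (by linarith) (by linarith))
          (le_add_of_nonneg_right (Real.rpow_nonneg (by linarith) _))
    · refine le_trans ?_ (le_add_of_nonneg_left hA0)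
      have h2 : φ r₁ ≤ φ r := hmin ⟨h.le, hr.2.le.trans hs.2⟩
      rw [hΛ, le_inv_mul_iff₀ (by positivity)]
      have : 0 < (e - Φ r) ^ (b - 1) := by positivity
      gcongr
  have hmaj : IntegrableOn (fun r => ρ ^ (N - 1) * (A + Λ * (φ r * b * (e - Φ r) ^ (b - 1))))
      (Ioo 0 s) := ((integrableOn_const (by simp)).add (hint'.const_mul Λ)).const_mul _
  have hfi : IntegrableOn (fun r => r ^ (N - 1) * f r) (Ioo 0 s) := by
    refine hmaj.mono' ?_ ?_
    · refine ContinuousOn.aestronglyMeasurable ?_ measurableSet_Ioo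
      refine ContinuousOn.congr (f := fun r => r ^ (N - 1) * (e - Φ r) ^ (b - 1))
        ((continuousOn_pow _).mul ((continuousOn_const.sub
          (hΦc.mono fun r hr => hr.1.le)).rpow_const
          fun r hr => Or.inl (sub_pos.2 (hlt r hr)).ne')) fun r hr => ?_
      simp only [hf, if_pos (hlt r hr)]
    · filter_upwards [ae_restrict_mem measurableSet_Ioo] with r hr
      rw [Real.norm_of_nonneg (mul_nonneg (pow_nonneg hr.1.le _) (hf0 r))]
      exact hbd r hr
  have hz : ∀ r ∈ Ioi (0 : ℝ) \ Ioo 0 s, r ^ (N - 1) * f r = 0 := fun r hr => by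
    have : s ≤ r := by
      by_contra h; exact hr.2 ⟨hr.1, not_le.1 h⟩
    simp only [hf, if_neg (hge r this), mul_zero]
  have hfin : Module.finrank ℝ (Space N) - 1 = N - 1 := by simp
  have hfi' : Integrable fun x : Space N => f ‖x‖ := by
    rw [integrable_fun_norm_addHaar, hfin]
    exact hfi.of_forall_sdiff_eq_zero measurableSet_Ioi hz
  rw [← ofReal_integral_eq_lintegral_ofReal hfi' (Eventually.of_forall fun x => hf0 _)]
  refine ENNReal.ofReal_le_ofReal ?_
  rw [integral_fun_norm_addHaar, hfin]
  simp only [smul_eq_mul]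
  rw [setIntegral_eq_of_subset_of_forall_sdiff_eq_zero measurableSet_Ioi Ioo_subset_Ioi_self hz]
  refine nsmul_le_nsmul_right (mul_le_mul_of_nonneg_left ?_ measureReal_nonneg) _
  refine (setIntegral_mono_on hfi hmaj measurableSet_Ioo hbd).trans ?_
  rw [integral_const_mul, integral_add (integrable_const A) (hint'.const_mul Λ),
    integral_const_mul, hval]
  simp only [integral_const, smul_eq_mul, MeasurableSet.univ, measureReal_restrict_apply,
    univ_inter, Real.volume_real_Ioo_of_le hs0.le, sub_zero]
  rw [mul_comm s A]
  have := hs.2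
  have : 0 ≤ e - Φ 0 := by linarith
  gcongr

end

section

/-! ### Radial barriers -/

variable {N : ℕ}

/-- A separated radial profile `C (t + t₀)^{-a} (e(t) - Φ(|x|))_+^b`. -/
def radialBarrier {N : ℕ} (C t₀ a b : ℝ) (Φ e : ℝ → ℝ) (z : Space N × ℝ) : ℝ :=
  C / (z.2 + t₀) ^ a * (max 0 (e z.2 - Φ ‖z.1‖)) ^ b

/-- Conditions on the shape `Φ` (with slope `φ` and right derivative `ψ'` of `φ ^ (p - 1)`) and
on the level `e` under which `radialBarrier` is a strong subsolution. -/
structure IsBarrierData (N : ℕ) (p m : ℝ) (g : ℝ → ℝ) (C t₀ a b : ℝ) (Φ φ ψ' e e' : ℝ → ℝ) :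
    Prop where
  one_lt_p : 1 < p
  two_le_dim : 2 ≤ N
  pm_pos : 0 < p + m - 3
  a_eq : a = 1 / (p + m - 3)
  b_eq : b = (p - 1) / (p + m - 3)
  C_pos : 0 < C
  t₀_pos : 0 < t₀
  continuousOn_g : ContinuousOn g (Ici 0)
  g_nonneg : ∀ s, 0 ≤ s → 0 ≤ g s
  hasDerivAt_g : ∀ s, 0 < s → HasDerivAt g (deriv g s) s
  hasDerivAt_shape : ∀ r, 0 < r → HasDerivAt Φ (φ r) r
  shape_flat : HasDerivWithinAt Φ 0 (Ici 0) 0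
  shape_mono : StrictMonoOn Φ (Ici 0)
  shape_top : ∀ t, 0 ≤ t → ∃ ρ, 0 < ρ ∧ e t ≤ Φ ρ
  shape_nonneg : 0 ≤ Φ 0
  continuousOn_slope : ContinuousOn φ (Ici 0)
  slope_zero : φ 0 = 0
  slope_pos : ∀ r, 0 < r → 0 < φ r
  hasDerivWithinAt_slope : ∀ r, 0 < r →
    HasDerivWithinAt (fun r => φ r ^ (p - 1)) (ψ' r) (Ioi r) r
  hasDerivAt_level : ∀ t, 0 ≤ t → HasDerivAt e (e' t) t
  continuousOn_level' : ContinuousOn e' (Ici 0)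
  level'_pos : ∀ t, 0 ≤ t → 0 < e' t
  level_zero : Φ 0 < e 0
  level_bound : ∃ B, ∀ t, 0 ≤ t → e t ^ (p - 1) ≤ B * (t + t₀)
  ineq : ∀ t, 0 < t → ∀ r, 0 < r → Φ r < e t →
    -a * (e t - Φ r) + b * ((t + t₀) * e' t) + b ^ (p - 1) * C ^ (p + m - 3) *
      ((e t - Φ r) * (((N : ℝ) - 1) * (φ r ^ (p - 1) / r) + deriv g r * φ r ^ (p - 1) + ψ' r)
        - b * φ r ^ p) ≤ 0

theorem isLocallyFiniteMeasure_weightMeasure {g : ℝ → ℝ} (hg : ContinuousOn g (Ici 0)) :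
    IsLocallyFiniteMeasure (weightMeasure N g) :=
  IsLocallyFiniteMeasure.withDensity_ofReal (continuous_weight hg)

theorem hasDerivAt_posPart_rpow {b : ℝ} (hb : 0 < b) (s : ℝ) :
    HasDerivAt (fun s : ℝ => (max 0 s) ^ (1 + b)) ((1 + b) * (max 0 s) ^ b) s := by
  rcases lt_trichotomy s 0 with h | rfl | h
  · rw [max_eq_left h.le, Real.zero_rpow hb.ne', mul_zero]
    refine (hasDerivAt_const s (0 : ℝ)).congr_of_eventuallyEq ?_
    filter_upwards [Iio_mem_nhds h] with y hy
    rw [max_eq_left (le_of_lt hy), Real.zero_rpow (by linarith)]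
  · rw [max_self, Real.zero_rpow hb.ne', mul_zero]
    have hl : HasDerivWithinAt (fun s : ℝ => (max 0 s) ^ (1 + b)) 0 (Iic 0) 0 := by
      refine (hasDerivWithinAt_const 0 (Iic 0) (0 : ℝ)).congr (fun y hy => ?_) ?_
      · rw [max_eq_left (mem_Iic.1 hy), Real.zero_rpow (by linarith)]
      · rw [max_self, Real.zero_rpow (by linarith)]
    have hr : HasDerivWithinAt (fun s : ℝ => (max 0 s) ^ (1 + b)) 0 (Ici 0) 0 := by
      have := Real.hasDerivAt_rpow_const (x := 0) (p := 1 + b) (Or.inr (by linarith))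
      rw [add_sub_cancel_left, Real.zero_rpow hb.ne', mul_zero] at this
      exact this.hasDerivWithinAt.congr (fun y hy => by rw [max_eq_right (mem_Ici.1 hy)])
        (by rw [max_self])
    have := hl.union hr
    rwa [Iic_union_Ici, hasDerivWithinAt_univ] at this
  · rw [max_eq_right h.le]
    have := Real.hasDerivAt_rpow_const (x := s) (p := 1 + b) (Or.inl h.ne')
    rw [add_sub_cancel_left] at this
    refine this.congr_of_eventuallyEq ?_
    filter_upwards [Ioi_mem_nhds h] with y hy
    rw [max_eq_right (le_of_lt hy)]

/-- Integration by parts for a differentiable function and a compactly supported test function. -/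
theorem integral_smul_gradient_add {F ζ : Space N → ℝ} {V Z : Space N → Space N}
    (hF : ∀ x, HasFDerivAt F (innerSL ℝ (V x)) x) (hV : Continuous V)
    (hζ : ∀ x, HasFDerivAt ζ (innerSL ℝ (Z x)) x) (hZ : Continuous Z) (hc : HasCompactSupport ζ) :
    ∫ x, (F x • Z x + ζ x • V x) = 0 := by
  have hFc : Continuous F := continuous_iff_continuousAt.2 fun x => (hF x).continuousAt
  have hζc : Continuous ζ := continuous_iff_continuousAt.2 fun x => (hζ x).continuousAt
  have hZc : HasCompactSupport Z := by
    refine HasCompactSupport.intro' hc.isCompact (isClosed_tsupport ζ) fun x hx => ?_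
    have h1 : fderiv ℝ ζ x = 0 :=
      Function.notMem_support.1 fun h => hx (support_fderiv_subset ℝ h)
    rw [(hζ x).fderiv] at h1
    have h2 : innerSL ℝ (Z x) (Z x) = 0 := by rw [h1]; rfl
    simpa using h2
  have i1 : Integrable fun x => F x • Z x :=
    (hFc.smul hZ).integrable_of_hasCompactSupport hZc.smul_left
  have i2 : Integrable fun x => ζ x • V x :=
    (hζc.smul hV).integrable_of_hasCompactSupport hc.smul_right
  refine ext_inner_right ℝ fun v => ?_
  have i12 : Integrable fun x => F x • Z x + ζ x • V x := i1.add i2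
  rw [inner_zero_left, real_inner_comm, ← integral_inner i12]
  have hDF : ∀ x, fderiv ℝ F x v = inner ℝ (V x) v := fun x => by rw [(hF x).fderiv]; simp
  have hDζ : ∀ x, fderiv ℝ ζ x v = inner ℝ (Z x) v := fun x => by rw [(hζ x).fderiv]; simp
  have key := integral_mul_fderiv_eq_neg_fderiv_mul_of_integrable (μ := volume) (f := F) (g := ζ)
    (v := v) ?_ ?_ ?_ (fun x _ => (hF x).differentiableAt) (fun x _ => (hζ x).differentiableAt)
  · have i3 : Integrable fun x => F x * fderiv ℝ ζ x v := by
      simp only [hDζ]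
      simpa [inner_smul_left] using i1.inner_const (𝕜 := ℝ) v
    have i4 : Integrable fun x => fderiv ℝ F x v * ζ x := by
      simp only [hDF]
      simpa [inner_smul_left, mul_comm] using i2.inner_const (𝕜 := ℝ) v
    rw [← add_eq_zero_iff_eq_neg, ← integral_add i3 i4] at key
    rw [← key]
    refine integral_congr_ae (Eventually.of_forall fun x => ?_)
    simp only [hDF, hDζ, inner_add_right, inner_smul_right]
    rw [real_inner_comm v (Z x), real_inner_comm v (V x)]
    ring
  · simp only [hDF]
    simpa [inner_smul_left, mul_comm] using i2.inner_const (𝕜 := ℝ) v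
  · simp only [hDζ]
    simpa [inner_smul_left] using i1.inner_const (𝕜 := ℝ) v
  · exact (hFc.mul hζc).integrable_of_hasCompactSupport hc.mul_left

namespace IsBarrierData

variable {p m C t₀ a b : ℝ} {g Φ φ ψ' e e' : ℝ → ℝ}

theorem a_pos (h : IsBarrierData N p m g C t₀ a b Φ φ ψ' e e') : 0 < a := by
  have := h.pm_pos; rw [h.a_eq]; positivity

theorem b_pos (h : IsBarrierData N p m g C t₀ a b Φ φ ψ' e e') : 0 < b := by
  have := h.pm_pos
  have : 0 < p - 1 := by linarith [h.one_lt_p]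
  rw [h.b_eq]; positivity

theorem b_eq_mul (h : IsBarrierData N p m g C t₀ a b Φ φ ψ' e e') : b = (p - 1) * a := by
  rw [h.a_eq, h.b_eq]; ring

theorem a_mul (h : IsBarrierData N p m g C t₀ a b Φ φ ψ' e e') : a * (p + m - 3) = 1 := by
  rw [h.a_eq]; exact one_div_mul_cancel h.pm_pos.ne'

/-- The power of the barrier that must have a gradient is a multiple of W_+^{1+a}. Its exponent
exceeds one, so it is differentiable across the front even when b < 1. -/
theorem gradExponent_mul (h : IsBarrierData N p m g C t₀ a b Φ φ ψ' e e') :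
    b * gradExponent p m = 1 + a := by
  have : p - 1 ≠ 0 := by linarith [h.one_lt_p]
  have h2 := h.a_mul
  rw [h.b_eq_mul, gradExponent]
  field_simp
  linarith

theorem continuousOn_shape (h : IsBarrierData N p m g C t₀ a b Φ φ ψ' e e') :
    ContinuousOn Φ (Ici 0) := by
  intro r hr
  rcases (mem_Ici.1 hr).eq_or_lt with rfl | hr
  · exact h.shape_flat.continuousWithinAt
  · exact (h.hasDerivAt_shape r hr).continuousAt.continuousWithinAt

theorem continuous_shape_norm (h : IsBarrierData N p m g C t₀ a b Φ φ ψ' e e') :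
    Continuous fun x : Space N => Φ ‖x‖ :=
  h.continuousOn_shape.comp_continuous continuous_norm fun x => norm_nonneg x

theorem continuousOn_level (h : IsBarrierData N p m g C t₀ a b Φ φ ψ' e e') :
    ContinuousOn e (Ici 0) := fun t ht => (h.hasDerivAt_level t ht).continuousAt.continuousWithinAt

theorem level_strictMono (h : IsBarrierData N p m g C t₀ a b Φ φ ψ' e e') :
    StrictMonoOn e (Ici 0) := by
  refine strictMonoOn_of_deriv_pos (convex_Ici 0) h.continuousOn_level fun t ht => ?_
  rw [interior_Ici] at ht
  rw [(h.hasDerivAt_level t (le_of_lt ht)).deriv]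
  exact h.level'_pos t (le_of_lt ht)

theorem shape_norm_nonneg (h : IsBarrierData N p m g C t₀ a b Φ φ ψ' e e') (x : Space N) :
    0 ≤ Φ ‖x‖ :=
  h.shape_nonneg.trans (h.shape_mono.monotoneOn self_mem_Ici (norm_nonneg x) (norm_nonneg x))

theorem level_pos (h : IsBarrierData N p m g C t₀ a b Φ φ ψ' e e') {t : ℝ} (ht : 0 ≤ t) :
    0 < e t :=
  (h.shape_nonneg.trans_lt h.level_zero).trans_le
    (h.level_strictMono.monotoneOn self_mem_Ici ht ht)

theorem continuousOn_gap (h : IsBarrierData N p m g C t₀ a b Φ φ ψ' e e') :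
    ContinuousOn (fun z : Space N × ℝ => e z.2 - Φ ‖z.1‖) (univ ×ˢ Ici 0) :=
  (h.continuousOn_level.comp continuousOn_snd fun _ hz => hz.2).sub
    (h.continuous_shape_norm.comp continuous_fst).continuousOn

theorem continuousOn_amplitude (h : IsBarrierData N p m g C t₀ a b Φ φ ψ' e e') :
    ContinuousOn (fun z : Space N × ℝ => C / (z.2 + t₀) ^ a) (univ ×ˢ Ici 0) := by
  have hT : ∀ z ∈ (univ ×ˢ Ici 0 : Set (Space N × ℝ)), 0 < z.2 + t₀ := fun z hz =>
    add_pos_of_nonneg_of_pos hz.2 h.t₀_pos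
  refine continuousOn_const.div ((continuousOn_snd.add continuousOn_const).rpow_const
    fun z hz => Or.inl (hT z hz).ne') fun z hz => (Real.rpow_pos_of_pos (hT z hz) _).ne'

theorem continuousOn_radialBarrier (h : IsBarrierData N p m g C t₀ a b Φ φ ψ' e e') :
    ContinuousOn (radialBarrier (N := N) C t₀ a b Φ e) (univ ×ˢ Ici 0) :=
  h.continuousOn_amplitude.mul ((continuousOn_const.sup h.continuousOn_gap).rpow_const
    fun _ _ => Or.inr h.b_pos.le)

theorem continuous_slice (h : IsBarrierData N p m g C t₀ a b Φ φ ψ' e e') {t : ℝ} (ht : 0 ≤ t) :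
    Continuous fun x : Space N => radialBarrier C t₀ a b Φ e (x, t) :=
  h.continuousOn_radialBarrier.comp_continuous (by fun_prop) fun _ => ⟨mem_univ _, ht⟩

theorem radialBarrier_nonneg (h : IsBarrierData N p m g C t₀ a b Φ φ ψ' e e') {t : ℝ} (ht : 0 ≤ t)
    (x : Space N) : 0 ≤ radialBarrier C t₀ a b Φ e (x, t) := by
  have := h.C_pos
  have := h.t₀_pos
  exact mul_nonneg (by positivity) (Real.rpow_nonneg (le_max_left _ _) _)

/-- Since b = (p-1)a, at most linear growth of e^{p-1} in t+t₀ is compensated exactly by the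
amplitude. -/
theorem exists_radialBarrier_le (h : IsBarrierData N p m g C t₀ a b Φ φ ψ' e e') :
    ∃ M, 0 ≤ M ∧ ∀ t, 0 ≤ t → ∀ x : Space N, radialBarrier C t₀ a b Φ e (x, t) ≤ M := by
  obtain ⟨B, hB⟩ := h.level_bound
  have hC := h.C_pos
  have hB0 : 0 ≤ B := by
    by_contra hc
    have h1 := hB 0 le_rfl
    have h2 : 0 ≤ e 0 ^ (p - 1) := Real.rpow_nonneg (h.level_pos le_rfl).le _
    nlinarith [h.t₀_pos]
  refine ⟨C * B ^ a, by positivity, fun t ht x => ?_⟩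
  have hT : 0 < t + t₀ := add_pos_of_nonneg_of_pos ht h.t₀_pos
  have he := h.level_pos ht
  have h1 : (max 0 (e t - Φ ‖x‖)) ^ b ≤ (B * (t + t₀)) ^ a := by
    calc (max 0 (e t - Φ ‖x‖)) ^ b ≤ e t ^ b :=
          Real.rpow_le_rpow (le_max_left _ _)
            (max_le he.le (by linarith [h.shape_norm_nonneg x])) h.b_pos.le
      _ = (e t ^ (p - 1)) ^ a := by rw [h.b_eq_mul, Real.rpow_mul he.le]
      _ ≤ _ := Real.rpow_le_rpow (Real.rpow_nonneg he.le _) (hB t ht) h.a_pos.le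
  calc radialBarrier C t₀ a b Φ e (x, t) ≤ C / (t + t₀) ^ a * (B * (t + t₀)) ^ a :=
        mul_le_mul_of_nonneg_left h1 (by positivity)
    _ = _ := by rw [Real.mul_rpow hB0 hT.le]; field_simp

theorem exists_radialBarrier_eq_zero (h : IsBarrierData N p m g C t₀ a b Φ φ ψ' e e') {T : ℝ}
    (hT : 0 ≤ T) : ∃ ρ, 0 < ρ ∧ ∀ t, 0 ≤ t → t ≤ T → ∀ x : Space N, ρ ≤ ‖x‖ →
      radialBarrier C t₀ a b Φ e (x, t) = 0 := by
  obtain ⟨ρ, hρ, hρe⟩ := h.shape_top T hT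
  refine ⟨ρ, hρ, fun t ht htT x hx => ?_⟩
  have h1 := h.level_strictMono.monotoneOn ht hT htT
  have h2 := h.shape_mono.monotoneOn hρ.le (norm_nonneg x) hx
  rw [radialBarrier, max_eq_left (by simp only; linarith), Real.zero_rpow h.b_pos.ne', mul_zero]

theorem isAdmissible (h : IsBarrierData N p m g C t₀ a b Φ φ ψ' e e') :
    IsAdmissible g (radialBarrier (N := N) C t₀ a b Φ e) := by
  have := isLocallyFiniteMeasure_weightMeasure (N := N) h.continuousOn_g
  obtain ⟨M, hM0, hM⟩ := h.exists_radialBarrier_le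
  refine ⟨fun t ht => Eventually.of_forall (h.radialBarrier_nonneg ht), fun t ht => ?_,
    fun t ht => ?_, fun tb htb => ?_⟩
  · obtain ⟨ρ, hρ, hz⟩ := h.exists_radialBarrier_eq_zero ht
    refine (h.continuous_slice ht).memLp_of_hasCompactSupport ?_
    refine HasCompactSupport.intro (isCompact_closedBall 0 ρ) fun x hx => hz t ht le_rfl x ?_
    rw [mem_closedBall_zero_iff, not_le] at hx
    exact hx.le
  · obtain ⟨ρ, hρ, hz⟩ := h.exists_radialBarrier_eq_zero (T := t + 1) (by linarith)
    simp only [eLpNorm_one_eq_lintegral_enorm]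
    have hev : ∀ᶠ s in 𝓝[Ici 0] t, 0 ≤ s ∧ s ≤ t + 1 := by
      filter_upwards [self_mem_nhdsWithin, mem_nhdsWithin_of_mem_nhds (Iic_mem_nhds (lt_add_one t))]
        with s h1 h2 using ⟨h1, h2⟩
    have key := tendsto_lintegral_filter_of_dominated_convergence
      (μ := weightMeasure N g) (l := 𝓝[Ici 0] t)
      (F := fun s x => ‖radialBarrier C t₀ a b Φ e (x, s) - radialBarrier C t₀ a b Φ e (x, t)‖ₑ)
      (f := fun _ => 0)
      ((Metric.closedBall (0 : Space N) ρ).indicator fun _ => ENNReal.ofReal M) ?_ ?_ ?_ ?_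
    · simpa using key
    · filter_upwards [hev] with s hs
      exact ((h.continuous_slice hs.1).sub (h.continuous_slice ht)).measurable.enorm
    · filter_upwards [hev] with s hs
      refine Eventually.of_forall fun x => ?_
      by_cases hx : x ∈ Metric.closedBall (0 : Space N) ρ
      · rw [indicator_of_mem hx, ← ofReal_norm]
        refine ENNReal.ofReal_le_ofReal (abs_le.2 ⟨?_, ?_⟩)
        · linarith [hM t ht x, h.radialBarrier_nonneg hs.1 x]
        · linarith [hM s hs.1 x, h.radialBarrier_nonneg ht x]
      · have hx' : ρ ≤ ‖x‖ := by
          rw [mem_closedBall_zero_iff, not_le] at hx; exact hx.le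
        rw [hz s hs.1 hs.2 x hx', hz t ht (by linarith) x hx']
        simp
    · rw [lintegral_indicator Metric.isClosed_closedBall.measurableSet, setLIntegral_const]
      exact ENNReal.mul_ne_top (by simp) (isCompact_closedBall _ _).measure_lt_top.ne
    · refine Eventually.of_forall fun x => ?_
      have h1 : ContinuousOn (fun s => radialBarrier C t₀ a b Φ e (x, s)) (Ici 0) :=
        h.continuousOn_radialBarrier.comp (by fun_prop) fun s hs => ⟨mem_univ _, hs⟩
      have h2 := ((h1 t ht).tendsto.sub_const (radialBarrier C t₀ a b Φ e (x, t))).enorm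
      simpa using h2
  · have hsub : (univ ×ˢ Ioi tb : Set (Space N × ℝ)) ⊆ univ ×ˢ Ici 0 :=
      prod_mono_right fun s hs => (htb.trans hs).le
    have hms : MeasurableSet (univ ×ˢ Ioi tb : Set (Space N × ℝ)) :=
      MeasurableSet.univ.prod measurableSet_Ioi
    refine memLp_top_of_bound ((h.continuousOn_radialBarrier.mono hsub).aestronglyMeasurable hms)
      M ?_
    filter_upwards [ae_restrict_mem hms] with z hz
    have h0 := h.radialBarrier_nonneg (hsub hz).2 z.1
    rw [Real.norm_of_nonneg h0]
    exact hM z.2 (hsub hz).2 z.1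

end IsBarrierData

end

section

/-! ### The spatial gradient of the barrier -/

variable {N : ℕ}

theorem gradX_slice {η : Space N × ℝ → ℝ} (hη : IsTest η) (t : ℝ) (x : Space N) :
    HasFDerivAt (fun x => η (x, t)) (innerSL ℝ (gradX η (x, t))) x := by
  have h : DifferentiableAt ℝ (fun x => η (x, t)) x :=
    (hη.differentiable.comp (by fun_prop : Differentiable ℝ fun x : Space N => (x, t))) x
  exact h.hasGradientAt.hasFDerivAt

theorem hasCompactSupport_slice {η : Space N × ℝ → ℝ} (hη : IsTest η) (t : ℝ) :
    HasCompactSupport fun x => η (x, t) := by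
  refine HasCompactSupport.intro (hη.compact.isCompact.image continuous_fst) fun x hx => ?_
  exact hη.eq_zero fun hz => hx ⟨_, hz, rfl⟩

namespace IsBarrierData

variable {p m C t₀ a b : ℝ} {g Φ φ ψ' e e' : ℝ → ℝ}

/-- The spatial gradient of the power `gradExponent p m` of `radialBarrier`. -/
def powGradient (p m C t₀ a : ℝ) (Φ φ e : ℝ → ℝ) (z : Space N × ℝ) : Space N :=
  (-((C / (z.2 + t₀) ^ a) ^ gradExponent p m * ((1 + a) * (max 0 (e z.2 - Φ ‖z.1‖)) ^ a))) •
    ((φ ‖z.1‖ * ‖z.1‖⁻¹) • z.1)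

theorem continuous_unit_field (h : IsBarrierData N p m g C t₀ a b Φ φ ψ' e e') :
    Continuous fun x : Space N => (φ ‖x‖ * ‖x‖⁻¹) • x := by
  have hφ : Continuous fun x : Space N => φ ‖x‖ :=
    h.continuousOn_slope.comp_continuous continuous_norm fun x => norm_nonneg x
  refine continuous_iff_continuousAt.2 fun x => ?_
  by_cases hx : x = 0
  · subst hx
    refine tendsto_zero_iff_norm_tendsto_zero.2 ?_ |>.trans_eq (by simp)
    have h1 : Tendsto (fun x : Space N => φ ‖x‖) (𝓝 0) (𝓝 0) := by
      simpa [h.slope_zero] using hφ.tendsto 0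
    refine squeeze_zero (fun _ => norm_nonneg _) (fun y => ?_) h1
    rw [norm_smul, norm_mul, norm_inv, norm_norm]
    have h2 : 0 ≤ φ ‖y‖ := by
      rcases (norm_nonneg y).eq_or_lt with hy | hy
      · rw [← hy, h.slope_zero]
      · exact (h.slope_pos _ hy).le
    rw [Real.norm_of_nonneg h2, mul_assoc]
    exact mul_le_of_le_one_right h2 (inv_mul_le_one)
  · exact (hφ.continuousAt.mul (continuous_norm.continuousAt.inv₀
      (norm_ne_zero_iff.2 hx))).smul continuousAt_id

theorem continuousOn_powGradient (h : IsBarrierData N p m g C t₀ a b Φ φ ψ' e e') :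
    ContinuousOn (powGradient (N := N) p m C t₀ a Φ φ e) (univ ×ˢ Ici 0) := by
  have hq := gradExponent_pos h.one_lt_p h.pm_pos
  refine ContinuousOn.smul ((h.continuousOn_amplitude.rpow_const fun _ _ => Or.inr hq.le).mul
    (continuousOn_const.mul ((continuousOn_const.sup h.continuousOn_gap).rpow_const
      fun _ _ => Or.inr h.a_pos.le))).neg (h.continuous_unit_field.comp continuous_fst).continuousOn

theorem spaceTime_subset : spaceTime N ⊆ univ ×ˢ Ici 0 := prod_mono_right Ioi_subset_Ici_self

theorem hasFDerivAt_pow_slice (h : IsBarrierData N p m g C t₀ a b Φ φ ψ' e e') {t : ℝ}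
    (ht : 0 ≤ t) (x : Space N) :
    HasFDerivAt (fun x => radialBarrier C t₀ a b Φ e (x, t) ^ gradExponent p m)
      (innerSL ℝ (powGradient p m C t₀ a Φ φ e (x, t))) x := by
  have hA : 0 ≤ C / (t + t₀) ^ a := by
    have := h.C_pos; have := h.t₀_pos; positivity
  have h1 : HasFDerivAt (fun x : Space N => e t - Φ ‖x‖) _ x :=
    (hasFDerivAt_comp_norm h.hasDerivAt_shape h.shape_flat h.slope_zero x).const_sub (e t)
  have h2 := ((hasDerivAt_posPart_rpow h.a_pos (e t - Φ ‖x‖)).comp_hasFDerivAt x h1).const_mul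
    ((C / (t + t₀) ^ a) ^ gradExponent p m)
  refine (h2.congr_of_eventuallyEq (Eventually.of_forall fun y => ?_)).congr_fderiv ?_
  · have : (0 : ℝ) ≤ max 0 (e t - Φ ‖y‖) := le_max_left _ _
    simp only [radialBarrier]
    rw [Real.mul_rpow hA (Real.rpow_nonneg this _), ← Real.rpow_mul this, h.gradExponent_mul]
    rfl
  · ext v
    simp [powGradient]
    ring

theorem isWeakGradX (h : IsBarrierData N p m g C t₀ a b Φ φ ψ' e e') :
    IsWeakGradX (fun z => radialBarrier (N := N) C t₀ a b Φ e z ^ gradExponent p m)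
      (powGradient p m C t₀ a Φ φ e) := by
  have hq := gradExponent_pos h.one_lt_p h.pm_pos
  have hw : LocallyIntegrableOn (fun z => radialBarrier (N := N) C t₀ a b Φ e z ^ gradExponent p m)
      (spaceTime N) :=
    ((h.continuousOn_radialBarrier.rpow_const fun _ _ => Or.inr hq.le).mono
      spaceTime_subset).locallyIntegrableOn measurableSet_spaceTime
  have hV : LocallyIntegrableOn (powGradient (N := N) p m C t₀ a Φ φ e) (spaceTime N) :=
    (h.continuousOn_powGradient.mono spaceTime_subset).locallyIntegrableOn measurableSet_spaceTime
  refine ⟨hw, hV, fun η hη => ?_⟩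
  have i1 : IntegrableOn (fun z => radialBarrier (N := N) C t₀ a b Φ e z ^ gradExponent p m •
      gradX η z) (spaceTime N) :=
    integrableOn_of_eq_zero_off ((hw.integrableOn_compact_subset hη.supp
      hη.compact).smul_continuousOn hη.continuous_gradX.continuousOn hη.compact)
      fun z hz => by simp [hη.gradX_eq_zero hz]
  have i2 : IntegrableOn (fun z => η z • powGradient (N := N) p m C t₀ a Φ φ e z) (spaceTime N) :=
    integrableOn_of_eq_zero_off ((hV.integrableOn_compact_subset hη.supp
      hη.compact).continuousOn_smul hη.smooth.continuous.continuousOn hη.compact)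
      fun z hz => by simp [hη.eq_zero hz]
  have i3 : IntegrableOn (fun z => radialBarrier (N := N) C t₀ a b Φ e z ^ gradExponent p m •
      gradX η z + η z • powGradient p m C t₀ a Φ φ e z) (spaceTime N) := i1.add i2
  rw [← add_eq_zero_iff_eq_neg, ← integral_add i1 i2]
  rw [IntegrableOn, volume_restrict_spaceTime] at i3
  rw [volume_restrict_spaceTime, integral_prod_symm _ i3]
  refine integral_eq_zero_of_ae ?_
  filter_upwards [ae_restrict_mem measurableSet_Ioi] with t ht
  have ht : 0 ≤ t := le_of_lt ht
  exact integral_smul_gradient_add (h.hasFDerivAt_pow_slice ht)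
    (h.continuousOn_powGradient.comp_continuous (by fun_prop) fun _ => ⟨mem_univ _, ht⟩)
    (gradX_slice hη t) (hη.continuous_gradX.comp (by fun_prop)) (hasCompactSupport_slice hη t)

theorem memLpLoc_powGradient (h : IsBarrierData N p m g C t₀ a b Φ φ ψ' e e') :
    MemLpLoc p (powGradient (N := N) p m C t₀ a Φ φ e) := by
  intro K hK hKs
  have : IsFiniteMeasure (volume.restrict K) := ⟨by simpa using hK.measure_lt_top⟩
  have hc := h.continuousOn_powGradient.mono (hKs.trans spaceTime_subset)
  obtain ⟨M, hM⟩ := hK.exists_bound_of_continuousOn hc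
  refine MemLp.of_bound (hc.aestronglyMeasurable hK.measurableSet) M ?_
  filter_upwards [ae_restrict_mem hK.measurableSet] with z hz using hM z hz

/-- Exponent bookkeeping: a(p-1) = b, so the flux carries the same power of the gap as the barrier.
As a(p+m-3) = 1, the amplitude to the power p+m-2 equals C^{p+m-3}/(t+t₀) times the amplitude. -/
theorem flux_powGradient (h : IsBarrierData N p m g C t₀ a b Φ φ ψ' e e') {t : ℝ} (ht : 0 ≤ t)
    (x : Space N) : flux p m (powGradient p m C t₀ a Φ φ e (x, t)) =
      (-(b ^ (p - 1) * C ^ (p + m - 3) * (C * ((t + t₀) ^ a)⁻¹ * (t + t₀)⁻¹) *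
        (max 0 (e t - Φ ‖x‖)) ^ b * φ ‖x‖ ^ (p - 1))) • (‖x‖⁻¹ • x) := by
  have hp := h.one_lt_p
  by_cases hx : x = 0
  · subst hx; simp [powGradient, flux]
  have hx0 : 0 < ‖x‖ := norm_pos_iff.2 hx
  have hφ : 0 < φ ‖x‖ := h.slope_pos _ hx0
  have hT : 0 < t + t₀ := add_pos_of_nonneg_of_pos ht h.t₀_pos
  have hC := h.C_pos
  have ha := h.a_pos
  have hb := h.b_pos
  have hq := gradExponent_pos hp h.pm_pos
  obtain ⟨W, hW⟩ : ∃ W, W = max 0 (e t - Φ ‖x‖) := ⟨_, rfl⟩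
  have hW0 : 0 ≤ W := hW ▸ le_max_left _ _
  obtain ⟨c, hc⟩ : ∃ c, c = (C / (t + t₀) ^ a) ^ gradExponent p m * ((1 + a) * W ^ a) * φ ‖x‖ :=
    ⟨_, rfl⟩
  have hc0 : 0 ≤ c := by rw [hc]; positivity
  have hV : powGradient p m C t₀ a Φ φ e (x, t) = (-c) • (‖x‖⁻¹ • x) := by
    simp only [powGradient, ← hW, hc, smul_smul]
    congr 1
    ring
  have hn : ‖powGradient p m C t₀ a Φ φ e (x, t)‖ = c := by
    rw [hV, norm_smul, norm_smul, norm_inv, norm_norm, inv_mul_cancel₀ hx0.ne', mul_one, norm_neg,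
      Real.norm_of_nonneg hc0]
  rw [flux, hn, hV, smul_smul, ← hW]
  congr 1
  -- Outside the support the gradient is zero and its power p - 2 may be negative, so the exponent
  -- laws apply only to a positive gap.
  rcases hW0.eq_or_lt with hW1 | hW1
  · have : c = 0 := by rw [hc, ← hW1, Real.zero_rpow ha.ne']; ring
    rw [this, ← hW1, Real.zero_rpow hb.ne']; ring
  have hc1 : 0 < c := by rw [hc]; positivity
  have e1 : c ^ (p - 2) * c = c ^ (p - 1) := by
    rw [← Real.rpow_add_one hc1.ne']; congr 1; ring
  have e2 : c ^ (p - 1) = (C / (t + t₀) ^ a) ^ (p + m - 2) * (1 + a) ^ (p - 1) * W ^ b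
      * φ ‖x‖ ^ (p - 1) := by
    rw [hc, Real.mul_rpow (by positivity) hφ.le, Real.mul_rpow (by positivity) (by positivity),
      Real.mul_rpow (by positivity) (by positivity), ← Real.rpow_mul hW0, ← Real.rpow_mul
      (by positivity), mul_comm a, ← h.b_eq_mul, gradExponent, div_mul_cancel₀ _ (by linarith)]
    ring
  have e3 : (C / (t + t₀) ^ a) ^ (p + m - 2)
      = C ^ (p + m - 3) * (C * ((t + t₀) ^ a)⁻¹ * (t + t₀)⁻¹) := by
    rw [show p + m - 2 = (p + m - 3) + 1 by ring, Real.rpow_add_one (by positivity),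
      Real.div_rpow hC.le (by positivity), ← Real.rpow_mul hT.le, h.a_mul, Real.rpow_one]
    ring
  have e4 : gradExponent p m ^ (-(p - 1)) * (1 + a) ^ (p - 1) = b ^ (p - 1) := by
    rw [Real.rpow_neg hq.le, ← h.gradExponent_mul, Real.mul_rpow hb.le hq.le, mul_comm (b ^ (p - 1)),
      inv_mul_cancel_left₀ (by positivity)]
  rw [mul_neg, mul_assoc, e1, e2, e3, ← e4]
  ring

end IsBarrierData

end

section

/-! ### The time derivative of the barrier -/

variable {N : ℕ}

namespace IsBarrierData

variable {p m C t₀ a b : ℝ} {g Φ φ ψ' e e' : ℝ → ℝ}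

/-- The time derivative of `radialBarrier`, off the boundary of its support. -/
def timeDeriv (C t₀ a b : ℝ) (Φ e e' : ℝ → ℝ) (z : Space N × ℝ) : ℝ :=
  if Φ ‖z.1‖ < e z.2 then
    C * ((z.2 + t₀) ^ a)⁻¹ * (z.2 + t₀)⁻¹ *
      (-a * (e z.2 - Φ ‖z.1‖) ^ b + b * ((z.2 + t₀) * e' z.2) * (e z.2 - Φ ‖z.1‖) ^ (b - 1))
  else 0

theorem hasDerivAt_radialBarrier (h : IsBarrierData N p m g C t₀ a b Φ φ ψ' e e') {t : ℝ}
    (ht : 0 ≤ t) {x : Space N} (hx : e t ≠ Φ ‖x‖) :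
    HasDerivAt (fun t => radialBarrier C t₀ a b Φ e (x, t)) (timeDeriv C t₀ a b Φ e e' (x, t)) t := by
  have he := h.hasDerivAt_level t ht
  have hT : 0 < t + t₀ := add_pos_of_nonneg_of_pos ht h.t₀_pos
  rcases hx.lt_or_gt with h1 | h1
  · rw [timeDeriv, if_neg (not_lt.2 h1.le)]
    refine (hasDerivAt_const t (0 : ℝ)).congr_of_eventuallyEq ?_
    filter_upwards [he.continuousAt.eventually (Iio_mem_nhds h1)] with s hs
    have hs : e s < Φ ‖x‖ := hs
    rw [radialBarrier, max_eq_left (sub_nonpos.2 hs.le), Real.zero_rpow h.b_pos.ne', mul_zero]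
  · rw [timeDeriv, if_pos h1]
    have hW := sub_pos.2 h1
    have h2 : HasDerivAt (fun s => C * (s + t₀) ^ (-a)) _ t :=
      (((hasDerivAt_id t).add_const t₀).rpow_const (p := -a) (Or.inl hT.ne')).const_mul C
    have h3 := h2.mul ((he.sub_const (Φ ‖x‖)).rpow_const (p := b) (Or.inl hW.ne'))
    refine (h3.congr_of_eventuallyEq ?_).congr_deriv ?_
    · filter_upwards [he.continuousAt.eventually (Ioi_mem_nhds h1),
        Ioi_mem_nhds (show -t₀ < t by linarith)] with s hs hs'
      have hs : Φ ‖x‖ < e s := hs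
      have hs' : -t₀ < s := hs'
      simp only [radialBarrier, Pi.mul_apply]
      rw [max_eq_right (sub_pos.2 hs).le, Real.rpow_neg (by linarith), div_eq_mul_inv]
    · simp only [id]
      rw [Real.rpow_sub_one hT.ne' (-a), Real.rpow_neg hT.le]
      field_simp

theorem exists_norm_timeDeriv_le (h : IsBarrierData N p m g C t₀ a b Φ φ ψ' e e') {t₁ t₂ : ℝ}
    (ht₁ : 0 < t₁) (h12 : t₁ ≤ t₂) : ∃ c₁ c₂, 0 ≤ c₁ ∧ 0 ≤ c₂ ∧ ∀ t ∈ Icc t₁ t₂, ∀ x : Space N,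
      ‖timeDeriv C t₀ a b Φ e e' (x, t)‖ ≤
        c₁ + c₂ * (if Φ ‖x‖ < e t then (e t - Φ ‖x‖) ^ (b - 1) else 0) := by
  have hC := h.C_pos
  have ha := h.a_pos
  have hb := h.b_pos
  have hsub : Icc t₁ t₂ ⊆ Ici 0 := fun t ht => ht₁.le.trans ht.1
  have hT : ∀ t ∈ Icc t₁ t₂, 0 < t + t₀ := fun t ht =>
    add_pos_of_nonneg_of_pos (hsub ht) h.t₀_pos
  have hamp : ContinuousOn (fun t => C * ((t + t₀) ^ a)⁻¹ * (t + t₀)⁻¹) (Icc t₁ t₂) := by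
    refine (continuousOn_const.mul (((continuousOn_id.add continuousOn_const).rpow_const
      fun t ht => Or.inl (hT t ht).ne').inv₀ fun t ht => (Real.rpow_pos_of_pos (hT t ht) _).ne')).mul
      ((continuousOn_id.add continuousOn_const).inv₀ fun t ht => (hT t ht).ne')
  obtain ⟨M₁, hM₁⟩ := isCompact_Icc.exists_bound_of_continuousOn
    (hamp.mul (continuousOn_const.mul
      ((h.continuousOn_level.mono hsub).rpow_const (p := b) fun _ _ => Or.inr hb.le)) (f := fun t =>
      C * ((t + t₀) ^ a)⁻¹ * (t + t₀)⁻¹) (g := fun t => a * e t ^ b))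
  obtain ⟨M₂, hM₂⟩ := isCompact_Icc.exists_bound_of_continuousOn
    (hamp.mul (continuousOn_const.mul ((continuousOn_id.add continuousOn_const).mul
      (h.continuousOn_level'.mono hsub))) (f := fun t =>
      C * ((t + t₀) ^ a)⁻¹ * (t + t₀)⁻¹) (g := fun t => b * ((t + t₀) * e' t)))
  refine ⟨M₁, M₂, (norm_nonneg _).trans (hM₁ t₁ (left_mem_Icc.2 h12)),
    (norm_nonneg _).trans (hM₂ t₁ (left_mem_Icc.2 h12)), fun t ht x => ?_⟩
  have hM₁0 : 0 ≤ M₁ := (norm_nonneg _).trans (hM₁ t ht)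
  have hTt := hT t ht
  have he' := h.level'_pos t (hsub ht)
  have het := h.level_pos (hsub ht)
  rw [timeDeriv]
  simp only
  split_ifs with hx
  · have hW := sub_pos.2 hx
    rw [mul_add]
    refine (norm_add_le _ _).trans (add_le_add ?_ ?_)
    · refine le_trans ?_ ((le_abs_self _).trans (hM₁ t ht))
      rw [neg_mul, mul_neg, norm_neg, Real.norm_of_nonneg (by positivity)]
      have : (e t - Φ ‖x‖) ^ b ≤ e t ^ b :=
        Real.rpow_le_rpow hW.le (by linarith [h.shape_norm_nonneg x]) hb.le
      simp only [Pi.mul_apply]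
      gcongr
    · have := hM₂ t ht
      rw [← mul_assoc, norm_mul, Real.norm_of_nonneg (by positivity : 0 ≤ (e t - Φ ‖x‖) ^ (b - 1))]
      exact mul_le_mul_of_nonneg_right this (by positivity)
  · simpa using hM₁0

theorem aestronglyMeasurable_timeDeriv (h : IsBarrierData N p m g C t₀ a b Φ φ ψ' e e') :
    AEStronglyMeasurable (timeDeriv (N := N) C t₀ a b Φ e e') (volume.restrict (spaceTime N)) := by
  set O : Set (Space N × ℝ) := {z ∈ spaceTime N | Φ ‖z.1‖ < e z.2} with hO
  have hOo : IsOpen O := by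
    have := (h.continuousOn_gap.mono spaceTime_subset).isOpen_inter_preimage isOpen_spaceTime
      (isOpen_Ioi (a := (0 : ℝ)))
    convert this using 1
    ext z
    simp [hO]
  have hsub : O ⊆ univ ×ˢ Ici 0 := fun z hz => spaceTime_subset hz.1
  have hT : ∀ z ∈ O, 0 < z.2 + t₀ := fun z hz => add_pos_of_nonneg_of_pos (hsub hz).2 h.t₀_pos
  have hc : ContinuousOn (timeDeriv (N := N) C t₀ a b Φ e e') O := by
    have hTc : ContinuousOn (fun z : Space N × ℝ => z.2 + t₀) O := by fun_prop
    have hgap := h.continuousOn_gap.mono hsub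
    have h0 : ∀ z ∈ O, e z.2 - Φ ‖z.1‖ ≠ 0 := fun z hz => (sub_pos.2 hz.2).ne'
    refine ContinuousOn.congr (f := fun z : Space N × ℝ => C * ((z.2 + t₀) ^ a)⁻¹ * (z.2 + t₀)⁻¹ *
      (-a * (e z.2 - Φ ‖z.1‖) ^ b + b * ((z.2 + t₀) * e' z.2) * (e z.2 - Φ ‖z.1‖) ^ (b - 1))) ?_
      fun z hz => if_pos hz.2
    refine ((continuousOn_const.mul ((hTc.rpow_const fun z hz => Or.inl (hT z hz).ne').inv₀
      fun z hz => (Real.rpow_pos_of_pos (hT z hz) _).ne')).mul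
      (hTc.inv₀ fun z hz => (hT z hz).ne')).mul ((continuousOn_const.mul (hgap.rpow_const
        fun z hz => Or.inl (h0 z hz))).add ((continuousOn_const.mul (hTc.mul
        (h.continuousOn_level'.comp continuousOn_snd fun z hz => (hsub hz).2))).mul
        (hgap.rpow_const fun z hz => Or.inl (h0 z hz))))
  have hm := (aestronglyMeasurable_indicator_iff (μ := volume.restrict (spaceTime N))
    hOo.measurableSet).2 ((hc.aestronglyMeasurable (μ := volume) hOo.measurableSet).mono_measure
      (Measure.restrict_mono_measure Measure.restrict_le_self _))
  refine hm.congr ?_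
  filter_upwards [ae_restrict_mem measurableSet_spaceTime] with z hz
  by_cases hzO : z ∈ O
  · rw [indicator_of_mem hzO]
  · rw [indicator_of_notMem hzO, timeDeriv, if_neg fun hlt => hzO ⟨hz, hlt⟩]

/-- For b < 1 the time derivative blows up at the front, so there is no pointwise bound. Between t₁
and t₂ the levels lie in a compact range, over which the integral of W^{b-1} is uniformly bounded.
-/
theorem timeDeriv_bound (h : IsBarrierData N p m g C t₀ a b Φ φ ψ' e e')
    (K : Set (Space N)) (hK : IsCompact K) (t₁ t₂ : ℝ) (ht₁ : 0 < t₁) : ∃ D : ℝ,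
      ∀ᵐ t ∂(volume.restrict (Icc t₁ t₂)),
        ∫⁻ x in K, ‖timeDeriv C t₀ a b Φ e e' (x, t)‖ₑ ∂(weightMeasure N g) ≤ ENNReal.ofReal D := by
  rcases lt_or_ge t₂ t₁ with h21 | h12
  · refine ⟨0, ?_⟩
    rw [Icc_eq_empty (not_le.2 h21)]
    simp
  have : NeZero N := ⟨by have := h.two_le_dim; omega⟩
  obtain ⟨c₁, c₂, hc₁, hc₂, hc⟩ := h.exists_norm_timeDeriv_le (N := N) ht₁ h12
  have het₁ : Φ 0 < e t₁ :=
    h.level_zero.trans_le (h.level_strictMono.monotoneOn self_mem_Ici ht₁.le ht₁.le)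
  -- A radius that the front has passed by time t₁; it separates the zero of the slope at the origin
  -- from the singularity at the front.
  obtain ⟨δ, hδ0, hδ⟩ : ∃ δ, 0 < δ ∧ Φ δ < e t₁ := by
    have h1 := (h.continuousOn_shape 0 self_mem_Ici).eventually (Iio_mem_nhds het₁)
    have h2 : ∀ᶠ r in 𝓝[>] (0 : ℝ), Φ r < e t₁ :=
      h1.filter_mono (nhdsWithin_mono _ Ioi_subset_Ici_self)
    obtain ⟨δ, h3, h4⟩ := (h2.and self_mem_nhdsWithin).exists
    exact ⟨δ, h4, h3⟩
  have h12e := h.level_strictMono.monotoneOn ht₁.le (ht₁.le.trans h12) h12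
  obtain ⟨ρ, hρ0, hρ⟩ := h.shape_top t₂ (ht₁.le.trans h12)
  have hδρ : δ < ρ := (h.shape_mono.lt_iff_lt hδ0.le hρ0.le).1 (by linarith)
  obtain ⟨D, hD⟩ := exists_lintegral_rpow_sub_bound (N := N) h.b_pos h.continuousOn_shape
    h.hasDerivAt_shape h.shape_mono h.slope_pos h.continuousOn_slope hδ0 hδρ hδ hρ
  obtain ⟨F, hF⟩ := hK.exists_bound_of_continuousOn
    (continuous_weight (N := N) h.continuousOn_g).continuousOn
  obtain ⟨Q, hQ⟩ : ∃ Q, Q = ENNReal.ofReal F * (ENNReal.ofReal c₁ * volume K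
    + ENNReal.ofReal c₂ * ENNReal.ofReal D) := ⟨_, rfl⟩
  have hQt : Q ≠ ⊤ := by
    rw [hQ]
    exact ENNReal.mul_ne_top (by simp) (ENNReal.add_ne_top.2
      ⟨ENNReal.mul_ne_top (by simp) hK.measure_lt_top.ne, ENNReal.mul_ne_top (by simp) (by simp)⟩)
  refine ⟨Q.toReal, (ae_restrict_mem measurableSet_Icc).mono fun t ht => ?_⟩
  rw [ENNReal.ofReal_toReal hQt, hQ]
  have hmw : Measurable fun x : Space N => ENNReal.ofReal (weight g x) :=
    (continuous_weight h.continuousOn_g).measurable.ennreal_ofReal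
  have ht0 : 0 ≤ t := ht₁.le.trans ht.1
  rw [weightMeasure, restrict_withDensity hK.measurableSet,
    lintegral_withDensity_eq_lintegral_mul_non_measurable _ hmw (by simp)]
  have hgapm : Measurable fun x : Space N => Φ ‖x‖ := h.continuous_shape_norm.measurable
  have hmf : Measurable fun x : Space N =>
      ENNReal.ofReal (if Φ ‖x‖ < e t then (e t - Φ ‖x‖) ^ (b - 1) else 0) :=
    (Measurable.ite (measurableSet_lt hgapm measurable_const)
      ((measurable_const.sub hgapm).pow_const _) measurable_const).ennreal_ofReal
  simp only [Pi.mul_apply]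
  calc ∫⁻ x in K, ENNReal.ofReal (weight g x) * ‖timeDeriv C t₀ a b Φ e e' (x, t)‖ₑ
      ≤ ∫⁻ x in K, ENNReal.ofReal F * (ENNReal.ofReal c₁ + ENNReal.ofReal c₂ *
          ENNReal.ofReal (if Φ ‖x‖ < e t then (e t - Φ ‖x‖) ^ (b - 1) else 0)) := by
        refine lintegral_mono_ae ?_
        filter_upwards [ae_restrict_mem hK.measurableSet] with x hx
        refine mul_le_mul' (ENNReal.ofReal_le_ofReal ((le_abs_self _).trans (hF x hx))) ?_
        rw [← ofReal_norm, ← ENNReal.ofReal_mul hc₂]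
        refine (ENNReal.ofReal_le_ofReal (hc t ht x)).trans ENNReal.ofReal_add_le
    _ = ENNReal.ofReal F * (ENNReal.ofReal c₁ * volume K + ENNReal.ofReal c₂ *
          ∫⁻ x in K, ENNReal.ofReal (if Φ ‖x‖ < e t then (e t - Φ ‖x‖) ^ (b - 1) else 0)) := by
        rw [lintegral_const_mul' _ _ (by simp), lintegral_add_left measurable_const,
          lintegral_const_mul' _ _ (by simp), setLIntegral_const]
    _ ≤ _ := by
        gcongr
        exact (setLIntegral_le_lintegral _ _).trans (hD _
          (h.level_strictMono.monotoneOn ht₁.le ht0 ht.1)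
          (h.level_strictMono.monotoneOn ht0 (ht0.trans ht.2) ht.2))

theorem locallyIntegrableOn_barrierTimeDeriv (h : IsBarrierData N p m g C t₀ a b Φ φ ψ' e e') :
    LocallyIntegrableOn (timeDeriv (N := N) C t₀ a b Φ e e') (spaceTime N) :=
  locallyIntegrableOn_timeDeriv h.g_nonneg h.aestronglyMeasurable_timeDeriv h.timeDeriv_bound

/-- For fixed x the barrier is continuous in time and differentiable except when the front crosses
|x|. The level is strictly increasing, so this happens at most once, and the fundamental theorem
tolerates the exception. -/
theorem integral_radialBarrier_mul_derivT (h : IsBarrierData N p m g C t₀ a b Φ φ ψ' e e')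
    {η : Space N × ℝ → ℝ} (hη : IsTest η) :
    ∫ z in spaceTime N, radialBarrier C t₀ a b Φ e z * derivT η z
      = -∫ z in spaceTime N, timeDeriv C t₀ a b Φ e e' z * η z := by
  have hU : LocallyIntegrableOn (radialBarrier (N := N) C t₀ a b Φ e) (spaceTime N) :=
    (h.continuousOn_radialBarrier.mono spaceTime_subset).locallyIntegrableOn measurableSet_spaceTime
  have i1 := hη.integrableOn_mul hU hη.continuous_derivT fun z hz => hη.derivT_eq_zero hz
  have i2 := hη.integrableOn_mul h.locallyIntegrableOn_barrierTimeDeriv hη.smooth.continuous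
    fun z hz => hη.eq_zero hz
  have i3 : IntegrableOn (fun z => radialBarrier C t₀ a b Φ e z * derivT η z
    + timeDeriv C t₀ a b Φ e e' z * η z) (spaceTime N) := i1.add i2
  rw [← add_eq_zero_iff_eq_neg, ← integral_add i1 i2]
  rw [IntegrableOn, volume_restrict_spaceTime] at i3
  rw [volume_restrict_spaceTime, integral_prod _ i3]
  refine integral_eq_zero_of_ae ?_
  filter_upwards [i3.prod_right_ae] with x hx
  obtain ⟨S, hS⟩ := (hη.compact.isCompact.image continuous_snd).isBounded.subset_closedBall 0
  have hzero : ∀ s, |S| < s → η (x, s) = 0 ∧ derivT η (x, s) = 0 := fun s hs => by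
    have hn : (x, s) ∉ tsupport η := fun hz => by
      have := hS ⟨_, hz, rfl⟩
      rw [mem_closedBall_zero_iff, Real.norm_eq_abs] at this
      linarith [le_abs_self s, le_abs_self S]
    exact ⟨hη.eq_zero hn, hη.derivT_eq_zero hn⟩
  have hS0 : 0 ≤ |S| + 1 := by positivity
  have hcut : ∫ t in Ioi (0 : ℝ), (radialBarrier C t₀ a b Φ e (x, t) * derivT η (x, t)
      + timeDeriv C t₀ a b Φ e e' (x, t) * η (x, t)) =
      ∫ t in (0 : ℝ)..(|S| + 1), (radialBarrier C t₀ a b Φ e (x, t) * derivT η (x, t)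
      + timeDeriv C t₀ a b Φ e e' (x, t) * η (x, t)) := by
    rw [intervalIntegral.integral_of_le hS0]
    refine (setIntegral_eq_of_subset_of_forall_sdiff_eq_zero measurableSet_Ioi
      Ioc_subset_Ioi_self fun t ht => ?_)
    have ht' : |S| < t := by
      by_contra hc
      exact ht.2 ⟨ht.1, by linarith [not_lt.1 hc]⟩
    simp [hzero t ht']
  rw [hcut, Pi.zero_apply]
  have hset : ({t | 0 ≤ t ∧ e t = Φ ‖x‖} : Set ℝ).Countable :=
    Set.Subsingleton.countable fun s hs t ht =>
      h.level_strictMono.injOn hs.1 ht.1 (hs.2.trans ht.2.symm)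
  rw [integral_eq_of_hasDerivAt_off_countable_of_le
    (fun t => radialBarrier C t₀ a b Φ e (x, t) * η (x, t)) _ hS0 hset]
  · rw [(hzero (|S| + 1) (by linarith)).1,
      hη.eq_zero (z := (x, 0)) fun hz => lt_irrefl (0 : ℝ) (hη.supp hz).2]
    simp
  · refine ContinuousOn.mul (h.continuousOn_radialBarrier.comp (by fun_prop)
      fun t ht => ⟨mem_univ _, ht.1⟩) ?_
    exact (hη.smooth.continuous.comp (by fun_prop)).continuousOn
  · intro t ht
    have ht0 : 0 ≤ t := ht.1.1.le
    have h1 := h.hasDerivAt_radialBarrier ht0 (x := x) fun he => ht.2 ⟨ht0, he⟩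
    have h2 : HasDerivAt (fun s => η (x, s)) (derivT η (x, t)) t :=
      ((hη.differentiable.comp (by fun_prop : Differentiable ℝ fun s : ℝ => (x, s))) t).hasDerivAt
    exact (h1.mul h2).congr_deriv (by ring)
  · rw [intervalIntegrable_iff_integrableOn_Ioc_of_le hS0]
    exact IntegrableOn.mono_set (t := Ioi 0) hx Ioc_subset_Ioi_self

theorem hasStrongTimeDeriv (h : IsBarrierData N p m g C t₀ a b Φ φ ψ' e e') :
    HasStrongTimeDeriv g (radialBarrier (N := N) C t₀ a b Φ e) :=
  ⟨_, h.aestronglyMeasurable_timeDeriv, h.timeDeriv_bound, fun _ hη =>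
    h.integral_radialBarrier_mul_derivT hη⟩

end IsBarrierData

end

section

/-! ### The barrier is a strong subsolution -/

variable {N : ℕ}

namespace IsBarrierData

variable {p m C t₀ a b : ℝ} {g Φ φ ψ' e e' : ℝ → ℝ}

/-- The radial component of minus the weighted flux of `radialBarrier`, up to a factor that
depends on time. -/
def radialFlux (p b : ℝ) (g Φ φ : ℝ → ℝ) (E r : ℝ) : ℝ :=
  (max 0 (E - Φ r)) ^ b * φ r ^ (p - 1) * Real.exp (g r)

theorem continuousOn_radialFlux (h : IsBarrierData N p m g C t₀ a b Φ φ ψ' e e') (E : ℝ) :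
    ContinuousOn (radialFlux p b g Φ φ E) (Ici 0) := by
  have : 0 ≤ p - 1 := by linarith [h.one_lt_p]
  exact (((continuousOn_const.sup (continuousOn_const.sub h.continuousOn_shape)).rpow_const
    fun _ _ => Or.inr h.b_pos.le).mul (h.continuousOn_slope.rpow_const fun _ _ => Or.inr this)).mul
    h.continuousOn_g.rexp

/-- At the front the left derivative may be infinite if b < 1. From the right the flux is
identically zero, so the right derivative exists at every positive radius. -/
theorem hasDerivWithinAt_radialFlux (h : IsBarrierData N p m g C t₀ a b Φ φ ψ' e e') (E : ℝ)
    {r : ℝ} (hr : 0 < r) : HasDerivWithinAt (radialFlux p b g Φ φ E)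
      (if Φ r < E then Real.exp (g r) * (E - Φ r) ^ (b - 1) *
        ((E - Φ r) * (ψ' r + deriv g r * φ r ^ (p - 1)) - b * φ r ^ p) else 0) (Ioi r) r := by
  split_ifs with hE
  · have hW := sub_pos.2 hE
    have h1 := (((h.hasDerivAt_shape r hr).const_sub E).rpow_const (p := b)
      (Or.inl hW.ne')).hasDerivWithinAt (s := Ioi r)
    have h2 := (h1.mul (h.hasDerivWithinAt_slope r hr)).mul
      (h.hasDerivAt_g r hr).exp.hasDerivWithinAt
    have hev : ∀ᶠ s in 𝓝 r, radialFlux p b g Φ φ E s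
        = (E - Φ s) ^ b * φ s ^ (p - 1) * Real.exp (g s) := by
      filter_upwards [(h.hasDerivAt_shape r hr).continuousAt.eventually (Iio_mem_nhds hE)] with s hs
      rw [radialFlux, max_eq_right (sub_pos.2 hs).le]
    refine (h2.congr_of_eventuallyEq (hev.filter_mono nhdsWithin_le_nhds)
      hev.self_of_nhds).congr_deriv ?_
    have hφ := h.slope_pos r hr
    have e1 : φ r ^ p = φ r * φ r ^ (p - 1) := by
      rw [Real.rpow_sub_one hφ.ne', mul_div_cancel₀ _ hφ.ne']
    have e2 : (E - Φ r) ^ b = (E - Φ r) * (E - Φ r) ^ (b - 1) := by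
      rw [Real.rpow_sub_one hW.ne', mul_div_cancel₀ _ hW.ne']
    simp only [Pi.mul_apply]
    rw [e1, e2]
    ring
  · have hz : ∀ s, r ≤ s → radialFlux p b g Φ φ E s = 0 := fun s hs => by
      have := h.shape_mono.monotoneOn hr.le (hr.le.trans hs) hs
      rw [radialFlux, max_eq_left (by linarith), Real.zero_rpow h.b_pos.ne', zero_mul, zero_mul]
    exact (hasDerivWithinAt_const r (Ioi r) (0 : ℝ)).congr (fun s hs => hz s (le_of_lt hs))
      (hz r le_rfl)

/-- Fubini reduces the claim to almost every time, where the weighted flux is a radial field. On the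
support the differential inequality is `ineq` multiplied by a nonnegative factor containing e^g
W^{b-1}; off the support every term vanishes. -/
theorem weakForm_nonpos (h : IsBarrierData N p m g C t₀ a b Φ φ ψ' e e')
    {η : Space N × ℝ → ℝ} (hη : IsTest η) (hη0 : ∀ z, 0 ≤ η z) :
    weakForm p m g (radialBarrier C t₀ a b Φ e) (powGradient p m C t₀ a Φ φ e) η ≤ 0 := by
  have hp := h.one_lt_p
  have hq := gradExponent_pos hp h.pm_pos
  have hf : Continuous (weight g : Space N → ℝ) := continuous_weight h.continuousOn_g
  have hV := h.memLpLoc_powGradient (N := N)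
  have hpq := Real.HolderConjugate.conjExponent hp
  rw [weakForm_eq hp hq h.continuousOn_g hV
    ((h.continuousOn_radialBarrier.mono spaceTime_subset).locallyIntegrableOn
      measurableSet_spaceTime) h.locallyIntegrableOn_barrierTimeDeriv
    (fun _ => h.integral_radialBarrier_mul_derivT) hη]
  have i1 : IntegrableOn (fun z => timeDeriv C t₀ a b Φ e e' z * (η z * weight g z.1))
      (spaceTime N) :=
    hη.integrableOn_mul h.locallyIntegrableOn_barrierTimeDeriv
      (hη.smooth.continuous.mul (hf.comp continuous_fst)) fun z hz => by simp [hη.eq_zero hz]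
  have i2 := integrableOn_inner_gradX hpq.symm.lt.le (hV.flux hp hq) hf hη
  have i3 : IntegrableOn (fun z => timeDeriv C t₀ a b Φ e e' z * (η z * weight g z.1)
    + inner ℝ (flux p m (powGradient p m C t₀ a Φ φ e z)) (gradX η z) * weight g z.1)
    (spaceTime N) := i1.add i2
  rw [← integral_add i1 i2]
  rw [IntegrableOn, volume_restrict_spaceTime] at i3
  rw [volume_restrict_spaceTime, integral_prod_symm _ i3]
  refine integral_nonpos_of_ae ?_
  filter_upwards [ae_restrict_mem measurableSet_Ioi, i3.prod_left_ae] with t ht hi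
  have ht0 : 0 < t := ht
  have hT : 0 < t + t₀ := add_pos ht0 h.t₀_pos
  have hC := h.C_pos
  obtain ⟨A, hA⟩ : ∃ A, A = C * ((t + t₀) ^ a)⁻¹ * (t + t₀)⁻¹ := ⟨_, rfl⟩
  obtain ⟨S, hS⟩ : ∃ S, S = b ^ (p - 1) * C ^ (p + m - 3) := ⟨_, rfl⟩
  have hA0 : 0 < A := by rw [hA]; positivity
  have hEq : ∀ x : Space N, timeDeriv C t₀ a b Φ e e' (x, t) * (η (x, t) * weight g x)
      + inner ℝ (flux p m (powGradient p m C t₀ a Φ φ e (x, t))) (gradX η (x, t)) * weight g x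
      = timeDeriv C t₀ a b Φ e e' (x, t) * weight g x * η (x, t)
        - S * A * radialFlux p b g Φ φ (e t) ‖x‖ *
          (‖x‖⁻¹ * fderiv ℝ (fun x => η (x, t)) x x) := fun x => by
    rw [h.flux_powGradient ht0.le, (gradX_slice hη t x).fderiv, innerSL_apply_apply, inner_smul_left,
      inner_smul_left, real_inner_comm, hS, hA, radialFlux, weight]
    simp only [conj_trivial]
    ring
  simp only [hEq, Pi.zero_apply] at hi ⊢
  have hζ : ContDiff ℝ 1 fun x => η (x, t) :=
    (hη.smooth.comp (contDiff_id.prodMk contDiff_const)).of_le (by simp)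
  refine integral_radial_field_nonpos h.two_le_dim
    (k := fun r => S * A * radialFlux p b g Φ φ (e t) r)
    (continuousOn_const.mul (h.continuousOn_radialFlux (e t)))
    (fun r hr => (h.hasDerivWithinAt_radialFlux (e t) hr).const_mul (S * A)) (fun x hx => ?_) hζ
    (hasCompactSupport_slice hη t) (fun x => hη0 _) hi
  have hr : 0 < ‖x‖ := norm_pos_iff.2 hx
  simp only [timeDeriv]
  split_ifs with hE
  · have hW := sub_pos.2 hE
    have key := h.ineq t ht0 ‖x‖ hr hE
    have e2 : (e t - Φ ‖x‖) ^ b = (e t - Φ ‖x‖) * (e t - Φ ‖x‖) ^ (b - 1) := by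
      rw [Real.rpow_sub_one hW.ne', mul_div_cancel₀ _ hW.ne']
    rw [radialFlux, max_eq_right hW.le, weight, ← hA, e2]
    rw [← hS] at key
    have hfac : 0 ≤ A * Real.exp (g ‖x‖) * (e t - Φ ‖x‖) ^ (b - 1) := by positivity
    refine le_trans (le_of_eq ?_) (mul_nonpos_of_nonneg_of_nonpos hfac key)
    ring
  · rw [radialFlux, max_eq_left (sub_nonpos.2 (not_lt.1 hE)), Real.zero_rpow h.b_pos.ne']
    simp

theorem isStrongSubsolution (h : IsBarrierData N p m g C t₀ a b Φ φ ψ' e e') :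
    IsStrongSubsolution p m g (radialBarrier (N := N) C t₀ a b Φ e) :=
  ⟨⟨h.isAdmissible, _, h.isWeakGradX, h.memLpLoc_powGradient, fun _ => h.weakForm_nonpos⟩,
    h.hasStrongTimeDeriv⟩

end IsBarrierData

end

section

/-! ### Choice of the constants -/

variable {N : ℕ}

namespace IsPowerlike

variable {g : ℝ → ℝ} {α₁ α₂ p m : ℝ}

theorem shape_zero_nonneg {r₀ : ℝ} (hp : 1 < p) (hg : IsPowerlike g α₁ α₂) (h₁ : 0 < α₁)
    (h₀ : 0 < r₀) : 0 ≤ shape p g r₀ 0 := by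
  have hp1 : p - 1 ≠ 0 := by linarith
  have hG := hg.bigG_pos h₁ h₀
  have hgr := hg.pos r₀ h₀
  rw [shape, if_neg (not_le.2 h₀), bigI, Real.zero_rpow (by linarith), zero_div,
    Real.zero_rpow (by positivity), mul_zero, zero_add, sub_sub_cancel, bigJ]
  positivity

/-- The order of choices matters: r₀ = ℓ/2 fixes the shape and its bound M, then C is taken small
against M and ε, then Γ small against C, and t₀ comes last. -/
theorem exists_barrierData (hp : 1 < p) (hpN : p < N) (hpm : 0 < p + m - 3)
    (hg : IsPowerlike g α₁ α₂) (h₁ : 0 < α₁) (h₂ : α₂ < p) {ε ℓ : ℝ} (hε : 0 < ε) (hℓ : 0 < ℓ) :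
    ∃ C Γ, 0 < C ∧ 0 < Γ ∧
      C * shape p g (ℓ / 2) ℓ ^ ((p - 1) / (p + m - 3)) ≤ ε ∧
      ∃ e', IsBarrierData N p m g C (Real.exp (bigG g ℓ / Γ)) (1 / (p + m - 3))
        ((p - 1) / (p + m - 3)) (shape p g (ℓ / 2)) (shapeSlope p g (ℓ / 2))
        (shapeFluxDeriv p g (ℓ / 2))
        (fun t => bigE p g (Γ * Real.log (t + Real.exp (bigG g ℓ / Γ))) ^ (1 / (p - 1))) e' := by
  have hp1 : 0 < p - 1 := by linarith
  have h₀ : 0 < ℓ / 2 := by positivity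
  have hlt : ℓ / 2 < ℓ := by linarith
  obtain ⟨r₀, hr₀⟩ : ∃ r₀, r₀ = ℓ / 2 := ⟨_, rfl⟩
  rw [← hr₀] at h₀ hlt ⊢
  obtain ⟨a, ha⟩ : ∃ a, a = 1 / (p + m - 3) := ⟨_, rfl⟩
  obtain ⟨b, hb⟩ : ∃ b, b = (p - 1) / (p + m - 3) := ⟨_, rfl⟩
  rw [← ha, ← hb]
  have ha0 : 0 < a := by rw [ha]; positivity
  have hb0 : 0 < b := by rw [hb]; positivity
  have hN1 : (1 : ℝ) < N := hp.trans hpN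
  obtain ⟨M, hM0, hM⟩ := exists_shapeFlux_bound hp h₂ hg h₁ h₀ (k := (N : ℝ) - 1) (by linarith)
  have hΦℓ := shape_pos hp hg h₁ h₀ hlt.le
  -- The largest admissible value of C^{p+m-3}: with it the bracket costs half of the decay term. As
  -- a(p+m-3) = 1, the condition on C itself is C ≤ X^a.
  obtain ⟨X, hX⟩ : ∃ X, X = a / (2 * M * b ^ (p - 1)) := ⟨_, rfl⟩
  have hX0 : 0 < X := by rw [hX]; positivity
  obtain ⟨C, hC⟩ : ∃ C, C = min (X ^ a) (ε / shape p g r₀ ℓ ^ b) := ⟨_, rfl⟩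
  have hC0 : 0 < C := by rw [hC]; positivity
  obtain ⟨S, hS⟩ : ∃ S, S = b ^ (p - 1) * C ^ (p + m - 3) := ⟨_, rfl⟩
  have hS0 : 0 < S := by rw [hS]; positivity
  have hSM : S * M ≤ a / 2 := by
    have h1 : C ^ (p + m - 3) ≤ X := by
      calc C ^ (p + m - 3) ≤ (X ^ a) ^ (p + m - 3) :=
            Real.rpow_le_rpow hC0.le (hC ▸ min_le_left _ _) hpm.le
        _ = X := by rw [← Real.rpow_mul hX0.le, ha, one_div_mul_cancel hpm.ne', Real.rpow_one]
    calc S * M ≤ b ^ (p - 1) * X * M := by rw [hS]; gcongr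
      _ = a / 2 := by rw [hX]; field_simp
  obtain ⟨Γ, hΓ, hspeed⟩ := exists_front_speed hp h₂ hg h₁ h₀ hlt ha0 hb0 hS0
  obtain ⟨t₀, ht₀⟩ : ∃ t₀, t₀ = Real.exp (bigG g ℓ / Γ) := ⟨_, rfl⟩
  have hlevel : ∀ t, 0 ≤ t → bigE p g (Γ * Real.log (t + t₀)) ^ (1 / (p - 1))
      = shape p g r₀ (radialInv (bigG g) (Γ * Real.log (t + t₀))) := fun t ht =>
    bigE_rpow_eq_shape (hlt.le.trans (hg.le_radialInv_log h₁ hℓ hΓ ht₀ ht).2)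
  have hR : ∀ t, 0 ≤ t → ℓ ≤ radialInv (bigG g) (Γ * Real.log (t + t₀)) := fun t ht =>
    (hg.le_radialInv_log h₁ hℓ hΓ ht₀ ht).2
  have ht₀0 : 0 < t₀ := by rw [ht₀]; positivity
  refine ⟨C, Γ, hC0, hΓ, ?_, fun t => Γ * (shapeSlope p g r₀ (radialInv (bigG g)
    (Γ * Real.log (t + t₀))) * (radialInv (bigG g) (Γ * Real.log (t + t₀)) /
      g (radialInv (bigG g) (Γ * Real.log (t + t₀))))) / (t + t₀), ?_⟩
  · rw [← le_div_iff₀ (by positivity)]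
    exact hC ▸ min_le_right _ _
  rw [← ht₀]
  exact {
    one_lt_p := hp
    two_le_dim := by exact_mod_cast hN1
    pm_pos := hpm
    a_eq := ha
    b_eq := hb
    C_pos := hC0
    t₀_pos := ht₀0
    continuousOn_g := hg.continuousOn
    g_nonneg := fun s hs => hg.nonneg hs
    hasDerivAt_g := fun s hs => hg.hasDerivAt hs
    hasDerivAt_shape := fun r hr => hasDerivAt_shape hp hg h₁ h₀ hr
    shape_flat := hasDerivWithinAt_shape_zero hp hg h₁ h₀
    shape_mono := strictMonoOn_shape hp h₂ hg h₁ h₀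
    shape_top := fun t ht => ⟨_, hℓ.trans_le (hR t ht), (hlevel t ht).le⟩
    shape_nonneg := shape_zero_nonneg hp hg h₁ h₀
    continuousOn_slope := continuousOn_shapeSlope hp hg h₁ h₀
    slope_zero := shapeSlope_zero hp
    slope_pos := fun r hr => shapeSlope_pos hp h₂ hg h₁ h₀ hr
    hasDerivWithinAt_slope := fun r hr => hasDerivWithinAt_shapeSlope_rpow hp h₂ hg h₁ h₀ hr
    hasDerivAt_level := fun t ht => hasDerivAt_front hp hg h₁ h₀ hlt hΓ ht₀ ht
    continuousOn_level' := continuousOn_deriv_front hp hg h₁ h₀ hlt hΓ ht₀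
    level'_pos := fun t ht => by
      have hR0 := hℓ.trans_le (hR t ht)
      have := shapeSlope_pos hp h₂ hg h₁ h₀ hR0
      have := hg.pos _ hR0
      positivity
    level_zero := by
      rw [hlevel 0 le_rfl]
      have hR0 := hℓ.trans_le (hR 0 le_rfl)
      exact strictMonoOn_shape hp h₂ hg h₁ h₀ self_mem_Ici hR0.le hR0
    level_bound := by
      obtain ⟨B, hB⟩ := hg.exists_front_bound hp h₁ hℓ hΓ ht₀
      refine ⟨B, fun t ht => ?_⟩
      have hτ := (hg.bigG_pos h₁ hℓ).trans_le (hg.le_radialInv_log h₁ hℓ hΓ ht₀ ht).1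
      have hE : 0 ≤ bigE p g (Γ * Real.log (t + t₀)) := by
        have hR0 := hℓ.trans_le (hR t ht)
        have := hg.bigG_pos h₁ hR0
        rw [bigE, bigJ]
        positivity
      rw [← Real.rpow_mul hE, one_div_mul_cancel hp1.ne', Real.rpow_one]
      exact hB t ht
    ineq := fun t ht r hr hrt => by
      rw [hlevel t ht.le] at hrt ⊢
      have hT : t + t₀ ≠ 0 := by positivity
      have h3 := hspeed _ (hR t ht.le) r hr hrt
      rw [mul_div_cancel₀ _ hT, ← hS]
      have hW := sub_pos.2 hrt
      -- The bracket uses at most half of the decay aW. The other half, together with the diffusion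
      -- term, covers the front term by `h3`.
      have h4 := mul_le_mul_of_nonneg_left (hM r hr) (mul_nonneg hS0.le hW.le)
      have h5 := mul_le_mul_of_nonneg_right hSM hW.le
      nlinarith }

theorem contDiffAt_shape {r₀ : ℝ} (hp : 1 < p) (hg : IsPowerlike g α₁ α₂) (h₁ : 0 < α₁)
    (h₀ : 0 < r₀) : ContDiffAt ℝ 1 (shape p g r₀) r₀ := by
  rw [contDiffAt_one_iff]
  refine ⟨fun r => ContinuousLinearMap.toSpanSingleton ℝ (shapeSlope p g r₀ r), Ioi 0,
    Ioi_mem_nhds h₀, ?_, fun r hr => (hasDerivAt_shape hp hg h₁ h₀ hr).hasFDerivAt⟩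
  exact (ContinuousLinearMap.toSpanSingletonCLE (𝕜 := ℝ) (E := ℝ)).continuous.comp_continuousOn
    ((continuousOn_shapeSlope hp hg h₁ h₀).mono Ioi_subset_Ici_self)

/-- Power growth of G gives G(γs) ≤ γ^{α₁}G(s), and G ≤ g/α₁. Applied at s = g^{-1}(log t), this
trades the inverse of G in the front for the inverse of g. -/
theorem bigG_mul_le (hg : IsPowerlike g α₁ α₂) (h₁ : 0 < α₁) {Γ γ s : ℝ} (hγ : 0 < γ)
    (hγ1 : γ ≤ 1) (hγΓ : γ ^ α₁ ≤ α₁ * Γ) (hs : 0 < s) : bigG g (γ * s) ≤ Γ * g s := by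
  have h := hg.bigG_mul_rpow_le h₁ (mul_pos hγ hs) (mul_le_of_le_one_left hs.le hγ1)
  rw [Real.mul_rpow hγ.le hs.le, ← mul_assoc] at h
  have h2 : bigG g (γ * s) ≤ bigG g s * γ ^ α₁ := le_of_mul_le_mul_right h (by positivity)
  have hG := hg.bigG_pos h₁ hs
  have hgs := hg.pos s hs
  have hΓ : 0 < Γ := pos_of_mul_pos_right ((Real.rpow_pos_of_pos hγ _).trans_le hγΓ) h₁.le
  calc bigG g (γ * s) ≤ bigG g s * γ ^ α₁ := h2
    _ ≤ bigG g s * (α₁ * Γ) := by gcongr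
    _ = Γ * (α₁ * bigG g s) := by ring
    _ ≤ Γ * g s := by gcongr; exact hg.mul_bigG_le h₁ hs.le

end IsPowerlike

/-! ### From almost everywhere bounds to the essential support. -/

theorem ball_subset_essSupport {v w : Space N → ℝ} {R : ℝ} (hvw : ∀ᵐ x, v x ≤ w x)
    (hv : ∀ x, ‖x‖ < R → 0 < v x) : Metric.ball (0 : Space N) R ⊆ essSupport w := by
  intro x hx U hU hzero
  obtain ⟨O, hOU, hO, hxO⟩ := mem_nhds_iff.1 hU
  have hO' : IsOpen (O ∩ Metric.ball (0 : Space N) R) := hO.inter Metric.isOpen_ball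
  have h1 : ∀ᵐ y ∂(volume.restrict (O ∩ Metric.ball (0 : Space N) R)), w y = 0 :=
    ae_mono (Measure.restrict_mono (inter_subset_left.trans hOU) le_rfl) hzero
  have h2 : ∀ᵐ y ∂(volume.restrict (O ∩ Metric.ball (0 : Space N) R)), False := by
    filter_upwards [h1, ae_restrict_of_ae hvw, ae_restrict_mem hO'.measurableSet] with y hy hy2 hy3
    have := hv y (mem_ball_zero_iff.1 hy3.2)
    linarith
  have h3 : volume (O ∩ Metric.ball (0 : Space N) R) = 0 := by
    rw [ae_iff] at h2
    simpa using h2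
  exact (hO'.measure_pos volume ⟨x, hxO, hx⟩).ne' h3

end

end

end WeightedParabolic

/-! ### The theorem: comparison with the barrier and the radius of its support. -/

open WeightedParabolic WeightedParabolic.IsPowerlike

/-- Subsolution barriers from below for strong solutions of the weighted doubly degenerate
parabolic Cauchy problem, and the resulting lower bound for the support. The constants are
chosen before the initial datum and the solution. -/
theorem theorem1p4 (N : ℕ) (p m α₁ α₂ : ℝ) (g : ℝ → ℝ)
    (hp : 1 < p) (hpN : p < N) (hpm : 0 < p + m - 3)
    (hα₁ : 0 < α₁) (hα : α₁ ≤ α₂) (hα₂ : α₂ < p)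
    (hg : WeightedParabolic.IsPowerlike g α₁ α₂)
    (ε ℓ : ℝ) (hε : 0 < ε) (hℓ : 0 < ℓ) :
    ∃ t₀ C Γ r₀ ν₀ γ : ℝ, 1 < t₀ ∧ 0 < C ∧ 0 < Γ ∧ 0 < r₀ ∧ 0 < ν₀ ∧ ν₀ < 1 ∧ 0 < γ ∧
      (∀ t, 0 ≤ t →
        ContDiffAt ℝ 1 (fun r => WeightedParabolic.profile p m g C Γ t₀ r₀ ν₀ r t) r₀) ∧
      WeightedParabolic.IsStrongSubsolution (N := N) p m g
        (WeightedParabolic.barrier p m g C Γ t₀ r₀ ν₀) ∧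
      ∀ (u₀ : WeightedParabolic.Space N → ℝ) (u : WeightedParabolic.Space N × ℝ → ℝ),
        (∀ᵐ x : WeightedParabolic.Space N, 0 ≤ u₀ x) →
        MemLp u₀ ∞ volume →
        (∃ R : ℝ, ∀ᵐ x : WeightedParabolic.Space N, R < ‖x‖ → u₀ x = 0) →
        (∀ᵐ x : WeightedParabolic.Space N, ‖x‖ ≤ ℓ → ε ≤ u₀ x) →
        WeightedParabolic.IsStrongCauchySolution p m g u₀ u →
        (∀ t, 0 < t → ∀ᵐ x : WeightedParabolic.Space N,
          WeightedParabolic.barrier p m g C Γ t₀ r₀ ν₀ (x, t) ≤ u (x, t)) ∧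
        (∀ t, t₀ < t →
          Metric.ball (0 : WeightedParabolic.Space N)
              (γ * WeightedParabolic.radialInv g (Real.log t)) ⊆
            WeightedParabolic.essSupport (fun x => u (x, t))) := by

  -- The matching radius must lie strictly inside the initial front ℓ, so that the barrier is
  -- positive near r₀ at all times.
  have hr₀ : 0 < ℓ / 2 := by positivity
  have hlt : ℓ / 2 < ℓ := by linarith
  obtain ⟨C, Γ, hC, hΓ, hCε, e', h⟩ := exists_barrierData (N := N) hp hpN hpm hg hα₁ hα₂ hε hℓ
  obtain ⟨t₀, ht₀⟩ : ∃ t₀, t₀ = Real.exp (bigG g ℓ / Γ) := ⟨_, rfl⟩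
  rw [← ht₀] at h
  have hGℓ := hg.bigG_pos hα₁ hℓ
  have hGr := hg.bigG_pos hα₁ hr₀
  have hgr := hg.pos _ hr₀
  have ht₀1 : 1 < t₀ := by rw [ht₀, Real.one_lt_exp_iff]; positivity
  have hratio : g (ℓ / 2) / (p * bigG g (ℓ / 2)) < 1 := by
    rw [div_lt_one (by positivity)]
    calc g (ℓ / 2) ≤ α₂ * bigG g (ℓ / 2) := hg.le_mul_bigG hα₁ hr₀.le
      _ < p * bigG g (ℓ / 2) := by gcongr
  have hratio0 : 0 < g (ℓ / 2) / (p * bigG g (ℓ / 2)) := by positivity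
  -- The second entry ensures γ^{α₁} ≤ α₁Γ, the first that γs ≤ s; both are needed to compare G(γs)
  -- with Γg(s).
  set γ : ℝ := min 1 ((α₁ * Γ) ^ (1 / α₁)) with hγ
  have hγ0 : 0 < γ := by rw [hγ]; positivity
  have hγΓ : γ ^ α₁ ≤ α₁ * Γ := by
    calc γ ^ α₁ ≤ ((α₁ * Γ) ^ (1 / α₁)) ^ α₁ :=
          Real.rpow_le_rpow hγ0.le (min_le_right _ _) hα₁.le
      _ = α₁ * Γ := by
          rw [← Real.rpow_mul (by positivity), one_div_mul_cancel hα₁.ne', Real.rpow_one]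
  have hmono := strictMonoOn_shape hp hα₂ hg hα₁ hr₀
  have hlevel : ∀ t, 0 ≤ t → ℓ ≤ radialInv (bigG g) (Γ * Real.log (t + t₀)) ∧
      bigE p g (Γ * Real.log (t + t₀)) ^ (1 / (p - 1))
        = shape p g (ℓ / 2) (radialInv (bigG g) (Γ * Real.log (t + t₀))) := fun t ht => by
    have h1 := (hg.le_radialInv_log hα₁ hℓ hΓ ht₀ ht).2
    exact ⟨h1, bigE_rpow_eq_shape (hlt.le.trans h1)⟩
  -- With this ν₀ the barrier unfolds to `radialBarrier` for `shape`, so the subsolution property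
  -- applies without rewriting.
  refine ⟨t₀, C, Γ, ℓ / 2, 1 - g (ℓ / 2) / (p * bigG g (ℓ / 2)), γ, ht₀1, hC, hΓ, hr₀,
    by linarith, by linarith, hγ0, fun t ht => ?_, h.isStrongSubsolution, ?_⟩
  · obtain ⟨h1, h2⟩ := hlevel t ht
    have hpos : 0 < bigE p g (Γ * Real.log (t + t₀)) ^ (1 / (p - 1)) - shape p g (ℓ / 2) (ℓ / 2) := by
      rw [h2, sub_pos]
      exact hmono hr₀.le (hℓ.le.trans h1) (hlt.trans_le h1)
    have hs := contDiffAt_shape hp hg hα₁ hr₀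
    have hd : ContDiffAt ℝ 1 (fun r => C / (t + t₀) ^ (1 / (p + m - 3)) *
        (bigE p g (Γ * Real.log (t + t₀)) ^ (1 / (p - 1)) - shape p g (ℓ / 2) r)
          ^ ((p - 1) / (p + m - 3))) (ℓ / 2) :=
      contDiffAt_const.mul ((contDiffAt_const.sub hs).rpow_const_of_ne hpos.ne')
    -- Near r₀ the gap is positive, so the positive part is inactive and the outer power is smooth
    -- there.
    refine hd.congr_of_eventuallyEq ?_
    filter_upwards [(continuousAt_const.sub hs.continuousAt).eventually (Ioi_mem_nhds hpos)]
      with r hr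
    change C / (t + t₀) ^ (1 / (p + m - 3)) * (max 0 (bigE p g (Γ * Real.log (t + t₀)) ^ (1 / (p - 1))
      - shape p g (ℓ / 2) r)) ^ ((p - 1) / (p + m - 3)) = _
    rw [max_eq_right]
    exact le_of_lt hr
  intro u₀ u hu₀ _ _ hu₀ε hu
  have hcomp : ∀ t, 0 ≤ t → ∀ᵐ x : Space N,
      barrier p m g C Γ t₀ (ℓ / 2) (1 - g (ℓ / 2) / (p * bigG g (ℓ / 2))) (x, t) ≤ u (x, t) := by
    refine h.isStrongSubsolution.le_of_isStrongSolution hp hpm hg.continuousOn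
      (fun s hs => hg.nonneg hs) hu.1 ?_ fun T => ?_
    · filter_upwards [hu₀, hu₀ε, hu.2] with x hx hxε hxu
      rw [hxu]
      -- The initial level is Φ(ℓ). The barrier thus starts from zero outside the ball of radius ℓ
      -- and, since t₀ > 1, from at most C Φ(ℓ)^b ≤ ε inside.
      have he0 : bigE p g (Γ * Real.log (0 + t₀)) ^ (1 / (p - 1)) = shape p g (ℓ / 2) ℓ := by
        rw [(hlevel 0 le_rfl).2, zero_add, ht₀, Real.log_exp, mul_div_cancel₀ _ hΓ.ne',
          hg.radialInv_bigG hα₁ hℓ.le]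
      simp only [radialBarrier, he0]
      rcases le_or_gt ‖x‖ ℓ with hxl | hxl
      · refine le_trans ?_ (hxε hxl)
        refine le_trans ?_ hCε
        have h1 : C / (0 + t₀) ^ (1 / (p + m - 3)) ≤ C := by
          refine div_le_self hC.le (Real.one_le_rpow (by linarith) (by positivity))
        have h2 : max 0 (shape p g (ℓ / 2) ℓ - shape p g (ℓ / 2) ‖x‖) ≤ shape p g (ℓ / 2) ℓ :=
          max_le (shape_pos hp hg hα₁ hr₀ hlt.le).le (by linarith [h.shape_norm_nonneg x])
        have hb := h.b_pos
        gcongr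
      · have h1 := hmono.monotoneOn hℓ.le (norm_nonneg x) hxl.le
        rw [max_eq_left (by linarith), Real.zero_rpow h.b_pos.ne', mul_zero]
        exact hx
    · obtain ⟨ρ, hρ, hz⟩ := h.exists_radialBarrier_eq_zero (le_max_right T 0)
      exact ⟨ρ, hρ, fun t ht htT x hx => hz t ht (htT.trans (le_max_left _ _)) x hx⟩
  refine ⟨fun t ht => hcomp t ht.le, fun t ht => ?_⟩
  have ht1 : 1 < t := ht₀1.trans ht
  have ht0 : 0 ≤ t := by linarith
  have hlog : 0 < Real.log t := Real.log_pos ht1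
  refine ball_subset_essSupport (hcomp t ht0) fun x hx => ?_
  have hsurj := hg.surjOn hα₁
  have hgs : g (radialInv g (Real.log t)) = Real.log t := apply_radialInv hsurj hlog.le
  have hs : 0 < radialInv g (Real.log t) := by
    refine (radialInv_mem hsurj hlog.le).lt_of_ne fun h0 => ?_
    rw [← h0, hg.map_zero] at hgs
    exact hlog.ne hgs
  have hlogt : Real.log t < Real.log (t + t₀) := Real.log_lt_log (by linarith) (by linarith)
  obtain ⟨hρ, he⟩ := hlevel t ht0
  -- The front lies strictly beyond the claimed radius; applying G reduces this to G(γ g^{-1}(log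
  -- t)) ≤ Γ log t < Γ log(t+t₀).
  have hlt' : γ * radialInv g (Real.log t) < radialInv (bigG g) (Γ * Real.log (t + t₀)) := by
    rw [← (hg.strictMonoOn_bigG hα₁).lt_iff_lt (mul_pos hγ0 hs).le (hℓ.le.trans hρ),
      apply_radialInv (hg.surjOn_bigG hα₁) (by positivity [hlog.trans hlogt])]
    calc bigG g (γ * radialInv g (Real.log t)) ≤ Γ * g (radialInv g (Real.log t)) :=
          hg.bigG_mul_le hα₁ hγ0 (min_le_left _ _) hγΓ hs
      _ < _ := by rw [hgs]; gcongr
  have hgap := hmono (norm_nonneg x) (hℓ.le.trans hρ) (hx.trans hlt')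
  rw [← he] at hgap
  change 0 < C / (t + t₀) ^ (1 / (p + m - 3)) * (max 0 (bigE p g (Γ * Real.log (t + t₀)) ^ (1 / (p - 1))
      - shape p g (ℓ / 2) ‖x‖)) ^ ((p - 1) / (p + m - 3))
  rw [max_eq_right (sub_pos.2 hgap).le]
  have := sub_pos.2 hgap
  positivity
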